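/- Let $n,k,\ell,p$ be nonnegative integers with $p\ge 1$ and $k\le \ell+p-1$. For a real vector space $V$ put $\mathrm{Alt}^{k,\ell}(V)=\mathrm{Alt}^k(V)\otimes \mathrm{Alt}^\ell(V)$ (alternating $k$-forms with values in alternating $\ell$-forms; spaces with a negative index are $0$), and let $\mathcal S_\dagger:\mathrm{Alt}^{k,\ell}\to \mathrm{Alt}^{k-1,\ell+1}$, $$\mathcal S_\dagger\omega(v_1,\dots,v_{k-1})(u_1,\dots,u_{\ell+1})=\sum_{j=1}^{\ell+1}(-1)^{j+1}\omega(u_j,v_1,\dots,v_{k-1})(u_1,\dots,\widehat{u_j},\dots,u_{\ell+1}),$$ with $p$-fold composition $\mathcal S_{\dagger,[p]}:\mathrm{Alt}^{k,\ell}\to\mathrm{Alt}^{k-p,\ell+p}$. For a simplex $\sigma\subset\mathbb R^n$, $\mathcal P^-\mathrm{Alt}^{k,\ell}(\sigma)=\mathrm{Alt}^{k,\ell}(\sigma)+\kappa\,\mathrm{Alt}^{k+1,\ell}(\sigma)$, where $\kappa$ is the contraction of the first slot with the position vector (relative to any origin in the affine hull of $\sigma$) and the forms live on the tangent space of $\sigma$;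 $\mathcal P^-\mathbb W^{k,\ell}_{[p]}(\sigma)$ is the kernel of $\mathcal S_{\dagger,[p]}$ in it. The bubble space $\mathcal B^-\mathrm{Alt}^{k,\ell}(\sigma)$ consists of the $\omega\in\mathcal P^-\mathrm{Alt}^{k,\ell}(\sigma)$ whose double pullback $\iota_F^*\iota_F^*\omega$ (both slots) vanishes on every proper subsimplex $F$ of $\sigma$, and $\mathcal B^-\mathbb W^{k,\ell}_{[p]}(\sigma)$ is the kernel of $\mathcal S_{\dagger,[p]}$ in it. For $q\le \ell$ let $\vartheta^*_{\sigma,q}$ map an $\ell$-form on $\mathbb R^n$ to its component in $\mathrm{Alt}^q(\sigma)\otimes \mathrm{Alt}^{\ell-q}(\sigma^\perp)$ ($q$ tangential, $\ell-q$ normal arguments; $0$ if $q<0$ or $q>\ell$); for $\dim\sigma=m$ let $\jmath^*_{\sigma,[p]}=\bigoplus_{s=0}^{p-1}\vartheta^*_{\sigma,m-s}$. In $\iota_\sigma^*\vartheta^*_{\sigma,q}$ the pullback acts on the first slot and $\vartheta^*_{\sigma,q}$ on the second. $\langle\cdot,\cdot\rangle_\sigma$ is the integral over $\sigma$ ($\dim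 \sigma$-dimensional measure) of the pointwise Frobenius product. (a) Let $K\subset \mathbb R^n$ be an $n$-simplex. The degrees of freedom $$\begin{cases}\langle \iota_\sigma^*\vartheta^*_{\sigma,k-s}\,\omega,b\rangle_\sigma, & b\in \mathrm{Alt}^k(\sigma)\otimes \mathrm{Alt}^{k-s}(\sigma)\otimes\mathrm{Alt}^{\ell-k+s}(\sigma^\perp),\ s=0,\dots,p-1,\ \dim\sigma=k,\\ \langle\iota_\sigma^*\iota_\sigma^*\omega,b\rangle_\sigma,& b\in\mathcal B^-\mathrm{Alt}^{k,\ell}(\sigma),\ \dim\sigma\ge \ell+p,\end{cases}$$ for $\sigma$ ranging over the subsimplices of $K$ (the one-dimensional factor $\mathrm{Alt}^k(\sigma)$ is spanned by the volume form), are unisolvent for $\mathcal P^-\mathrm{Alt}^{k,\ell}(K)$: prescribed values, linear in the test functions, are attained by exactly one shape function. The same degrees of freedom with $\mathcal B^-\mathbb W^{k,\ell}_{[p]}(\sigma)$ in place of $\mathcal B^-\mathrm{Alt}^{k,\ell}(\sigma)$ are unisolvent for $\mathcal P^-\mathbb W^{k,\ell}_{[p]}(K)$. (b) For every $s=0,\dots,p-1$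 the number of bubble moments on the $(\ell+s)$-faces equals the number of moments of $\iota^*\vartheta^*_{\sigma,k-s}$ on the $k$-faces: $$\sum_{F\subseteq K,\ \dim F=\ell+s}\dim\mathcal B^-\mathrm{Alt}^{k,\ell}(F)=\sum_{\sigma\subseteq K,\ \dim\sigma=k}\dim\big(\mathrm{Alt}^{k-s}(\sigma)\otimes\mathrm{Alt}^{\ell-k+s}(\sigma^\perp)\big),$$ and likewise with $\mathcal B^-\mathbb W^{k,\ell}_{[p]}(F)$ on the left. (c) For every simplicial complex $\mathcal T$ in $\mathbb R^n$, both resulting finite element spaces (piecewise shape functions on the $n$-cells of $\mathcal T$ whose degrees of freedom are single-valued on shared simplices) are $\iota^*\jmath^*_{[p]}$-conforming: for each simplex $\sigma$ shared by two $n$-cells, $\iota_\sigma^*\jmath^*_{\sigma,[p]}\omega$ takes the same value from both cells if $\dim\sigma\le\ell+p-1$, and $\iota_\sigma^*\iota_\sigma^*\omega$ takes the same value from both cells if $\dim \sigma\ge\ell+p$. -/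

import Mathlib

open MeasureTheory

noncomputable section

namespace FormValued

/-! ### Alternating form-valued alternating forms -/

/-- `Alt^{k,ℓ}(V) = Alt^k(V) ⊗ Alt^ℓ(V)`: alternating `k`-forms on `V` with values in the alternating
`ℓ`-forms on `V`; `ω v u` is `ω(v₁, …, v_k)(u₁, …, u_ℓ)`. -/
abbrev FF (k ℓ : ℕ) (V : Type*) [AddCommGroup V] [Module ℝ V] : Type _ :=
  V [⋀^Fin k]→ₗ[ℝ] (V [⋀^Fin ℓ]→ₗ[ℝ] ℝ)

section Algebra

variable {V : Type*} [AddCommGroup V] [Module ℝ V]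

/-- For fixed `v₁, …, v_k`, the alternating map
`(u₁, …, u_{ℓ+1}) ↦ ∑_j (-1)^{j+1} ω(u_j, v₁, …, v_k)(u₁, …, û_j, …, u_{ℓ+1})`. -/
def sdagSucc (k ℓ : ℕ) (ω : FF (k + 1) ℓ V) : FF k (ℓ + 1) V where
  toFun v := AlternatingMap.alternatizeUncurryFin
    { toFun := fun u => ω.curryLeft u v
      map_add' := fun _ _ => by rw [map_add]; rfl
      map_smul' := fun _ _ => by rw [map_smul]; rfl }
  map_update_add' v i x y := by
    ext u
    simp [AlternatingMap.alternatizeUncurryFin_apply, Finset.sum_add_distrib,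
      AlternatingMap.map_update_add, -AlternatingMap.curryLeft_apply_apply, smul_add]
  map_update_smul' v i c x := by
    ext u
    simp [AlternatingMap.alternatizeUncurryFin_apply, Finset.mul_sum,
      AlternatingMap.map_update_smul, -AlternatingMap.curryLeft_apply_apply, mul_left_comm]
  map_eq_zero_of_eq' v i j hv hij := by
    ext u
    simp [AlternatingMap.alternatizeUncurryFin_apply, -AlternatingMap.curryLeft_apply_apply,
      AlternatingMap.map_eq_zero_of_eq _ v hv hij]

theorem sdagSucc_apply (k ℓ : ℕ) (ω : FF (k + 1) ℓ V) (v : Fin k → V) (u : Fin (ℓ + 1) → V) :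
    sdagSucc k ℓ ω v u =
      ∑ j : Fin (ℓ + 1), (-1) ^ (j : ℕ) • ω (Fin.cons (u j) v) (Fin.removeNth j u) :=
  AlternatingMap.alternatizeUncurryFin_apply _ _

/-- `S_†^{k,ℓ} : Alt^{k,ℓ}(V) → Alt^{k-1,ℓ+1}(V)`; it is the zero map for `k = 0`. -/
def sdag : (k ℓ : ℕ) → FF k ℓ V →ₗ[ℝ] FF (k - 1) (ℓ + 1) V
  | 0, _ => 0
  | k + 1, ℓ =>
    { toFun := sdagSucc k ℓ
      map_add' := fun ω η => by
        ext v u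
        simp [sdagSucc_apply, Finset.sum_add_distrib]
      map_smul' := fun c ω => by
        ext v u
        simp [sdagSucc_apply, Finset.mul_sum, mul_left_comm] }

/-- `S_{†,[p]}^{k,ℓ} = S_†^{k-p+1,ℓ+p-1} ∘ ⋯ ∘ S_†^{k,ℓ} : Alt^{k,ℓ}(V) → Alt^{k-p,ℓ+p}(V)`.
It is the zero map for `p > k`, where `Alt^{k-p,ℓ+p}(V)` stands for the zero space. -/
def sdagIter (k ℓ : ℕ) : (p : ℕ) → FF k ℓ V →ₗ[ℝ] FF (k - p) (ℓ + p) V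
  | 0 => LinearMap.id
  | p + 1 => sdag (k - p) (ℓ + p) ∘ₗ sdagIter k ℓ p

/-- Pull-back of both form slots along a linear map. -/
def pullback {W : Type*} [AddCommGroup W] [Module ℝ W] (k ℓ : ℕ) (f : W →ₗ[ℝ] V)
    (ω : FF k ℓ V) : FF k ℓ W :=
  ({ toFun := fun α => α.compLinearMap f
     map_add' := fun _ _ => rfl
     map_smul' := fun _ _ => rfl } :
    (V [⋀^Fin ℓ]→ₗ[ℝ] ℝ) →ₗ[ℝ] (W [⋀^Fin ℓ]→ₗ[ℝ] ℝ)).compAlternatingMap (ω.compLinearMap f)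

/-- `P^- Alt^{k,ℓ} = Alt^{k,ℓ} + κ Alt^{k+1,ℓ}`, as a space of functions on a set `S` of points,
where `pos x` is the Euler (position) vector at `x ∈ S` and `κ` contracts it into the first slot:
`(κ b)_x (v₁, …, v_k) = b(pos x, v₁, …, v_k)`. -/
def whitneySpace (k ℓ : ℕ) {S : Type*} (pos : S → V) : Submodule ℝ (S → FF k ℓ V) where
  carrier := {ω | ∃ (a : FF k ℓ V) (b : FF (k + 1) ℓ V), ∀ x, ω x = a + b.curryLeft (pos x)}
  zero_mem' := ⟨0, 0, fun _ => by simp⟩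
  add_mem' := by
    rintro ω η ⟨a, b, h⟩ ⟨a', b', h'⟩
    refine ⟨a + a', b + b', fun x => ?_⟩
    rw [Pi.add_apply, h, h', AlternatingMap.curryLeft_add, LinearMap.add_apply]
    abel
  smul_mem' := by
    rintro c ω ⟨a, b, h⟩
    refine ⟨c • a, c • b, fun x => ?_⟩
    rw [Pi.smul_apply, h, AlternatingMap.curryLeft_smul, LinearMap.smul_apply, smul_add]

/-- The `Alt^{k,ℓ}(V)`-valued functions on `S` with values in
`W_{[p]}^{k,ℓ} = ker (S_{†,[p]}^{k,ℓ})`. -/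
def symmetric (k ℓ p : ℕ) (S V : Type*) [AddCommGroup V] [Module ℝ V] :
    Submodule ℝ (S → FF k ℓ V) :=
  LinearMap.ker ((sdagIter (V := V) k ℓ p).compLeft S)

/-- For fixed `t₁, …, t_q` in `A`, the alternating map
`(ν₁, …, ν_r) ↦ α(t₁, …, t_q, ν₁, …, ν_r)` on `B`, where `q + r = ℓ`. -/
def componentAux (A B : Submodule ℝ V) {ℓ q r : ℕ} (h : q + r = ℓ) (α : V [⋀^Fin ℓ]→ₗ[ℝ] ℝ)
    (t : Fin q → A) : B [⋀^Fin r]→ₗ[ℝ] ℝ where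
  toFun ν := α.domDomCongr (finSumFinEquiv.trans (finCongr h)).symm
    (Sum.elim (A.subtype ∘ t) (B.subtype ∘ ν))
  map_update_add' ν i x y := by
    classical
    simp only [Function.comp_update, ← Sum.update_elim_inr, map_add,
      AlternatingMap.map_update_add]
  map_update_smul' ν i c x := by
    classical
    simp only [Function.comp_update, ← Sum.update_elim_inr, map_smul,
      AlternatingMap.map_update_smul]
  map_eq_zero_of_eq' ν i j hν hij :=
    (α.domDomCongr (finSumFinEquiv.trans (finCongr h)).symm).map_eq_zero_of_eq
      (i := Sum.inr i) (j := Sum.inr j) _ (congrArg B.subtype hν) (fun e => hij (Sum.inr.inj e))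

/-- The component of an alternating `ℓ`-form `α` on `V` with `q` arguments in `A` and `r` arguments
in `B`, for `q + r = ℓ`, as an element of `Alt^q(A) ⊗ Alt^r(B)`:
`(t, ν) ↦ α(t₁, …, t_q, ν₁, …, ν_r)`. -/
def component (A B : Submodule ℝ V) {ℓ q r : ℕ} (h : q + r = ℓ) :
    (V [⋀^Fin ℓ]→ₗ[ℝ] ℝ) →ₗ[ℝ] (A [⋀^Fin q]→ₗ[ℝ] (B [⋀^Fin r]→ₗ[ℝ] ℝ)) where
  toFun α :=
    { toFun := componentAux A B h α
      map_update_add' := fun t i x y => AlternatingMap.ext fun ν => by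
        classical
        change α.domDomCongr _ _ = α.domDomCongr _ _ + α.domDomCongr _ _
        simp only [Function.comp_update, ← Sum.update_elim_inl, map_add,
          AlternatingMap.map_update_add]
      map_update_smul' := fun t i c x => AlternatingMap.ext fun ν => by
        classical
        change α.domDomCongr _ _ = c • α.domDomCongr _ _
        simp only [Function.comp_update, ← Sum.update_elim_inl, map_smul,
          AlternatingMap.map_update_smul]
      map_eq_zero_of_eq' := fun t i j ht hij => AlternatingMap.ext fun ν =>
        (α.domDomCongr (finSumFinEquiv.trans (finCongr h)).symm).map_eq_zero_of_eq
          (i := Sum.inl i) (j := Sum.inl j) _ (congrArg A.subtype ht)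
          (fun e => hij (Sum.inl.inj e)) }
  map_add' := fun _ _ => rfl
  map_smul' := fun _ _ => rfl

end Algebra

section FrobeniusProduct

variable {V : Type*} [NormedAddCommGroup V] [InnerProductSpace ℝ V] [FiniteDimensional ℝ V]

/-- The Frobenius product of alternating `k`-forms on `V` with values in `N`, relative to a product
`ip` on `N`: the sum of `ip (α(e_{i₁}, …, e_{i_k})) (β(e_{i₁}, …, e_{i_k}))` over all multi-indices,
for an orthonormal basis `e` of `V`. -/
def frobenius (k : ℕ) {N : Type*} [AddCommGroup N] [Module ℝ N] (ip : N → N → ℝ)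
    (α β : V [⋀^Fin k]→ₗ[ℝ] N) : ℝ :=
  ∑ f : Fin k → Fin (Module.finrank ℝ V),
    ip (α fun i => stdOrthonormalBasis ℝ V (f i)) (β fun i => stdOrthonormalBasis ℝ V (f i))

end FrobeniusProduct

/-! ### Simplices, given by their finite sets of vertices -/

/-- The ambient Euclidean space `ℝⁿ`. -/
abbrev Euc (n : ℕ) : Type := EuclideanSpace ℝ (Fin n)

variable {n : ℕ}

/-- `σ` is the vertex set of an `m`-dimensional simplex in `ℝⁿ`. -/
def IsSimplex (σ : Finset (Euc n)) (m : ℕ) : Prop :=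
  AffineIndependent ℝ ((↑) : σ → Euc n) ∧ σ.card = m + 1

/-- The closed simplex with vertex set `σ`, as a set of points. -/
abbrev cell (σ : Finset (Euc n)) : Set (Euc n) := convexHull ℝ (σ : Set (Euc n))

/-- The tangent space of the simplex `σ`. -/
abbrev tangent (σ : Finset (Euc n)) : Submodule ℝ (Euc n) := vectorSpan ℝ (σ : Set (Euc n))

/-- The normal space `σ^⊥` of the simplex `σ` in `ℝⁿ`. -/
abbrev normal (σ : Finset (Euc n)) : Submodule ℝ (Euc n) := (tangent σ)ᗮ

/-- The dimension of the simplex with vertex set `σ`. -/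
def dim (σ : Finset (Euc n)) : ℕ := σ.card - 1

/-- The `dim σ`-dimensional Lebesgue measure on the simplex `σ`. -/
def cellMeasure (σ : Finset (Euc n)) : Measure (cell σ) :=
  (μHE[dim σ] : Measure (Euc n)).comap Subtype.val

theorem sub_mem_tangent (σ : Finset (Euc n)) (x y : cell σ) : (x : Euc n) - y ∈ tangent σ := by
  rw [tangent, ← direction_affineSpan]
  exact AffineSubspace.vsub_mem_direction (convexHull_subset_affineSpan _ x.2)
    (convexHull_subset_affineSpan _ y.2)

/-- The position vector `x - x₀`, tangent to `σ`, of a point `x` of `σ`. -/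
def relPos (σ : Finset (Euc n)) (x₀ x : cell σ) : tangent σ :=
  ⟨(x : Euc n) - x₀, sub_mem_tangent σ x x₀⟩

/-- Form-valued forms on the simplex `σ`. -/
abbrev CellForm (k ℓ : ℕ) (σ : Finset (Euc n)) : Type :=
  cell σ → FF k ℓ (tangent σ)

/-- Form-valued forms on `ℝⁿ`. -/
abbrev Form (n k ℓ : ℕ) : Type := Euc n → FF k ℓ (Euc n)

/-! ### Shape functions and bubbles -/

/-- `P^- Alt^{k,ℓ}`: the shape functions on an `n`-dimensional cell `K` of `ℝⁿ`, written as
polynomial forms on `ℝⁿ`. -/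
def shapeAlt (n k ℓ : ℕ) : Submodule ℝ (Form n k ℓ) := whitneySpace k ℓ id

/-- `P^- W_{[p]}^{k,ℓ} = ker (S_{†,[p]} : P^- Alt^{k,ℓ} → P^- Alt^{k-p,ℓ+p})`. -/
def shapeW (n k ℓ p : ℕ) : Submodule ℝ (Form n k ℓ) :=
  shapeAlt n k ℓ ⊓ symmetric k ℓ p (Euc n) (Euc n)

/-- `P^- Alt^{k,ℓ}(σ)`. The space `Alt^{k,ℓ}(σ) + κ Alt^{k+1,ℓ}(σ)` does not depend on the point
`x₀` of `σ` that serves as origin, so that all the spaces joined here are the same. -/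
def cellAlt (k ℓ : ℕ) (σ : Finset (Euc n)) : Submodule ℝ (CellForm k ℓ σ) :=
  ⨆ x₀ : cell σ, whitneySpace k ℓ (relPos σ x₀)

/-- The double trace `ι_F^* ι_F^*` of a form on a simplex `σ` to a subsimplex `F`. -/
def cellTrace {k ℓ : ℕ} {F σ : Finset (Euc n)} (h : F ⊆ σ) (ω : CellForm k ℓ σ) :
    CellForm k ℓ F := fun x =>
  pullback k ℓ (Submodule.inclusion (vectorSpan_mono ℝ (Finset.coe_subset.2 h)))
    (ω ⟨x, convexHull_mono (Finset.coe_subset.2 h) x.2⟩)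

/-- The double trace `ι_σ^* ι_σ^*` of a form on `ℝⁿ` to a simplex `σ`. -/
def doubleTrace {k ℓ : ℕ} (σ : Finset (Euc n)) (ω : Form n k ℓ) : CellForm k ℓ σ := fun x =>
  pullback k ℓ (tangent σ).subtype (ω x)

/-- The bubbles `B^- Alt^{k,ℓ}(σ)`: the elements of `P^- Alt^{k,ℓ}(σ)` whose double trace vanishes
on all proper subsimplices of `σ`. -/
def bubbleAlt (k ℓ : ℕ) (σ : Finset (Euc n)) : Submodule ℝ (CellForm k ℓ σ) where
  carrier := {ω | ω ∈ cellAlt k ℓ σ ∧ ∀ (F : Finset (Euc n)) (h : F ⊂ σ), F.Nonempty →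
    cellTrace h.subset ω = 0}
  zero_mem' := ⟨zero_mem _, fun _ _ _ => rfl⟩
  add_mem' := by
    rintro ω η ⟨h, h'⟩ ⟨g, g'⟩
    refine ⟨add_mem h g, fun F hF hne => ?_⟩
    have e : cellTrace hF.subset (ω + η) = cellTrace hF.subset ω + cellTrace hF.subset η := rfl
    rw [e, h' F hF hne, g' F hF hne, add_zero]
  smul_mem' := by
    rintro c ω ⟨h, h'⟩
    refine ⟨Submodule.smul_mem _ c h, fun F hF hne => ?_⟩
    have e : cellTrace hF.subset (c • ω) = c • cellTrace hF.subset ω := rfl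
    rw [e, h' F hF hne, smul_zero]

/-- `B^- W_{[p]}^{k,ℓ}(σ) = ker (S_{†,[p]} : B^- Alt^{k,ℓ}(σ) → B^- Alt^{k-p,ℓ+p}(σ))`. -/
def bubbleW (k ℓ p : ℕ) (σ : Finset (Euc n)) : Submodule ℝ (CellForm k ℓ σ) :=
  bubbleAlt k ℓ σ ⊓ symmetric k ℓ p (cell σ) (tangent σ)

/-! ### Generalized traces -/

/-- `Alt^q(σ) ⊗ Alt^r(σ^⊥)`. -/
abbrev TanNor (σ : Finset (Euc n)) (q r : ℕ) : Type :=
  tangent σ [⋀^Fin q]→ₗ[ℝ] (normal σ [⋀^Fin r]→ₗ[ℝ] ℝ)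

/-- `Alt^k(σ) ⊗ Alt^q(σ) ⊗ Alt^r(σ^⊥)`. -/
abbrev FormTanNor (σ : Finset (Euc n)) (k q r : ℕ) : Type :=
  tangent σ [⋀^Fin k]→ₗ[ℝ] TanNor σ q r

/-- The indices of the components `ϑ_{F,m-s}^*`, `0 ≤ s ≤ p - 1`, of the generalized trace
`ȷ_{F,[p]}^*` of `ℓ`-forms on a simplex `F` of dimension `m`; here `q = m - s` is the number of
tangential arguments and `r = ℓ - m + s` the number of normal ones. Indices with `q` or `r` negative
are left out, as their components lie in the zero space. -/
structure TraceIndex (m ℓ p : ℕ) where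
  s : ℕ
  q : ℕ
  r : ℕ
  lt : s < p
  tan : q + s = m
  nor : q + r = ℓ

/-- The trace `ι_σ^* ϑ_{σ,q}^*`: the first slot is pulled back to `σ`, and from the second slot the
component with `q` arguments tangent and `r = ℓ - q` arguments normal to `σ` is taken. -/
def mixedTrace {k ℓ q r : ℕ} (h : q + r = ℓ) (σ : Finset (Euc n)) (ω : Form n k ℓ) :
    cell σ → FormTanNor σ k q r := fun x =>
  (component (tangent σ) (normal σ) h).compAlternatingMap
    ((ω x).compLinearMap (tangent σ).subtype)

/-! ### Degrees of freedom -/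

/-- `⟨ι_σ^* ϑ_{σ,q}^* ω, b⟩_σ` for a constant `b`. (On a simplex of dimension `k` the factor
`Alt^k(σ)` is the line of volume forms.) -/
def skeletalDof {k ℓ q r : ℕ} (h : q + r = ℓ) (σ : Finset (Euc n)) (ω : Form n k ℓ)
    (b : FormTanNor σ k q r) : ℝ :=
  ∫ x, frobenius k (frobenius q (frobenius r (· * ·))) (mixedTrace h σ ω x) b ∂cellMeasure σ

/-- `⟨ι_σ^* ι_σ^* ω, b⟩_σ`. -/
def bubbleDof {k ℓ : ℕ} (σ : Finset (Euc n)) (ω : Form n k ℓ) (b : CellForm k ℓ σ) : ℝ :=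
  ∫ x, frobenius k (frobenius ℓ (· * ·)) (doubleTrace σ ω x) (b x) ∂cellMeasure σ

/-- Unisolvency, for the shape function space `X` on the cell `K`, of the degrees of freedom
* `⟨ι_σ^* ϑ_{σ,k-s}^* ω, b⟩_σ`, `0 ≤ s ≤ p - 1`, for the subsimplices `σ` of `K` of dimension `k`,
* `⟨ι_σ^* ι_σ^* ω, b⟩_σ`, `b ∈ B σ`, for the subsimplices `σ` of `K` of dimension `≥ ℓ + p`:
arbitrary values of the degrees of freedom, depending linearly on the test functions `b`, are
attained by exactly one `ω ∈ X`. -/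
def IsUnisolvent {k ℓ : ℕ} (p : ℕ) (X : Submodule ℝ (Form n k ℓ))
    (B : ∀ σ : Finset (Euc n), Submodule ℝ (CellForm k ℓ σ)) (K : Finset (Euc n)) : Prop :=
  ∀ (c : ∀ (σ : Finset (Euc n)) (j : TraceIndex k ℓ p), Module.Dual ℝ (FormTanNor σ k j.q j.r))
    (d : ∀ σ : Finset (Euc n), Module.Dual ℝ (B σ)),
    ∃! ω : Form n k ℓ, ω ∈ X ∧
      (∀ σ ⊆ K, σ.Nonempty → dim σ = k → ∀ (j : TraceIndex k ℓ p) (b : FormTanNor σ k j.q j.r),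
        skeletalDof j.nor σ ω b = c σ j b) ∧
      (∀ σ ⊆ K, σ.Nonempty → ℓ + p ≤ dim σ → ∀ b : B σ, bubbleDof σ ω b = d σ b)

/-! ### The finite element space on a triangulation -/

/-- The `n`-dimensional cells of a simplicial complex in `ℝⁿ`. -/
abbrev Cells (T : Geometry.SimplicialComplex ℝ (Euc n)) : Type :=
  {K : Finset (Euc n) // K ∈ T.faces ∧ IsSimplex K n}

/-- The finite element space: piecewise forms whose restriction to each `n`-dimensional cell is in
`X` and whose degrees of freedom are single-valued on the simplices shared by two cells. -/
def feSpace {k ℓ : ℕ} (p : ℕ) (X : Submodule ℝ (Form n k ℓ))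
    (B : ∀ σ : Finset (Euc n), Submodule ℝ (CellForm k ℓ σ))
    (T : Geometry.SimplicialComplex ℝ (Euc n)) : Set (Cells T → Form n k ℓ) :=
  {ω | (∀ K, ω K ∈ X) ∧
    ∀ (K K' : Cells T) (σ : Finset (Euc n)), σ.Nonempty → σ ⊆ K → σ ⊆ K' →
      (dim σ = k → ∀ (j : TraceIndex k ℓ p) (b : FormTanNor σ k j.q j.r),
        skeletalDof j.nor σ (ω K) b = skeletalDof j.nor σ (ω K') b) ∧
      (ℓ + p ≤ dim σ → ∀ b ∈ B σ, bubbleDof σ (ω K) b = bubbleDof σ (ω K') b)}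

/-- `ι^* ȷ_{[p]}^*`-conformity of a piecewise form: `ι_σ^* ȷ_{σ,[p]}^*` is single-valued on the
simplices `σ` of dimension `≤ ℓ + p - 1`, and `ι_σ^* ι_σ^*` is single-valued on those of dimension
`≥ ℓ + p`. -/
def IsConforming {k ℓ : ℕ} (p : ℕ) (T : Geometry.SimplicialComplex ℝ (Euc n))
    (ω : Cells T → Form n k ℓ) : Prop :=
  ∀ (K K' : Cells T) (σ : Finset (Euc n)), σ.Nonempty → σ ⊆ K → σ ⊆ K' →
    (dim σ < ℓ + p → ∀ j : TraceIndex (dim σ) ℓ p,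
      mixedTrace j.nor σ (ω K) = mixedTrace j.nor σ (ω K')) ∧
    (ℓ + p ≤ dim σ → doubleTrace σ (ω K) = doubleTrace σ (ω K'))

/-! ### Counting degrees of freedom -/

/-- `dim (Alt^{k-s}(σ) ⊗ Alt^{ℓ-k+s}(σ^⊥))`, which is `0` if one of the degrees is negative. -/
def skeletalCount (k ℓ s : ℕ) (σ : Finset (Euc n)) : ℕ :=
  if s ≤ k ∧ k ≤ ℓ + s then Module.finrank ℝ (TanNor σ (k - s) (ℓ + s - k)) else 0

/-- On the cell `K`, for every `s = 0, …, p - 1`, the number of `ι^* ι^*` bubble moments on the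
subsimplices of dimension `ℓ + s` is the number of moments of `ι^* ϑ_{σ,k-s}^*` on the subsimplices
`σ` of dimension `k`. -/
def CountsMatch {k ℓ : ℕ} (p : ℕ)
    (B : ∀ σ : Finset (Euc n), Submodule ℝ (CellForm k ℓ σ)) (K : Finset (Euc n)) : Prop :=
  ∀ s < p, ∑ F ∈ K.powersetCard (ℓ + s + 1), Module.finrank ℝ (B F) =
    ∑ σ ∈ K.powersetCard (k + 1), skeletalCount k ℓ s σ

end FormValued

end

noncomputable section

namespace FormValued

/-! ### Alternating maps -/

section Alternating

variable {V N : Type*} [AddCommGroup V] [Module ℝ V] [AddCommGroup N] [Module ℝ N]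

/-! Uniqueness and conformity come from one vanishing principle, existence from a dimension count.

Vanishing. Suppose the degrees of freedom of `η` on all subsimplices of `σ` are zero. On a `k`-face
`τ` the pullback of the first slot is constant, because the `κ` part is a `(k+1)`-form on a
`k`-dimensional space. The skeletal moments therefore say that the `ℓ`-form `η(v)`, with `v` tangent
to `τ`, vanishes as soon as `k + 1 - p` of its arguments are tangent to `τ`. Enlarging `τ` to an
`m`-simplex adds `m - k` directions, and an alternating form uses each of them at most once; so the
same `ℓ`-form vanishes once `m + 1 - p` arguments are tangent to the larger simplex
(`VanishesOn.mono_left`). A Whitney form is determined by its values on `k`-faces (`whitney_ext`),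
hence the generalized trace on `σ` vanishes, and so does the double trace if `m < ℓ + p`. From
dimension `ℓ + p` on, induction shows that the double trace is a bubble, which is then tested
against itself. On `K` this gives uniqueness; for the difference of two pieces on a shared simplex
it gives conformity.

Counting. On an `m`-simplex with `ℓ ≤ m`, the products of the Whitney form of a face `σ` with the
wedge of the `dλ_i`, `i ∈ τ`, where `σ ∪ τ` is the whole vertex set and `min σ ∉ τ`, form a basis of
the bubbles, so their dimension is `C(m+1,k+1) C(k,m-ℓ)`. Summed over the faces of dimension at
least `ℓ` this gives the dimension of the shape functions, by Vandermonde. Layer by layer, the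
bubbles on `(ℓ+s)`-faces are as many as the skeletal moments of index `s`, so exchanging the first
`p` layers does not alter the count.

Kernels of `S_{†,[p]}`. It suffices that the bubble kernels have total dimension at most that of the
shape kernel. As `S_{†,[p]}` maps shape functions to shape functions, this reduces to its
surjectivity on bubbles (`Vertices.bubbleAlt_le_map`). With suitable signs on the generators,
`S_{†,[p]}` sends `(σ, τ)` to a multiple of the sum of all `(σ \ P, τ ∪ P)`, where `P ⊆ σ \ τ` has
`p` elements. The set `σ ∩ τ` does not change, so the matrix is the inclusion matrix between
`t`-subsets and `(t+p)`-subsets of its complement `U`. It has full rank if `2t + p ≤ |U|`, which is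
the condition `k + 1 ≤ ℓ + p`. -/

instance finite_alternatingMap [Module.Finite ℝ V] [Module.Finite ℝ N] (k : ℕ) :
    Module.Finite ℝ (V [⋀^Fin k]→ₗ[ℝ] N) :=
  Module.Finite.equiv (exteriorPower.alternatingMapLinearEquiv (R := ℝ) (M := V) (N := N)
    (n := k)).symm

theorem finrank_alternatingMap [Module.Finite ℝ V] [Module.Finite ℝ N] (k : ℕ) :
    Module.finrank ℝ (V [⋀^Fin k]→ₗ[ℝ] N) =
      (Module.finrank ℝ V).choose k * Module.finrank ℝ N := by
  rw [(exteriorPower.alternatingMapLinearEquiv (R := ℝ) (M := V) (N := N) (n := k)).finrank_eq,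
    Module.finrank_linearMap, exteriorPower.finrank_eq]

theorem ext_orderEmb {I : Type*} [LinearOrder I] (e : Module.Basis I ℝ V) {k : ℕ}
    {f g : V [⋀^Fin k]→ₗ[ℝ] N} (h : ∀ s : Fin k ↪o I, f (e ∘ s) = g (e ∘ s)) : f = g := by
  apply (exteriorPower.alternatingMapLinearEquiv (R := ℝ) (M := V) (N := N) (n := k)).injective
  refine (e.exteriorPower k).ext fun s => ?_
  rw [exteriorPower.basis_apply, exteriorPower.ιMulti_family,
    exteriorPower.alternatingMapLinearEquiv_apply_ιMulti,
    exteriorPower.alternatingMapLinearEquiv_apply_ιMulti]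
  exact h _

theorem alternatingMap_eq_zero_of_finrank_lt [Module.Finite ℝ V] {k : ℕ}
    (h : Module.finrank ℝ V < k) (f : V [⋀^Fin k]→ₗ[ℝ] N) : f = 0 := by
  refine (Module.finBasis ℝ V).ext_alternating fun v hv => ?_
  have := Fintype.card_le_of_injective v hv
  simp only [Fintype.card_fin] at this
  omega

theorem eq_zero_of_perm {κ : Type*} [Fintype κ] [DecidableEq κ] (f : V [⋀^κ]→ₗ[ℝ] N)
    (π : Equiv.Perm κ) {v : κ → V} (h : f (v ∘ π) = 0) : f v = 0 := by
  rw [f.map_perm] at h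
  simpa using (smul_eq_zero_iff_eq (Equiv.Perm.sign π)).1 h

/-- `α` vanishes as soon as `c - e` of its arguments lie in `A`. -/
def VanishesOn (A : Submodule ℝ V) (c e : ℕ) {ℓ : ℕ} (α : V [⋀^Fin ℓ]→ₗ[ℝ] ℝ) : Prop :=
  ∀ (w : Fin ℓ → V) (S : Finset (Fin ℓ)), c ≤ S.card + e → (∀ i ∈ S, w i ∈ A) → α w = 0

/-- A tuple all of whose entries lie in `A` or `B` can be sorted by a permutation. -/
theorem apply_eq_zero_of_component {A B : Submodule ℝ V} {ℓ : ℕ} {α : V [⋀^Fin ℓ]→ₗ[ℝ] ℝ}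
    {S : Finset (Fin ℓ)} {q r : ℕ} (hq : S.card = q) (h : q + r = ℓ)
    (hα : component A B h α = 0) {w : Fin ℓ → V} (hA : ∀ i ∈ S, w i ∈ A) (hB : ∀ i ∉ S, w i ∈ B) :
    α w = 0 := by
  have hr : Sᶜ.card = r := by rw [Finset.card_compl, Fintype.card_fin]; omega
  set e := finSumEquivOfFinset hq hr
  set e₀ := finSumFinEquiv.trans (finCongr h)
  have hinl : ∀ i, w (e (Sum.inl i)) ∈ A := fun i => hA _ (by
    simp only [e, finSumEquivOfFinset_inl]; exact Finset.orderEmbOfFin_mem _ _ _)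
  have hinr : ∀ i, w (e (Sum.inr i)) ∈ B := fun i => hB _ (by
    simp only [e, finSumEquivOfFinset_inr]
    exact Finset.mem_compl.1 (Finset.orderEmbOfFin_mem _ _ _))
  apply eq_zero_of_perm α (e₀.symm.trans e)
  have := congrArg (fun f => f (fun i => ⟨_, hinl i⟩) (fun i => ⟨_, hinr i⟩)) hα
  change α.domDomCongr e₀.symm (Sum.elim _ _) = 0 at this
  rw [AlternatingMap.domDomCongr_apply] at this
  rw [← this]
  congr 1
  ext i
  rcases hx : e₀.symm i with j | j <;> simp [hx]

theorem component_eq_zero_of_vanishesOn {A B : Submodule ℝ V} {c e ℓ q r : ℕ} (h : q + r = ℓ)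
    {α : V [⋀^Fin ℓ]→ₗ[ℝ] ℝ} (hα : VanishesOn A c e α) (hq : c ≤ q + e) :
    component A B h α = 0 := by
  ext t ν
  change α.domDomCongr (finSumFinEquiv.trans (finCongr h)).symm (Sum.elim _ _) = 0
  rw [AlternatingMap.domDomCongr_apply]
  refine hα _ (Finset.univ.map ((Function.Embedding.inl).trans
    (finSumFinEquiv.trans (finCongr h)).toEmbedding)) (by simpa using hq) ?_
  simp

/-- Split the arguments one at a time along `A ⊔ B = ⊤`. The induction runs over the number of
arguments not yet sorted into `A` or `B`. Once all are sorted, the value is read off a component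
with `S.card` arguments in `A`, and `S` never shrinks on the way. -/
theorem vanishesOn_of_component {A B : Submodule ℝ V} (hAB : A ⊔ B = ⊤) {c e ℓ : ℕ}
    {α : V [⋀^Fin ℓ]→ₗ[ℝ] ℝ}
    (hα : ∀ (q r : ℕ) (h : q + r = ℓ), c ≤ q + e → component A B h α = 0) :
    VanishesOn A c e α := by
  classical
  intro w S hS hA
  suffices H : ∀ (m : ℕ) (w : Fin ℓ → V) (S T : Finset (Fin ℓ)), c ≤ S.card + e →
      (∀ i ∈ S, w i ∈ A) → (∀ i ∈ T, w i ∈ B) → (S ∪ T)ᶜ.card = m → α w = 0 from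
    H _ w S ∅ hS hA (by simp) rfl
  intro m
  induction m with
  | zero =>
    intro w S T hS hA hB hm
    have hST : S ∪ T = Finset.univ := by
      rwa [Finset.card_eq_zero, Finset.compl_eq_empty_iff] at hm
    refine apply_eq_zero_of_component (r := ℓ - S.card) rfl
      (by have := S.card_le_univ; simp at this; omega) (hα _ _ _ hS) hA fun i hi => ?_
    have : i ∈ S ∪ T := hST ▸ Finset.mem_univ i
    exact hB i ((Finset.mem_union.1 this).resolve_left hi)
  | succ m ih =>
    intro w S T hS hA hB hm
    obtain ⟨i, hi⟩ : (S ∪ T)ᶜ.Nonempty := Finset.card_pos.1 (by omega)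
    have hi' : i ∉ S ∧ i ∉ T := by simpa using hi
    obtain ⟨a, ha, b, hb, hab⟩ := Submodule.mem_sup.1 (hAB ▸ Submodule.mem_top : w i ∈ A ⊔ B)
    have e1 : w = Function.update w i (a + b) := by rw [hab, Function.update_eq_self]
    have hc : (S ∪ insert i T)ᶜ.card = m := by
      have : (S ∪ insert i T)ᶜ = (S ∪ T)ᶜ.erase i := by ext; simp
      rw [this, Finset.card_erase_of_mem hi, hm, Nat.add_sub_cancel]
    rw [e1, α.map_update_add,
      ih _ (insert i S) T (by rw [Finset.card_insert_of_notMem hi'.1]; omega) ?_ ?_ ?_,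
      ih _ S (insert i T) hS ?_ ?_ hc, add_zero]
    · intro j hj; rw [Function.update_of_ne (by rintro rfl; exact hi'.1 hj)]; exact hA j hj
    · intro j hj
      rcases eq_or_ne j i with rfl | hji
      · simpa
      · rw [Function.update_of_ne hji]; exact hB j (Finset.mem_of_mem_insert_of_ne hj hji)
    · intro j hj
      rcases eq_or_ne j i with rfl | hji
      · simpa
      · rw [Function.update_of_ne hji]; exact hA j (Finset.mem_of_mem_insert_of_ne hj hji)
    · intro j hj; rw [Function.update_of_ne (by rintro rfl; exact hi'.2 hj)]; exact hB j hj
    · rwa [Finset.insert_union, ← Finset.union_insert]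

theorem dite_update_eq_update {ℓ : ℕ} (S : Finset (Fin ℓ)) [DecidableEq S] (w : Fin ℓ → V)
    (U : Submodule ℝ V) (t : S → U) (i : S) (z : U) :
    (fun j => if h : j ∈ S then ((Function.update t i z ⟨j, h⟩ : U) : V) else w j) =
      Function.update (fun j => if h : j ∈ S then (t ⟨j, h⟩ : V) else w j) i z := by
  ext j
  rcases eq_or_ne j i with rfl | hji
  · simp
  · by_cases hj : j ∈ S
    · have : (⟨j, hj⟩ : S) ≠ i := fun h => hji (congrArg Subtype.val h)
      simp [hj, hji, Function.update_of_ne this]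
    · simp [hj, hji]

/-- Fix the arguments of `α` outside of `S`. -/
def fixOutside {ℓ : ℕ} (α : V [⋀^Fin ℓ]→ₗ[ℝ] N) (S : Finset (Fin ℓ)) (w : Fin ℓ → V)
    (U : Submodule ℝ V) : U [⋀^S]→ₗ[ℝ] N where
  toFun t := α fun i => if h : i ∈ S then t ⟨i, h⟩ else w i
  map_update_add' t i x y := by
    rw [dite_update_eq_update, dite_update_eq_update, dite_update_eq_update]
    exact α.map_update_add _ _ _ _
  map_update_smul' t i c x := by
    rw [dite_update_eq_update, dite_update_eq_update]
    exact α.map_update_smul _ _ _ _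
  map_eq_zero_of_eq' t i j ht hij := by
    refine α.map_eq_zero_of_eq (i := (i : Fin ℓ)) (j := (j : Fin ℓ)) _ ?_
      (fun h => hij (Subtype.ext h))
    simp [ht]

/-- Choose a basis of `U` adapted to `A` and a complement `C` of dimension at most `d`. By
alternation only distinct basis vectors matter, so at most `d` of the arguments in `U` come from `C`
and the others lie in `A`. -/
theorem VanishesOn.mono_left [Module.Finite ℝ V] {A U : Submodule ℝ V} (hAU : A ≤ U)
    {c d e ℓ : ℕ} (hd : Module.finrank ℝ U ≤ Module.finrank ℝ A + d)
    {α : V [⋀^Fin ℓ]→ₗ[ℝ] ℝ} (hα : VanishesOn A c e α) : VanishesOn U (c + d) e α := by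
  classical
  intro w S hS hU
  have e1 : α w = fixOutside α S w U fun i => ⟨w i, hU i i.2⟩ := by
    simp [fixOutside]
  rw [e1]
  suffices H : fixOutside α S w U = 0 by rw [H]; rfl
  obtain ⟨C, hC⟩ := Submodule.exists_isCompl (A.submoduleOf U)
  set bA := Module.finBasis ℝ (A.submoduleOf U)
  set bC := Module.finBasis ℝ C
  refine ((bA.prod bC).map (Submodule.prodEquivOfIsCompl _ _ hC)).ext_alternating fun v hv => ?_
  change α _ = 0
  set S' : Finset (Fin ℓ) := Finset.univ.filter fun i => ∃ h : i ∈ S, (v ⟨i, h⟩).isLeft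
  refine hα _ S' ?_ ?_
  · have hfC : Module.finrank ℝ C ≤ d := by
      have h1 := Submodule.finrank_add_eq_of_isCompl hC
      have h2 : Module.finrank ℝ (A.submoduleOf U) = Module.finrank ℝ A :=
        (Submodule.submoduleOfEquivOfLe hAU).finrank_eq
      omega
    have h3 : (S \ S').card ≤ Module.finrank ℝ C := by
      have h4 : ∀ i : (S \ S' : Finset (Fin ℓ)),
          ∃ j, v ⟨i, (Finset.mem_sdiff.1 i.2).1⟩ = Sum.inr j := by
        rintro ⟨i, hi⟩
        have h5 := (Finset.mem_sdiff.1 hi).2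
        simp only [S', Finset.mem_filter, Finset.mem_univ, true_and, not_exists] at h5
        rcases hvi : v ⟨i, (Finset.mem_sdiff.1 hi).1⟩ with j | j
        · exact absurd (by rw [hvi]; rfl) (h5 (Finset.mem_sdiff.1 hi).1)
        · exact ⟨j, rfl⟩
      choose g hg using h4
      have hinj : Function.Injective g := by
        intro i j hij
        have : v ⟨i, (Finset.mem_sdiff.1 i.2).1⟩ = v ⟨j, (Finset.mem_sdiff.1 j.2).1⟩ := by
          rw [hg, hg, hij]
        exact Subtype.ext (congrArg (fun x : S => (x : Fin ℓ)) (hv this))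
      have := Fintype.card_le_of_injective g hinj
      rwa [Fintype.card_coe, Fintype.card_fin] at this
    have h6 : S' ⊆ S := by
      intro i hi
      simp only [S', Finset.mem_filter] at hi
      exact hi.2.1
    have := Finset.card_sdiff_add_card_eq_card h6
    omega
  · intro i hi
    simp only [S', Finset.mem_filter, Finset.mem_univ, true_and] at hi
    obtain ⟨h, hl⟩ := hi
    rcases hvi : v ⟨i, h⟩ with j | j
    · simp only [h, dif_pos, hvi]
      simp only [Module.Basis.map_apply, Module.Basis.prod_apply, Sum.elim_inl,
        Function.comp_apply, LinearMap.inl_apply, Submodule.coe_prodEquivOfIsCompl']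
      rw [Submodule.coe_zero, add_zero]
      exact (bA j).2
    · rw [hvi] at hl; simp at hl

end Alternating

/-! ### Whitney forms -/

section Whitney

variable {V N : Type*} [AddCommGroup V] [Module ℝ V] [AddCommGroup N] [Module ℝ N]

theorem map_cons_cons_swap {k : ℕ} (f : V [⋀^Fin (k + 2)]→ₗ[ℝ] N) (x y : V) (v : Fin k → V) :
    f (Fin.cons x (Fin.cons y v : Fin (k + 1) → V)) =
      -f (Fin.cons y (Fin.cons x v : Fin (k + 1) → V)) := by
  rw [← f.map_swap _ (show (0 : Fin (k + 2)) ≠ 1 by simp)]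
  congr 1
  ext i
  refine Fin.cases ?_ (fun i => Fin.cases ?_ (fun i => ?_) i) i
  · simp only [Function.comp_apply, Equiv.swap_apply_left]; rfl
  · rw [Function.comp_apply, show (Fin.succ 0 : Fin (k + 2)) = 1 from rfl,
      Equiv.swap_apply_right]
    rfl
  · have : Equiv.swap 0 1 i.succ.succ = i.succ.succ := Equiv.swap_apply_of_ne_of_ne
      (Fin.succ_ne_zero _) (fun h => Fin.succ_ne_zero i (Fin.succ_injective _ h))
    rw [Function.comp_apply, this]
    rfl

/-- Since `x` already occupies the first slot, every term of the expansion that contains a further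
`-x` vanishes. -/
theorem map_cons_sub {k : ℕ} (f : V [⋀^Fin (k + 1)]→ₗ[ℝ] N) (x : V) (v : Fin k → V) :
    f.curryLeft x (fun i => v i - x) = f.curryLeft x v := by
  have h := (f.curryLeft x).map_add_univ v (fun _ => -x)
  have e : (v + fun _ => -x) = fun i => v i - x := by ext i; simp [sub_eq_add_neg]
  rw [e] at h
  rw [h, Finset.sum_eq_single Finset.univ]
  · simp
  · intro S _ hS
    obtain ⟨i, hi⟩ : ∃ i, i ∉ S := by simpa [Finset.eq_univ_iff_forall] using hS
    set w := S.piecewise v fun _ => -x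
    have hw : w = Function.update w i (-x) := by
      rw [eq_comm, Function.update_eq_self_iff]
      exact (Finset.piecewise_eq_of_notMem S v (fun _ => -x) hi).symm
    rw [hw, AlternatingMap.map_update_neg, AlternatingMap.curryLeft_apply_apply, neg_eq_zero]
    exact f.map_eq_zero_of_eq (i := 0) (j := i.succ) _ (by simp [Matrix.vecCons])
      (Fin.succ_ne_zero i).symm
  · simp

/-- A Whitney form is determined by its values on the `k`-faces of a simplex. -/
theorem whitney_ext {m k : ℕ} (p : Fin (m + 1) → V) (e : Module.Basis (Fin m) ℝ V)
    (he : ∀ i, e i = p i.succ - p 0) (a : V [⋀^Fin k]→ₗ[ℝ] N) (b : V [⋀^Fin (k + 1)]→ₗ[ℝ] N)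
    (h : ∀ s : Fin (k + 1) ↪o Fin (m + 1),
      (a + b.curryLeft (p (s 0))) (fun i => p (s i.succ) - p (s 0)) = 0) :
    a + b.curryLeft (p 0) = 0 ∧ b = 0 := by
  -- The faces through vertex 0 give the values of the form at that vertex on all increasing tuples
  -- of basis edges.
  have h0 : a + b.curryLeft (p 0) = 0 := by
    refine ext_orderEmb e fun s => ?_
    let s' : Fin (k + 1) ↪o Fin (m + 1) := OrderEmbedding.ofStrictMono
      (Fin.cons 0 fun i => (s i).succ) (by
        intro i j
        refine Fin.cases ?_ (fun i => ?_) i <;> refine Fin.cases ?_ (fun j => ?_) j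
        · simp
        · intro _; simp
        · intro h; simp at h
        · intro h; simpa using h)
    have h1 := h s'
    have e0 : s' 0 = 0 := rfl
    have e1 : ∀ i : Fin k, s' i.succ = (s i).succ := fun _ => rfl
    simp only [e0, e1] at h1
    rw [AlternatingMap.zero_apply, ← h1]
    congr 1
    ext i
    simp [he]
  -- On a face avoiding vertex 0, `h0` reduces the form at the vertex `s 0` to the contraction of
  -- `b` with `e (s 0)`, and the edges `e (s i) - e (s 0)` may then be replaced by `e (s i)`. This
  -- leaves `b` on basis vectors.
  refine ⟨h0, ext_orderEmb e fun s => ?_⟩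
  have h1 := h (s.trans (Fin.succOrderEmb m))
  have e1 : a + b.curryLeft (p (s 0).succ) = b.curryLeft (e (s 0)) := by
    rw [he, map_sub, eq_sub_iff_add_eq, add_right_comm, h0, zero_add]
  simp only [RelEmbedding.coe_trans, Function.comp_apply, Fin.coe_succOrderEmb] at h1
  rw [e1] at h1
  have e2 : (fun i : Fin k => p (s i.succ).succ - p (s 0).succ) =
      fun i => e (s i.succ) - e (s 0) := by ext i; simp [he]
  rw [e2, map_cons_sub] at h1
  rw [AlternatingMap.zero_apply, ← h1, AlternatingMap.curryLeft_apply_apply]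
  congr 1
  ext i
  refine Fin.cases ?_ (fun i => ?_) i <;> simp

/-! ### The operator `S_†` -/

theorem sdag_succ_apply (k ℓ : ℕ) (ω : FF (k + 1) ℓ V) (v : Fin k → V) (u : Fin (ℓ + 1) → V) :
    sdag (k + 1) ℓ ω v u =
      ∑ j : Fin (ℓ + 1), (-1) ^ (j : ℕ) • ω (Fin.cons (u j) v) (Fin.removeNth j u) :=
  sdagSucc_apply k ℓ ω v u

/-- `S_†` anticommutes with `κ`: both insert a vector in front of the first slot, in opposite
orders. This is why `S_†` preserves the Whitney spaces. -/
theorem sdag_curryLeft (k ℓ : ℕ) (b : FF (k + 2) ℓ V) (x : V) :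
    sdag (k + 1) ℓ (b.curryLeft x) =
      -AlternatingMap.curryLeft (n := k) (sdag (k + 2) ℓ b) x := by
  ext v u
  rw [sdag_succ_apply, AlternatingMap.neg_apply, AlternatingMap.neg_apply,
    AlternatingMap.curryLeft_apply_apply]
  erw [sdag_succ_apply (k + 1) ℓ b (Matrix.vecCons x v) u]
  rw [← Finset.sum_neg_distrib]
  refine Finset.sum_congr rfl fun j _ => ?_
  rw [AlternatingMap.curryLeft_apply_apply, Matrix.vecCons, Matrix.vecCons, map_cons_cons_swap]
  simp

theorem pullback_apply {W : Type*} [AddCommGroup W] [Module ℝ W] (k ℓ : ℕ) (f : W →ₗ[ℝ] V)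
    (ω : FF k ℓ V) (v : Fin k → W) (u : Fin ℓ → W) :
    pullback k ℓ f ω v u = ω (f ∘ v) (f ∘ u) := rfl

theorem sdag_pullback {W : Type*} [AddCommGroup W] [Module ℝ W] (k ℓ : ℕ) (f : W →ₗ[ℝ] V)
    (ω : FF k ℓ V) :
    sdag k ℓ (pullback k ℓ f ω) = pullback (k - 1) (ℓ + 1) f (sdag k ℓ ω) := by
  cases k with
  | zero => rfl
  | succ k =>
    ext v u
    rw [sdag_succ_apply]
    erw [pullback_apply k (ℓ + 1) f _ v u, sdag_succ_apply]
    refine Finset.sum_congr rfl fun j _ => ?_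
    rw [pullback_apply]
    congr 2
    congr 1
    ext i
    refine Fin.cases ?_ (fun i => ?_) i <;> rfl

theorem sdagIter_pullback {W : Type*} [AddCommGroup W] [Module ℝ W] (k ℓ : ℕ) (f : W →ₗ[ℝ] V)
    (p : ℕ) (ω : FF k ℓ V) :
    sdagIter k ℓ p (pullback k ℓ f ω) = pullback (k - p) (ℓ + p) f (sdagIter k ℓ p ω) := by
  induction p with
  | zero => rfl
  | succ p ih =>
    change sdag (k - p) (ℓ + p) (sdagIter k ℓ p _) = _
    rw [ih, sdag_pullback]
    rfl

theorem sdag_mem_whitneySpace {k ℓ : ℕ} (hk : 1 ≤ k) {S : Type*} {pos : S → V}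
    {ω : S → FF k ℓ V} (hω : ω ∈ whitneySpace k ℓ pos) :
    (fun x => sdag k ℓ (ω x)) ∈ whitneySpace (k - 1) (ℓ + 1) pos := by
  obtain ⟨k, rfl⟩ : ∃ j, k = j + 1 := ⟨k - 1, by omega⟩
  obtain ⟨a, b, h⟩ := hω
  refine ⟨sdag (k + 1) ℓ a, -sdag (k + 2) ℓ b, fun x => ?_⟩
  dsimp only
  rw [h, map_add, sdag_curryLeft]
  rfl

theorem sdagIter_mem_whitneySpace {k ℓ p : ℕ} (hp : p ≤ k) {S : Type*} {pos : S → V}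
    {ω : S → FF k ℓ V} (hω : ω ∈ whitneySpace k ℓ pos) :
    (sdagIter k ℓ p).compLeft S ω ∈ whitneySpace (k - p) (ℓ + p) pos := by
  induction p with
  | zero => exact hω
  | succ p ih =>
    have h1 : 1 ≤ k - p := by omega
    exact sdag_mem_whitneySpace h1 (ih (by omega))

theorem sdagIter_eq_zero {k p : ℕ} (ℓ : ℕ) (hp : k < p) :
    sdagIter (V := V) k ℓ p = 0 := by
  obtain ⟨p, rfl⟩ : ∃ j, p = j + 1 := ⟨p - 1, by omega⟩
  change sdag (k - p) (ℓ + p) ∘ₗ _ = 0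
  -- The last factor acts in degree `k - p`, which truncates to 0, where `sdag` is zero by
  -- definition.
  have : ∀ j, j = 0 → sdag (V := V) j (ℓ + p) = 0 := by rintro _ rfl; rfl
  rw [this _ (by omega), LinearMap.zero_comp]

theorem symmetric_eq_top {k ℓ p : ℕ} {S : Type*} (h : sdagIter (V := V) k ℓ p = 0) :
    symmetric k ℓ p S V = ⊤ := by
  rw [symmetric, h]
  exact LinearMap.ker_zero

/-! ### Products of determinants -/

variable {ι : Type*}

/-- `det (dλ_{t_i} (u_j))`. -/
def detForm (dl : ι → Module.Dual ℝ V) {ℓ : ℕ} (t : Fin ℓ → ι) : V [⋀^Fin ℓ]→ₗ[ℝ] ℝ :=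
  Matrix.detRowAlternating.compLinearMap (LinearMap.pi fun i => dl (t i))

theorem detForm_apply (dl : ι → Module.Dual ℝ V) {ℓ : ℕ} (t : Fin ℓ → ι) (u : Fin ℓ → V) :
    detForm dl t u = (Matrix.of fun j i => dl (t i) (u j)).det := rfl

theorem detForm_insertNth (dl : ι → Module.Dual ℝ V) {ℓ : ℕ} (j : Fin (ℓ + 1)) (i : ι)
    (t : Fin ℓ → ι) :
    detForm dl (j.insertNth i t : Fin (ℓ + 1) → ι) =
      (-1 : ℝ) ^ (j : ℕ) • detForm dl (Fin.cons i t : Fin (ℓ + 1) → ι) := by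
  ext u
  have h := (Matrix.detRowAlternating (R := ℝ) (n := Fin (ℓ + 1))).map_insertNth j
    (fun c => dl i (u c)) fun r c => dl (t r) (u c)
  rw [AlternatingMap.smul_apply, detForm_apply, detForm_apply, ← Matrix.det_transpose,
    ← Matrix.det_transpose (Matrix.of fun j_1 i_1 => (dl _) (u j_1))]
  have e1 : (Matrix.of fun r c => dl ((j.insertNth i t : Fin (ℓ + 1) → ι) c) (u r)).transpose =
      (j.insertNth (fun c => dl i (u c)) fun r c => dl (t r) (u c) :
        Fin (ℓ + 1) → Fin (ℓ + 1) → ℝ) := by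
    ext r c
    rcases Fin.eq_self_or_eq_succAbove j r with rfl | ⟨r, rfl⟩ <;> simp
  have e2 : (Matrix.of fun r c => dl ((Fin.cons i t : Fin (ℓ + 1) → ι) c) (u r)).transpose =
      (Matrix.vecCons (fun c => dl i (u c)) fun r c => dl (t r) (u c) :
        Fin (ℓ + 1) → Fin (ℓ + 1) → ℝ) := by
    ext r c
    refine Fin.cases ?_ (fun r => ?_) r <;> simp
  rw [e1, e2]
  rw [← Int.cast_smul_eq_zsmul ℝ] at h
  push_cast at h
  exact h

theorem detForm_eq_zero (dl : ι → Module.Dual ℝ V) {ℓ : ℕ} {t : Fin ℓ → ι} {i j : Fin ℓ}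
    (h : t i = t j) (hij : i ≠ j) : detForm dl t = 0 := by
  ext u
  rw [detForm_apply]
  exact Matrix.det_zero_of_column_eq hij fun r => by simp [h]

/-- The Whitney form of the face with vertices `s`, at a point with barycentric coordinates `y`. -/
def whitneyForm (y : ι → ℝ) (dl : ι → Module.Dual ℝ V) {k : ℕ} (s : Fin (k + 1) → ι) :
    V [⋀^Fin k]→ₗ[ℝ] ℝ :=
  (AlternatingMap.curryLeft (n := k) Matrix.detRowAlternating (y ∘ s)).compLinearMap
    (LinearMap.pi fun i => dl (s i))

theorem whitneyForm_apply (y : ι → ℝ) (dl : ι → Module.Dual ℝ V) {k : ℕ} (s : Fin (k + 1) → ι)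
    (v : Fin k → V) :
    whitneyForm y dl s v = Matrix.det (Matrix.of
      (Fin.cons (fun i => y (s i)) fun j i => dl (s i) (v j))) := rfl

/-- The product of a Whitney form in the first slot and a constant form in the second slot. -/
def gen (y : ι → ℝ) (dl : ι → Module.Dual ℝ V) {k ℓ : ℕ} (s : Fin (k + 1) → ι) (t : Fin ℓ → ι) :
    FF k ℓ V :=
  (LinearMap.toSpanSingleton ℝ _ (detForm dl t)).compAlternatingMap (whitneyForm y dl s)

theorem gen_apply (y : ι → ℝ) (dl : ι → Module.Dual ℝ V) {k ℓ : ℕ} (s : Fin (k + 1) → ι)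
    (t : Fin ℓ → ι) (v : Fin k → V) (u : Fin ℓ → V) :
    gen y dl s t v u = whitneyForm y dl s v * detForm dl t u := rfl

theorem sum_apply_apply {κ : Type*} (S : Finset κ) {k ℓ : ℕ} (f : κ → FF k ℓ V) (v : Fin k → V)
    (u : Fin ℓ → V) : (∑ i ∈ S, f i) v u = ∑ i ∈ S, f i v u := by
  classical
  induction S using Finset.induction_on with
  | empty => rfl
  | insert a S ha ih =>
    rw [Finset.sum_insert ha, Finset.sum_insert ha, AlternatingMap.add_apply,
      AlternatingMap.add_apply, ih]

/-- Expand the Whitney determinant along the row of `u_j`. For each `i`, the sum over `j` is then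
the Laplace expansion, along its first column, of the determinant with `dλ_{s i}` in front of `t`.
The minus sign comes from exchanging the row of `u_j` with the coordinate row. -/
theorem sdag_gen (y : ι → ℝ) (dl : ι → Module.Dual ℝ V) {k ℓ : ℕ} (s : Fin (k + 2) → ι)
    (t : Fin ℓ → ι) :
    @Eq (FF k (ℓ + 1) V) (sdag (k + 1) ℓ (gen y dl s t)) (-∑ i : Fin (k + 2), (-1 : ℝ) ^ (i : ℕ) •
      gen y dl (s ∘ i.succAbove) (Fin.cons (s i) t : Fin (ℓ + 1) → ι)) := by
  ext v u
  rw [sdag_succ_apply]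
  have hw : ∀ x, whitneyForm y dl s (Fin.cons x v) = -∑ i : Fin (k + 2), (-1 : ℝ) ^ (i : ℕ) *
      dl (s i) x * whitneyForm y dl (s ∘ i.succAbove) v := by
    intro x
    rw [whitneyForm_apply]
    have e1 : (Fin.cons (fun i => y (s i)) fun (j : Fin (k + 1)) i =>
        dl (s i) ((Fin.cons x v : Fin (k + 1) → V) j) : Fin (k + 2) → Fin (k + 2) → ℝ) =
        Fin.cons (fun i => y (s i)) (Fin.cons (fun i => dl (s i) x) fun j i => dl (s i) (v j) :
          Fin (k + 1) → Fin (k + 2) → ℝ) := by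
      congr 1
      ext j i
      refine Fin.cases ?_ (fun j => ?_) j <;> simp
    have h := map_cons_cons_swap (Matrix.detRowAlternating (R := ℝ) (n := Fin (k + 2)))
      (fun i => y (s i)) (fun i => dl (s i) x) fun j i => dl (s i) (v j)
    rw [e1]
    refine h.trans ?_
    congr 1
    refine (Matrix.det_succ_row_zero _).trans (Finset.sum_congr rfl fun i _ => ?_)
    rw [whitneyForm_apply]
    congr 2
    ext r c
    refine Fin.cases ?_ (fun r => ?_) r <;> rfl
  have hd : ∀ i, detForm dl (Fin.cons (s i) t : Fin (ℓ + 1) → ι) u =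
      ∑ j : Fin (ℓ + 1), (-1 : ℝ) ^ (j : ℕ) * dl (s i) (u j) * detForm dl t (j.removeNth u) := by
    intro i
    rw [detForm_apply, Matrix.det_succ_column_zero]
    refine Finset.sum_congr rfl fun j _ => ?_
    rw [detForm_apply]
    congr 2
  rw [AlternatingMap.neg_apply, AlternatingMap.neg_apply, sum_apply_apply]
  simp only [gen_apply, hw, AlternatingMap.smul_apply, hd, smul_eq_mul, Finset.sum_mul,
    Finset.mul_sum, neg_mul, smul_neg, Finset.smul_sum, Finset.sum_neg_distrib]
  rw [Finset.sum_comm]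
  refine congrArg _ (Finset.sum_congr rfl fun i _ => Finset.sum_congr rfl fun j _ => ?_)
  simp
  ring

/-- The determinant is linear in its coordinate row, and the coordinates are affine in the position:
the constants give `a`, the linear parts give a contraction with `pos`. -/
theorem gen_mem_whitneySpace {S : Type*} {pos : S → V} {y : S → ι → ℝ}
    {dl : ι → Module.Dual ℝ V} {c : ι → ℝ} (hy : ∀ x i, y x i = c i + dl i (pos x)) {k ℓ : ℕ}
    (s : Fin (k + 1) → ι) (t : Fin ℓ → ι) :
    (fun x => gen (y x) dl s t) ∈ whitneySpace k ℓ pos := by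
  refine ⟨gen c dl s t,
    (LinearMap.toSpanSingleton ℝ _ (detForm dl t)).compAlternatingMap (detForm dl s), fun x => ?_⟩
  ext v u
  have h : whitneyForm (y x) dl s v =
      whitneyForm c dl s v + detForm dl s (Fin.cons (pos x) v) := by
    have h1 : y x ∘ s = c ∘ s + fun i => dl (s i) (pos x) := by ext i; simp [hy]
    rw [whitneyForm, h1, map_add]
    refine congrArg (whitneyForm c dl s v + ·) ?_
    change Matrix.detRowAlternating _ = Matrix.detRowAlternating _
    congr 1
    ext r c
    refine Fin.cases ?_ (fun r => ?_) r <;> rfl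
  rw [gen_apply, h, add_mul]
  rfl

end Whitney

/-! ### Inclusion of subsets -/

section Subsets

/-- Such a set contains `I ∪ B`, and its other elements are chosen freely outside `T ∪ B`. The count
therefore depends on `B` only through `|B ∩ T|`. -/
theorem card_filter_inter_eq {α : Type*} [DecidableEq α] {U T I B : Finset α} {t a : ℕ}
    (hT : T ⊆ U) (hTt : T.card = t) (hI : I ⊆ T) (hB : B ⊆ U) (hBt : B.card = t)
    (hBI : B ∩ T ⊆ I) :
    (((U.powersetCard a).filter (· ∩ T = I)).filter (B ⊆ ·)).card =
      if I.card + (t - (B ∩ T).card) ≤ a then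
        (U.card - t - (t - (B ∩ T).card)).choose (a - (I.card + (t - (B ∩ T).card))) else 0 := by
  have hBT : (B \ T).card = t - (B ∩ T).card := by
    have := Finset.card_sdiff_add_card_inter B T; omega
  have hD : (I ∪ B).card = I.card + (t - (B ∩ T).card) := by
    have e : I ∪ B = I ∪ B \ T := by
      ext x
      have h1 := @hBI x
      have h2 := @hI x
      simp only [Finset.mem_union, Finset.mem_sdiff, Finset.mem_inter] at *
      tauto
    rw [e, Finset.card_union_of_disjoint, hBT]
    exact Finset.disjoint_left.2 fun x hx hx' => (Finset.mem_sdiff.1 hx').2 (hI hx)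
  have hTB : (T ∪ B).card = t + (t - (B ∩ T).card) := by
    have e : T ∪ B = T ∪ B \ T := by simp
    rw [e, Finset.card_union_of_disjoint Finset.disjoint_sdiff, hBT, hTt]
  have hsub : T ∪ B ⊆ U := Finset.union_subset hT hB
  have hA : ∀ A : Finset α, A ∩ T = I → B ⊆ A → A ∩ (T ∪ B) = I ∪ B := by
    intro A h1 h2
    rw [Finset.inter_union_distrib_left, h1, Finset.inter_eq_right.2 h2]
  split_ifs with hle
  · rw [← hD]
    have hc : U.card - t - (t - (B ∩ T).card) = (U \ (T ∪ B)).card := by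
      rw [Finset.card_sdiff_of_subset hsub, hTB]; omega
    rw [hc, ← Finset.card_powersetCard]
    refine Finset.card_nbij' (fun A => A \ (T ∪ B)) (fun X => (I ∪ B) ∪ X) ?_ ?_ ?_ ?_
    · intro A hA'
      simp only [Finset.coe_filter, Finset.mem_filter, Finset.mem_powersetCard,
        Set.mem_ofPred_eq] at hA'
      obtain ⟨⟨⟨h1, h2⟩, h3⟩, h4⟩ := hA'
      simp only [Finset.mem_coe, Finset.mem_powersetCard]
      refine ⟨Finset.sdiff_subset_sdiff h1 subset_rfl, ?_⟩
      have := Finset.card_sdiff_add_card_inter A (T ∪ B)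
      rw [hA A h3 h4] at this
      omega
    · intro X hX
      simp only [Finset.mem_coe, Finset.mem_powersetCard] at hX
      simp only [Finset.coe_filter, Finset.mem_filter, Finset.mem_powersetCard,
        Set.mem_ofPred_eq]
      have hdis : Disjoint (I ∪ B) X := by
        refine Finset.disjoint_left.2 fun x hx hx' => ?_
        have := (Finset.mem_sdiff.1 (hX.1 hx')).2
        exact this (Finset.union_subset_union hI subset_rfl hx)
      refine ⟨⟨⟨?_, ?_⟩, ?_⟩, ?_⟩
      · exact Finset.union_subset (Finset.union_subset (hI.trans hT) hB)
          (hX.1.trans Finset.sdiff_subset)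
      · rw [Finset.card_union_of_disjoint hdis, hX.2]; omega
      · ext x
        have h1 := @hBI x
        have h2 := @hI x
        have h3 := @hX.1 x
        simp only [Finset.mem_union, Finset.mem_sdiff, Finset.mem_inter] at *
        tauto
      · exact Finset.subset_union_right.trans Finset.subset_union_left
    · intro A hA'
      simp only [Finset.coe_filter, Finset.mem_filter, Finset.mem_powersetCard,
        Set.mem_ofPred_eq] at hA'
      obtain ⟨⟨⟨h1, h2⟩, h3⟩, h4⟩ := hA'
      dsimp only
      rw [← hA A h3 h4, Finset.union_comm, Finset.sdiff_union_inter]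
    · intro X hX
      simp only [Finset.mem_coe, Finset.mem_powersetCard] at hX
      ext x
      have h2 := @hI x
      have h3 := @hX.1 x
      simp only [Finset.mem_union, Finset.mem_sdiff] at *
      tauto
  · rw [Finset.card_eq_zero, Finset.filter_eq_empty_iff]
    intro A hA' hBA
    rw [Finset.mem_filter, Finset.mem_powersetCard] at hA'
    have : I ∪ B ⊆ A := Finset.union_subset (hA'.2 ▸ Finset.inter_subset_left) hBA
    have := Finset.card_le_card this
    omega

/-- The inclusion matrix between `t`-subsets and `a`-subsets of a finite set `U` has full rank if
`t ≤ a` and `a + t ≤ |U|`. -/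
theorem eq_zero_of_sum_powersetCard {α M : Type*} [DecidableEq α] [AddCommGroup M] [Module ℝ M]
    {U : Finset α} {t a : ℕ} (hta : t ≤ a) (hU : a + t ≤ U.card) (y : Finset α → M)
    (h : ∀ A ⊆ U, A.card = a → ∑ B ∈ A.powersetCard t, y B = 0) {T : Finset α} (hT : T ⊆ U)
    (hTt : T.card = t) : y T = 0 := by
  -- Group the unknowns by their intersection with `T`. The group sums vanish by induction on `I`,
  -- and the group of `I = T` consists of `T` alone.
  suffices H : ∀ I ⊆ T, ∑ B ∈ (U.powersetCard t).filter (· ∩ T = I), y B = 0 by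
    have h1 := H T subset_rfl
    have h2 : (U.powersetCard t).filter (· ∩ T = T) = {T} := by
      ext B
      simp only [Finset.mem_filter, Finset.mem_powersetCard, Finset.inter_eq_right,
        Finset.mem_singleton]
      constructor
      · rintro ⟨⟨_, h3⟩, h4⟩
        exact (Finset.eq_of_subset_of_card_le h4 (by omega)).symm
      · rintro rfl
        exact ⟨⟨hT, hTt⟩, subset_rfl⟩
    rwa [h2, Finset.sum_singleton] at h1
  intro I
  induction I using Finset.strongInduction with
  | H I ih =>
    intro hI
    set 𝒜 := (U.powersetCard a).filter (· ∩ T = I) with h𝒜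
    -- Add the equations of all `A` with `A ∩ T = I` and exchange the sums. Only `B` with `B ∩ T ⊆
    -- I` occur, and those with smaller intersection are covered by induction.
    have h0 : ∑ B ∈ U.powersetCard t, (𝒜.filter (B ⊆ ·)).card • y B = 0 := by
      have h1 : ∑ A ∈ 𝒜, ∑ B ∈ A.powersetCard t, y B = 0 := Finset.sum_eq_zero fun A hA => by
        rw [h𝒜, Finset.mem_filter, Finset.mem_powersetCard] at hA
        exact h A hA.1.1 hA.1.2
      rw [Finset.sum_comm' (t' := U.powersetCard t) (s' := fun B => 𝒜.filter (B ⊆ ·))] at h1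
      · simpa only [Finset.sum_const] using h1
      · intro A B
        simp only [h𝒜, Finset.mem_filter, Finset.mem_powersetCard]
        constructor
        · rintro ⟨⟨⟨h1, h2⟩, h3⟩, h4, h5⟩
          exact ⟨⟨⟨⟨h1, h2⟩, h3⟩, h4⟩, h4.trans h1, h5⟩
        · rintro ⟨⟨⟨⟨h1, h2⟩, h3⟩, h4⟩, h5, h6⟩
          exact ⟨⟨⟨h1, h2⟩, h3⟩, h4, h6⟩
    rw [← Finset.sum_fiberwise_of_maps_to (t := T.powerset) (g := fun B => B ∩ T)
      (fun B _ => Finset.mem_powerset.2 Finset.inter_subset_right)] at h0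
    rw [Finset.sum_eq_single I] at h0
    · have h1 : ∀ B ∈ (U.powersetCard t).filter (· ∩ T = I), (𝒜.filter (B ⊆ ·)).card • y B =
          (U.card - t - (t - I.card)).choose (a - t) • y B := by
        intro B hB
        rw [Finset.mem_filter, Finset.mem_powersetCard] at hB
        rw [card_filter_inter_eq hT hTt hI hB.1.1 hB.1.2 hB.2.subset, hB.2]
        have := Finset.card_le_card hI
        rw [if_pos (by omega)]
        congr 3
        omega
      rw [Finset.sum_congr rfl h1, ← Finset.smul_sum, ← Nat.cast_smul_eq_nsmul ℝ] at h0
      refine (smul_eq_zero.1 h0).resolve_left ?_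
      -- The remaining binomial coefficient is nonzero because `a + t ≤ |U|`.
      exact Nat.cast_ne_zero.2 (Nat.choose_pos (by omega)).ne'
    · intro R hR hRI
      rw [Finset.mem_powerset] at hR
      by_cases hRI' : R ⊆ I
      · have h1 : ∀ B ∈ (U.powersetCard t).filter (· ∩ T = R), (𝒜.filter (B ⊆ ·)).card • y B =
            (if I.card + (t - R.card) ≤ a then
              (U.card - t - (t - R.card)).choose (a - (I.card + (t - R.card))) else 0) • y B := by
          intro B hB
          rw [Finset.mem_filter, Finset.mem_powersetCard] at hB
          rw [card_filter_inter_eq hT hTt hI hB.1.1 hB.1.2 (hB.2 ▸ hRI'), hB.2]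
        rw [Finset.sum_congr rfl h1, ← Finset.smul_sum,
          ih R (Finset.ssubset_iff_subset_ne.2 ⟨hRI', hRI⟩) hR, smul_zero]
      · refine Finset.sum_eq_zero fun B hB => ?_
        rw [Finset.mem_filter] at hB
        have : 𝒜.filter (B ⊆ ·) = ∅ := by
          rw [Finset.filter_eq_empty_iff]
          intro A hA hBA
          rw [h𝒜, Finset.mem_filter] at hA
          exact hRI' (hB.2 ▸ hA.2 ▸ Finset.inter_subset_inter_right hBA)
        rw [this, Finset.card_empty, zero_smul]
    · intro h1
      exact absurd (Finset.mem_powerset.2 hI) h1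

end Subsets

/-! ### Sign-free generators -/

section Signs

variable {V : Type*} [AddCommGroup V] [Module ℝ V] {ι : Type*} [LinearOrder ι]

theorem orderEmbOfFin_erase {σ : Finset ι} {k : ℕ} (h : σ.card = k + 1) (i : Fin (k + 1))
    (h' : (σ.erase (σ.orderEmbOfFin h i)).card = k) :
    ((σ.erase (σ.orderEmbOfFin h i)).orderEmbOfFin h' : Fin k → ι) =
      σ.orderEmbOfFin h ∘ i.succAbove := by
  symm
  refine Finset.orderEmbOfFin_unique h' (fun j => ?_)
    ((σ.orderEmbOfFin h).strictMono.comp (Fin.strictMono_succAbove i))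
  refine Finset.mem_erase.2 ⟨fun e => ?_, Finset.orderEmbOfFin_mem _ _ _⟩
  exact Fin.succAbove_ne i j ((σ.orderEmbOfFin h).injective e)

theorem card_filter_lt_orderEmbOfFin {σ : Finset ι} {k : ℕ} (h : σ.card = k) (i : Fin k) :
    (σ.filter (· < σ.orderEmbOfFin h i)).card = i := by
  have : σ.filter (· < σ.orderEmbOfFin h i) =
      (Finset.Iio i).map (σ.orderEmbOfFin h).toEmbedding := by
    ext x
    simp only [Finset.mem_filter, Finset.mem_map, Finset.mem_Iio]
    constructor
    · rintro ⟨h1, h2⟩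
      have : x ∈ Set.range (σ.orderEmbOfFin h) := by rw [Finset.range_orderEmbOfFin]; exact h1
      obtain ⟨j, rfl⟩ := this
      exact ⟨j, (σ.orderEmbOfFin h).lt_iff_lt.1 h2, rfl⟩
    · rintro ⟨j, h1, rfl⟩
      exact ⟨Finset.orderEmbOfFin_mem _ _ _, (σ.orderEmbOfFin h).lt_iff_lt.2 h1⟩
  rw [this, Finset.card_map, Fin.card_Iio]

/-- `(-1)` to the number of inversions `b < a`, `b ∈ τ`, `a ∈ σ`. -/
def inversionSign (σ τ : Finset ι) : ℝ := ∏ b ∈ τ, ∏ a ∈ σ, if b < a then -1 else 1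

theorem inversionSign_mul_self (σ τ : Finset ι) :
    inversionSign σ τ * inversionSign σ τ = 1 := by
  rw [inversionSign, ← Finset.prod_mul_distrib]
  refine Finset.prod_eq_one fun b _ => ?_
  rw [← Finset.prod_mul_distrib]
  refine Finset.prod_eq_one fun a _ => ?_
  split_ifs <;> simp

/-- Removing `x` from `σ` loses the inversions with smaller elements of `τ`; adding it to `τ`
creates those with larger elements of `σ`. -/
theorem inversionSign_erase_insert {σ τ : Finset ι} {x : ι} (hσ : x ∈ σ) (hτ : x ∉ τ) :
    inversionSign (σ.erase x) (insert x τ) * (-1) ^ (τ.filter (· < x)).card =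
      (-1) ^ (σ.filter (x < ·)).card * inversionSign σ τ := by
  have h1 : ∀ b, (∏ a ∈ σ, if b < a then (-1 : ℝ) else 1) =
      (if b < x then -1 else 1) * ∏ a ∈ σ.erase x, if b < a then (-1 : ℝ) else 1 := fun b =>
    (Finset.mul_prod_erase σ _ hσ).symm
  have h2 : (∏ a ∈ σ.erase x, if x < a then (-1 : ℝ) else 1) =
      (-1) ^ (σ.filter (x < ·)).card := by
    rw [Finset.prod_ite, Finset.prod_const, Finset.prod_const_one, mul_one]
    congr 2
    ext a
    simp only [Finset.mem_filter, Finset.mem_erase]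
    exact ⟨fun h => ⟨h.1.2, h.2⟩, fun h => ⟨⟨h.2.ne', h.1⟩, h.2⟩⟩
  have h3 : (∏ b ∈ τ, if b < x then (-1 : ℝ) else 1) = (-1) ^ (τ.filter (· < x)).card := by
    rw [Finset.prod_ite, Finset.prod_const, Finset.prod_const_one, mul_one]
  rw [inversionSign, inversionSign, Finset.prod_insert hτ, h2, Finset.prod_congr rfl fun b _ => h1 b,
    Finset.prod_mul_distrib, h3]
  ring

/-- The generator with increasing index tuples, which is zero for index sets of the wrong sizes. -/
def genSet (y : ι → ℝ) (dl : ι → Module.Dual ℝ V) (k ℓ : ℕ) (σ τ : Finset ι) : FF k ℓ V :=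
  if h : σ.card = k + 1 ∧ τ.card = ℓ then
    gen y dl (σ.orderEmbOfFin h.1) (τ.orderEmbOfFin h.2) else 0

theorem genSet_of_card {y : ι → ℝ} {dl : ι → Module.Dual ℝ V} {k ℓ : ℕ} {σ τ : Finset ι}
    (hσ : σ.card = k + 1) (hτ : τ.card = ℓ) :
    genSet y dl k ℓ σ τ = gen y dl (σ.orderEmbOfFin hσ) (τ.orderEmbOfFin hτ) :=
  dif_pos ⟨hσ, hτ⟩

theorem genSet_of_not {y : ι → ℝ} {dl : ι → Module.Dual ℝ V} {k ℓ : ℕ} {σ τ : Finset ι}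
    (h : ¬(σ.card = k + 1 ∧ τ.card = ℓ)) : genSet y dl k ℓ σ τ = 0 :=
  dif_neg h

/-- Sorting `x` into `τ` moves it past the smaller elements of `τ`; a repeated index makes two
columns of the determinant equal. -/
theorem gen_cons_eq_genSet (y : ι → ℝ) (dl : ι → Module.Dual ℝ V) {k ℓ : ℕ} {σ τ : Finset ι}
    (hσ : σ.card = k + 2) (hτ : τ.card = ℓ) (i : Fin (k + 2)) :
    gen y dl (σ.orderEmbOfFin hσ ∘ i.succAbove)
      (Fin.cons (σ.orderEmbOfFin hσ i) (τ.orderEmbOfFin hτ) : Fin (ℓ + 1) → ι) =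
    if σ.orderEmbOfFin hσ i ∈ τ then 0 else
      (-1 : ℝ) ^ (τ.filter (· < σ.orderEmbOfFin hσ i)).card •
        genSet y dl k (ℓ + 1) (σ.erase (σ.orderEmbOfFin hσ i))
          (insert (σ.orderEmbOfFin hσ i) τ) := by
  set x := σ.orderEmbOfFin hσ i with hx
  split_ifs with hxτ
  · have : x ∈ Set.range (τ.orderEmbOfFin hτ) := by rw [Finset.range_orderEmbOfFin]; exact hxτ
    obtain ⟨j, hj⟩ := this
    have h0 : detForm dl (Fin.cons x (τ.orderEmbOfFin hτ) : Fin (ℓ + 1) → ι) = 0 :=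
      detForm_eq_zero dl (i := 0) (j := j.succ) (by simp [hj]) (Fin.succ_ne_zero j).symm
    ext v u
    rw [gen_apply, h0]
    simp
  · have h1 : (σ.erase x).card = k + 1 := by
      rw [Finset.card_erase_of_mem (Finset.orderEmbOfFin_mem _ _ _), hσ]; rfl
    have h2 : (insert x τ).card = ℓ + 1 := by rw [Finset.card_insert_of_notMem hxτ, hτ]
    rw [genSet_of_card h1 h2, orderEmbOfFin_erase hσ i h1]
    have : x ∈ Set.range ((insert x τ).orderEmbOfFin h2) := by
      rw [Finset.range_orderEmbOfFin]; exact Finset.mem_insert_self _ _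
    obtain ⟨j, hj⟩ := this
    have h3 : (τ.orderEmbOfFin hτ : Fin ℓ → ι) = (insert x τ).orderEmbOfFin h2 ∘ j.succAbove := by
      rw [← orderEmbOfFin_erase h2 j (by rw [hj, Finset.erase_insert hxτ, hτ])]
      congr!
      rw [hj, Finset.erase_insert hxτ]
    have h4 : ((insert x τ).orderEmbOfFin h2 : Fin (ℓ + 1) → ι) =
        j.insertNth x (τ.orderEmbOfFin hτ) := by
      exact Fin.eq_insertNth_iff.2 ⟨hj, h3.symm⟩
    have h5 : (τ.filter (· < x)).card = j := by
      rw [← card_filter_lt_orderEmbOfFin h2 j, hj, Finset.filter_insert, if_neg (lt_irrefl x)]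
    ext v u
    rw [AlternatingMap.smul_apply, AlternatingMap.smul_apply, gen_apply, gen_apply, h4,
      detForm_insertNth, h5, AlternatingMap.smul_apply, smul_eq_mul, smul_eq_mul]
    have : (-1 : ℝ) ^ (j : ℕ) * (-1) ^ (j : ℕ) = 1 := by rw [← mul_pow]; simp
    linear_combination (-(whitneyForm y dl (σ.orderEmbOfFin hσ ∘ i.succAbove) v *
      detForm dl (Fin.cons x (τ.orderEmbOfFin hτ) : Fin (ℓ + 1) → ι) u)) * this

/-- `genSet` with the sign that makes `S_†` act without signs. -/
def genSigned (y : ι → ℝ) (dl : ι → Module.Dual ℝ V) (k ℓ : ℕ) (σ τ : Finset ι) : FF k ℓ V :=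
  inversionSign σ τ • genSet y dl k ℓ σ τ

/-- The sorting sign cancels against part of the change of `inversionSign`. What remains is the
number of elements of `σ` below `x` plus the number above it, which is `k + 1` whatever `x` is. -/
theorem sdag_genSigned (y : ι → ℝ) (dl : ι → Module.Dual ℝ V) (k ℓ : ℕ) (σ τ : Finset ι) :
    @Eq (FF k (ℓ + 1) V) (sdag (k + 1) ℓ (genSigned y dl (k + 1) ℓ σ τ))
      ((-1 : ℝ) ^ k • ∑ x ∈ σ \ τ, genSigned y dl k (ℓ + 1) (σ.erase x) (insert x τ)) := by
  by_cases h : σ.card = k + 1 + 1 ∧ τ.card = ℓ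
  · obtain ⟨hσ, hτ⟩ := h
    rw [genSigned, genSet_of_card hσ hτ]
    refine ((map_smul (sdag (k + 1) ℓ) _ _).trans (congrArg
      (fun z : FF k (ℓ + 1) V => inversionSign σ τ • z) (sdag_gen y dl _ _))).trans ?_
    have h1 : ∀ i : Fin (k + 2), inversionSign σ τ • (-1 : ℝ) ^ (i : ℕ) •
        gen y dl (σ.orderEmbOfFin hσ ∘ i.succAbove)
          (Fin.cons (σ.orderEmbOfFin hσ i) (τ.orderEmbOfFin hτ) : Fin (ℓ + 1) → ι) =
        (-1 : ℝ) ^ (k + 1) • (fun x => if x ∈ τ then 0 else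
          genSigned y dl k (ℓ + 1) (σ.erase x) (insert x τ)) (σ.orderEmbOfFin hσ i) := by
      intro i
      rw [gen_cons_eq_genSet]
      dsimp only
      split_ifs with hxτ
      · simp
      · have h2 := inversionSign_erase_insert (Finset.orderEmbOfFin_mem σ hσ i) hxτ
        have h3 := card_filter_lt_orderEmbOfFin hσ i
        have h4 : (σ.filter (σ.orderEmbOfFin hσ i < ·)).card + i = k + 1 := by
          have e1 := Finset.card_filter_add_card_filter_not (s := σ) (· < σ.orderEmbOfFin hσ i)
          have e2 : (σ.filter (¬ · < σ.orderEmbOfFin hσ i)) =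
              insert (σ.orderEmbOfFin hσ i) (σ.filter (σ.orderEmbOfFin hσ i < ·)) := by
            ext a
            simp only [Finset.mem_filter, Finset.mem_insert, not_lt, le_iff_eq_or_lt]
            constructor
            · rintro ⟨ha, rfl | hlt⟩
              · exact Or.inl rfl
              · exact Or.inr ⟨ha, hlt⟩
            · rintro (rfl | ⟨ha, hlt⟩)
              · exact ⟨Finset.orderEmbOfFin_mem _ _ _, Or.inl rfl⟩
              · exact ⟨ha, Or.inr hlt⟩
          rw [e2, Finset.card_insert_of_notMem (by simp), h3] at e1
          omega
        rw [genSigned, smul_smul, smul_smul, smul_smul]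
        congr 1
        set g := (σ.filter (σ.orderEmbOfFin hσ i < ·)).card
        set c := (τ.filter (· < σ.orderEmbOfFin hσ i)).card
        have s1 : ∀ m : ℕ, (-1 : ℝ) ^ m * (-1) ^ m = 1 := fun m => by rw [← mul_pow]; simp
        have hk : (-1 : ℝ) ^ (k + 1) = (-1) ^ g * (-1) ^ (i : ℕ) := by rw [← h4, pow_add]
        rw [hk]
        linear_combination (-(-1 : ℝ) ^ (i : ℕ) * (-1) ^ c * (-1) ^ g) * h2 -
          (inversionSign σ τ * (-1) ^ (i : ℕ) * (-1) ^ c) * s1 g +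
          (inversionSign (σ.erase (σ.orderEmbOfFin hσ i)) (insert (σ.orderEmbOfFin hσ i) τ) *
            (-1 : ℝ) ^ (i : ℕ) * (-1) ^ g) * s1 c
    refine (smul_neg (A := FF k (ℓ + 1) V) (inversionSign σ τ) _).trans ?_
    rw [Finset.smul_sum, Finset.sum_congr rfl fun i _ => h1 i, ← Finset.smul_sum]
    refine (neg_smul (M := FF k (ℓ + 1) V) ((-1 : ℝ) ^ (k + 1)) _).symm.trans ?_
    rw [pow_succ, mul_neg_one, neg_neg]
    congr 1
    have h2 := Finset.sum_map Finset.univ (σ.orderEmbOfFin hσ).toEmbedding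
      (fun x => if x ∈ τ then 0 else genSigned y dl k (ℓ + 1) (σ.erase x) (insert x τ))
    rw [Finset.map_orderEmbOfFin_univ] at h2
    refine h2.symm.trans ?_
    rw [Finset.sum_ite, Finset.sum_const_zero, zero_add, Finset.sdiff_eq_filter]
  · rw [genSigned, genSet_of_not h, smul_zero, map_zero, Finset.sum_eq_zero, smul_zero]
    intro x hx
    rw [genSigned, genSet_of_not, smul_zero]
    rintro ⟨h1, h2⟩
    rw [Finset.mem_sdiff] at hx
    rw [Finset.card_erase_of_mem hx.1] at h1
    rw [Finset.card_insert_of_notMem hx.2] at h2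
    exact h ⟨by omega, by omega⟩

theorem sdagIter_genSigned (dl : ι → Module.Dual ℝ V) {k p : ℕ} (ℓ : ℕ) (hp : p ≤ k) :
    ∃ c : ℝ, c ≠ 0 ∧ ∀ (y : ι → ℝ) (σ τ : Finset ι), sdagIter k ℓ p (genSigned y dl k ℓ σ τ) =
      c • ∑ P ∈ (σ \ τ).powersetCard p, genSigned y dl (k - p) (ℓ + p) (σ \ P) (τ ∪ P) := by
  induction p with
  | zero => exact ⟨1, one_ne_zero, fun y σ τ => by simp [sdagIter]⟩
  | succ p ih =>
    obtain ⟨c, hc, h⟩ := ih (by omega)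
    -- A set `Q` with `p + 1` elements arises from the `p + 1` pairs `(Q \ {x}, x)`; the last `S_†`
    -- acts in degree `k - p` and contributes the sign.
    refine ⟨c * (-1) ^ (k - p - 1) * (p + 1), by
      have : (p : ℝ) + 1 ≠ 0 := by positivity
      simp [hc, this], fun y σ τ => ?_⟩
    have hs : ∀ (j ℓ' : ℕ), 1 ≤ j → ∀ σ τ : Finset ι, sdag j ℓ' (genSigned y dl j ℓ' σ τ) =
        (-1 : ℝ) ^ (j - 1) • ∑ x ∈ σ \ τ,
          genSigned y dl (j - 1) (ℓ' + 1) (σ.erase x) (insert x τ) := by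
      intro j ℓ' hj σ τ
      obtain ⟨j, rfl⟩ : ∃ i, j = i + 1 := ⟨j - 1, by omega⟩
      exact sdag_genSigned y dl j ℓ' σ τ
    have e1 : sdagIter k ℓ (p + 1) (genSigned y dl k ℓ σ τ) =
        sdag (k - p) (ℓ + p) (sdagIter k ℓ p (genSigned y dl k ℓ σ τ)) := rfl
    rw [e1, h, map_smul, map_sum,
      Finset.sum_congr rfl fun P _ => hs (k - p) (ℓ + p) (by omega) _ _, ← Finset.smul_sum,
      smul_smul, mul_smul (c * _)]
    congr 1
    change _ = _ • ∑ Q ∈ (σ \ τ).powersetCard (p + 1),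
      genSigned y dl (k - p - 1) (ℓ + p + 1) (σ \ Q) (τ ∪ Q)
    have e2 : ∀ P ∈ (σ \ τ).powersetCard p, ∀ x ∈ (σ \ P) \ (τ ∪ P),
        genSigned y dl (k - p - 1) (ℓ + p + 1) ((σ \ P).erase x) (insert x (τ ∪ P)) =
        genSigned y dl (k - p - 1) (ℓ + p + 1) (σ \ insert x P) (τ ∪ insert x P) := by
      intro P _ x _
      congr 1
      · ext; simp only [Finset.mem_erase, Finset.mem_sdiff, Finset.mem_insert]; tauto
      · ext; simp only [Finset.mem_union, Finset.mem_insert]; tauto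
    rw [Finset.sum_congr rfl fun P hP => Finset.sum_congr rfl fun x hx => e2 P hP x hx]
    have e3 : ((p : ℝ) + 1) • ∑ Q ∈ (σ \ τ).powersetCard (p + 1),
        genSigned y dl (k - p - 1) (ℓ + p + 1) (σ \ Q) (τ ∪ Q) =
        ∑ Q ∈ (σ \ τ).powersetCard (p + 1), ∑ _x ∈ Q,
        genSigned y dl (k - p - 1) (ℓ + p + 1) (σ \ Q) (τ ∪ Q) := by
      rw [Finset.smul_sum]
      refine Finset.sum_congr rfl fun Q hQ => ?_
      rw [Finset.sum_const, (Finset.mem_powersetCard.1 hQ).2, ← Nat.cast_smul_eq_nsmul ℝ]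
      push_cast
      rfl
    rw [e3, Finset.sum_sigma', Finset.sum_sigma']
    refine Finset.sum_bij' (fun a _ => ⟨insert a.2 a.1, a.2⟩) (fun b _ => ⟨b.1.erase b.2, b.2⟩)
      ?_ ?_ ?_ ?_ ?_
    · rintro ⟨P, x⟩ h
      simp only [Finset.mem_sigma, Finset.mem_powersetCard, Finset.mem_sdiff,
        Finset.mem_union, not_or] at h ⊢
      obtain ⟨⟨h1, h2⟩, ⟨h3, h4⟩, h5, h6⟩ := h
      exact ⟨⟨Finset.insert_subset (Finset.mem_sdiff.2 ⟨h3, h5⟩) h1,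
        by rw [Finset.card_insert_of_notMem h4, h2]⟩, Finset.mem_insert_self _ _⟩
    · rintro ⟨Q, x⟩ h
      simp only [Finset.mem_sigma, Finset.mem_powersetCard, Finset.mem_sdiff,
        Finset.mem_union, not_or] at h ⊢
      obtain ⟨⟨h1, h2⟩, h3⟩ := h
      have h4 := Finset.mem_sdiff.1 (h1 h3)
      exact ⟨⟨(Finset.erase_subset _ _).trans h1,
        by rw [Finset.card_erase_of_mem h3, h2, Nat.add_sub_cancel]⟩,
        ⟨h4.1, Finset.notMem_erase _ _⟩, h4.2, Finset.notMem_erase _ _⟩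
    · rintro ⟨P, x⟩ h
      simp only [Finset.mem_sigma, Finset.mem_sdiff] at h
      simp [Finset.erase_insert h.2.1.2]
    · rintro ⟨Q, x⟩ h
      simp only [Finset.mem_sigma] at h
      simp [Finset.insert_erase h.2]
    · rintro ⟨P, x⟩ h
      rfl

end Signs

variable {n : ℕ}

/-- One of the two determinants has a zero column, the one belonging to `i`. -/
theorem genSigned_apply_eq_zero {V ι : Type*} [AddCommGroup V] [Module ℝ V] [LinearOrder ι]
    {y : ι → ℝ} {dl : ι → Module.Dual ℝ V} {k ℓ : ℕ} {σ τ : Finset ι} {i : ι} (hi : i ∈ σ ∪ τ)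
    {v : Fin k → V} {u : Fin ℓ → V} (hy : y i = 0) (hv : ∀ j, dl i (v j) = 0)
    (hu : ∀ j, dl i (u j) = 0) : genSigned y dl k ℓ σ τ v u = 0 := by
  rw [genSigned]
  by_cases hc : σ.card = k + 1 ∧ τ.card = ℓ
  · rw [genSet_of_card hc.1 hc.2, AlternatingMap.smul_apply, AlternatingMap.smul_apply, gen_apply]
    rcases Finset.mem_union.1 hi with hi | hi
    · have : i ∈ Set.range (σ.orderEmbOfFin hc.1) := by rw [Finset.range_orderEmbOfFin]; exact hi
      obtain ⟨j, hj⟩ := this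
      rw [whitneyForm_apply, Matrix.det_eq_zero_of_column_eq_zero j, zero_mul, smul_zero]
      intro r
      refine Fin.cases ?_ (fun r => ?_) r
      · simpa only [Matrix.of_apply, Fin.cons_zero, hj] using hy
      · simpa only [Matrix.of_apply, Fin.cons_succ, hj] using hv r
    · have : i ∈ Set.range (τ.orderEmbOfFin hc.2) := by rw [Finset.range_orderEmbOfFin]; exact hi
      obtain ⟨j, hj⟩ := this
      rw [detForm_apply, Matrix.det_eq_zero_of_column_eq_zero j, mul_zero, smul_zero]
      intro r
      simpa only [Matrix.of_apply, hj] using hu r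
  · rw [genSet_of_not hc]
    simp

/-! ### Simplices with numbered vertices -/

section Simplices

/-- An enumeration of the vertices of an `m`-simplex, with affine functions on `ℝⁿ` that restrict to
its barycentric coordinates. -/
structure Vertices (F : Finset (Euc n)) (m : ℕ) where
  pt : Fin (m + 1) → Euc n
  image_pt : Finset.univ.image pt = F
  bary : Fin (m + 1) → (Euc n →ᵃ[ℝ] ℝ)
  bary_pt : ∀ i j, bary i (pt j) = if i = j then 1 else 0

theorem IsSimplex.nonempty_vertices {F : Finset (Euc n)} {m : ℕ} (h : IsSimplex F m) :
    Nonempty (Vertices F m) := by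
  classical
  -- Extending the vertices to an affine basis of `ℝⁿ` makes the barycentric coordinates affine
  -- functions on the whole space.
  obtain ⟨t, hFt, ht, htop⟩ := exists_subset_affineIndependent_affineSpan_eq_top h.1
  let b : AffineBasis t ℝ (Euc n) := ⟨(↑), ht, by rw [Subtype.range_coe]; exact htop⟩
  let e := (F.equivFinOfCardEq h.2).symm
  refine ⟨fun i => e i, ?_, fun i => b.coord ⟨e i, hFt (e i).2⟩, fun i j => ?_⟩
  · ext x
    simp only [Finset.mem_image, Finset.mem_univ, true_and]
    exact ⟨fun ⟨i, hi⟩ => hi ▸ (e i).2, fun hx => ⟨e.symm ⟨x, hx⟩, by simp⟩⟩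
  · have : (e j : Euc n) = b ⟨e j, hFt (e j).2⟩ := rfl
    rw [this, AffineBasis.coord_apply]
    simp [Subtype.ext_iff]

theorem IsSimplex.subset {K F : Finset (Euc n)} {m : ℕ} (h : IsSimplex K m) (hF : F ⊆ K)
    (hne : F.Nonempty) : IsSimplex F (dim F) :=
  ⟨h.1.mono hF, (Nat.sub_add_cancel hne.card_pos).symm⟩

namespace Vertices

variable {F : Finset (Euc n)} {m : ℕ} (c : Vertices F m)

theorem pt_mem (i : Fin (m + 1)) : c.pt i ∈ F :=
  c.image_pt.subset (Finset.mem_image_of_mem _ (Finset.mem_univ i))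

theorem exists_pt {x : Euc n} (hx : x ∈ F) : ∃ i, c.pt i = x := by
  rw [← c.image_pt] at hx
  simpa using hx

theorem pt_injective : Function.Injective c.pt := by
  intro i j hij
  have h1 := c.bary_pt i i
  rw [hij, c.bary_pt] at h1
  by_contra h
  simp [h] at h1

theorem card_eq (c : Vertices F m) : F.card = m + 1 := by
  rw [← c.image_pt, Finset.card_image_of_injective _ c.pt_injective]
  simp

theorem dim_eq (c : Vertices F m) : dim F = m := by rw [dim, c.card_eq]; rfl

/-- A vertex as a point of the closed simplex. -/
def cellPt (i : Fin (m + 1)) : cell F := ⟨c.pt i, subset_convexHull ℝ _ (c.pt_mem i)⟩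

/-- The vector from vertex `j` to vertex `i`. -/
def edge (i j : Fin (m + 1)) : tangent F :=
  ⟨c.pt i - c.pt j, vsub_mem_vectorSpan ℝ (c.pt_mem i) (c.pt_mem j)⟩

/-- The differentials of the barycentric coordinates. -/
def dbary (i : Fin (m + 1)) : Module.Dual ℝ (tangent F) :=
  (c.bary i).linear ∘ₗ (tangent F).subtype

theorem bary_eq (x₀ x : cell F) (i : Fin (m + 1)) :
    c.bary i x = c.bary i x₀ + c.dbary i (relPos F x₀ x) := by
  have := (c.bary i).linearMap_vsub x x₀
  change _ = _ + (c.bary i).linear ((x : Euc n) -ᵥ x₀)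
  rw [this]
  simp

theorem dbary_edge (i a b : Fin (m + 1)) :
    c.dbary i (c.edge a b) = (if i = a then 1 else 0) - if i = b then 1 else 0 := by
  rw [← c.bary_pt, ← c.bary_pt]
  exact (c.bary i).linearMap_vsub _ _

theorem linearIndependent_edge (o : Fin (m + 1)) :
    LinearIndependent ℝ fun i => c.edge (o.succAbove i) o := by
  refine LinearIndependent.of_pairwise_dual_eq_zero_one _ (fun i => c.dbary (o.succAbove i))
    (fun i j hij => ?_) fun i => ?_
  · dsimp only
    rw [dbary_edge, if_neg (fun h => hij (Fin.succAbove_right_injective h)),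
      if_neg (Fin.succAbove_ne o i), sub_zero]
  · rw [dbary_edge, if_pos rfl, if_neg (Fin.succAbove_ne o i), sub_zero]

theorem finrank_tangent (c : Vertices F m) : Module.finrank ℝ (tangent F) = m := by
  classical
  refine le_antisymm ?_ ?_
  · have h := finrank_vectorSpan_image_finset_le ℝ c.pt Finset.univ (n := m) (by simp)
    rwa [c.image_pt] at h
  · simpa using (c.linearIndependent_edge 0).fintype_card_le_finrank

/-- The edges from a vertex form a basis of the tangent space. -/
def basis (o : Fin (m + 1)) : Module.Basis (Fin m) ℝ (tangent F) :=
  basisOfLinearIndependentOfCardEqFinrank' _ (c.linearIndependent_edge o)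
    (by rw [c.finrank_tangent, Fintype.card_fin])

theorem basis_apply (o : Fin (m + 1)) (i : Fin m) : c.basis o i = c.edge (o.succAbove i) o := by
  simp [basis]

end Vertices

end Simplices

/-! ### Forms on a simplex -/

section CellForms

/-- A shift of the origin changes `κ b` by a constant form, which `a` absorbs. -/
theorem whitneySpace_relPos_le (k ℓ : ℕ) (F : Finset (Euc n)) (x₀ x₁ : cell F) :
    whitneySpace k ℓ (relPos F x₀) ≤ whitneySpace k ℓ (relPos F x₁) := by
  rintro ω ⟨a, b, h⟩
  refine ⟨a + b.curryLeft (relPos F x₀ x₁), b, fun x => ?_⟩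
  have : relPos F x₀ x = relPos F x₀ x₁ + relPos F x₁ x :=
    Subtype.ext (by simp [relPos])
  rw [h, this, map_add, add_assoc]

theorem cellAlt_eq (k ℓ : ℕ) (F : Finset (Euc n)) (x₀ : cell F) :
    cellAlt k ℓ F = whitneySpace k ℓ (relPos F x₀) :=
  le_antisymm (iSup_le fun x₁ => whitneySpace_relPos_le k ℓ F x₁ x₀)
    (le_iSup (fun x₁ => whitneySpace k ℓ (relPos F x₁)) x₀)

variable {F : Finset (Euc n)} {m : ℕ} (c : Vertices F m) {k ℓ : ℕ}

theorem cellTrace_apply {H : Finset (Euc n)} (hH : H ⊆ F) (ω : CellForm k ℓ F) (x : cell H)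
    (v : Fin k → tangent H) (u : Fin ℓ → tangent H) :
    cellTrace hH ω x v u = ω ⟨x, convexHull_mono (Finset.coe_subset.2 hH) x.2⟩
      (Submodule.inclusion (vectorSpan_mono ℝ (Finset.coe_subset.2 hH)) ∘ v)
      (Submodule.inclusion (vectorSpan_mono ℝ (Finset.coe_subset.2 hH)) ∘ u) :=
  rfl

theorem mem_bubbleAlt {ω : CellForm k ℓ F} : ω ∈ bubbleAlt k ℓ F ↔ ω ∈ cellAlt k ℓ F ∧
    ∀ (H : Finset (Euc n)) (h : H ⊂ F), H.Nonempty → cellTrace h.subset ω = 0 :=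
  Iff.rfl

namespace Vertices

/-- The value of a form on the vertices `s` and the edges from the vertex `s 0` to the vertices
`t`. -/
def coeff (s : Fin (k + 1) → Fin (m + 1)) (t : Fin ℓ → Fin (m + 1)) :
    CellForm k ℓ F →ₗ[ℝ] ℝ where
  toFun ω := ω (c.cellPt (s 0)) (fun i => c.edge (s i.succ) (s 0)) fun j => c.edge (t j) (s 0)
  map_add' _ _ := rfl
  map_smul' _ _ := rfl

/-- By `whitney_ext` the values on `k`-faces suffice. For the second slot the edges issuing from `s
0` form a basis, so `t` needs only indices other than `s 0`; `succAbove` enumerates these. -/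
theorem cellAlt_ext {ω : CellForm k ℓ F} (hω : ω ∈ cellAlt k ℓ F)
    (h : ∀ (s : Fin (k + 1) ↪o Fin (m + 1)) (t : Fin ℓ ↪o Fin m),
      c.coeff s ((s 0).succAbove ∘ t) ω = 0) : ω = 0 := by
  rw [cellAlt_eq k ℓ F (c.cellPt 0)] at hω
  obtain ⟨a, b, hab⟩ := hω
  have h1 := whitney_ext (fun i => relPos F (c.cellPt 0) (c.cellPt i)) (c.basis 0)
    (fun i => by
      rw [basis_apply]
      exact Subtype.ext (by simp [relPos, edge, cellPt])) a b fun s => by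
    refine ext_orderEmb (c.basis (s 0)) fun t => ?_
    rw [← hab]
    have := h s t
    rw [AlternatingMap.zero_apply, ← this]
    change ω _ _ _ = ω _ _ _
    congr 1
    · congr 1
      ext i
      simp [relPos, edge, cellPt]
    · ext j
      simp [basis_apply]
  ext1 x
  have h2 := h1.1
  have h3 : relPos F (c.cellPt 0) (c.cellPt 0) = 0 := Subtype.ext (by simp [relPos])
  rw [hab, h1.2]
  rw [h3, map_zero, add_zero] at h2
  rw [h2]
  ext
  simp

/-- The generators of the Whitney forms on a simplex. -/
def genForm (k ℓ : ℕ) (σ τ : Finset (Fin (m + 1))) : CellForm k ℓ F := fun x =>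
  genSigned (fun i => c.bary i x) c.dbary k ℓ σ τ

theorem genForm_mem_cellAlt (σ τ : Finset (Fin (m + 1))) :
    c.genForm k ℓ σ τ ∈ cellAlt k ℓ F := by
  rw [cellAlt_eq k ℓ F (c.cellPt 0)]
  refine Submodule.smul_mem (whitneySpace k ℓ (relPos F (c.cellPt 0))) (inversionSign σ τ)
    (x := fun x => genSet (fun i => c.bary i x) c.dbary k ℓ σ τ) ?_
  by_cases h : σ.card = k + 1 ∧ τ.card = ℓ
  · simp only [genSet_of_card h.1 h.2]
    exact gen_mem_whitneySpace (fun x i => c.bary_eq (c.cellPt 0) x i) _ _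
  · simp only [genSet_of_not h]
    exact Submodule.zero_mem _

theorem bary_eq_zero {H : Finset (Euc n)} (hH : H ⊆ F) {i : Fin (m + 1)} (hi : c.pt i ∉ H)
    {z : Euc n} (hz : z ∈ cell H) : c.bary i z = 0 := by
  have hc : Convex ℝ ((c.bary i) ⁻¹' {0}) := (convex_singleton 0).affine_preimage _
  refine convexHull_min (fun z hz => ?_) hc hz
  obtain ⟨j, rfl⟩ := c.exists_pt (hH hz)
  rw [Set.mem_preimage, c.bary_pt, if_neg]
  · rfl
  · rintro rfl
    exact hi hz

theorem bary_linear_eq_zero {H : Finset (Euc n)} (hH : H ⊆ F) {i : Fin (m + 1)}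
    (hi : c.pt i ∉ H) {v : Euc n} (hv : v ∈ tangent H) : (c.bary i).linear v = 0 := by
  have : tangent H ≤ LinearMap.ker (c.bary i).linear := by
    rw [tangent, vectorSpan_def, Submodule.span_le]
    rintro _ ⟨a, ha, b, hb, rfl⟩
    change (c.bary i).linear (a -ᵥ b) = 0
    rw [AffineMap.linearMap_vsub, c.bary_eq_zero hH hi (subset_convexHull ℝ _ ha),
      c.bary_eq_zero hH hi (subset_convexHull ℝ _ hb), vsub_self]
  exact this hv

theorem cellTrace_genForm {H : Finset (Euc n)} (hH : H ⊆ F) {i : Fin (m + 1)}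
    (hi : c.pt i ∉ H) {σ τ : Finset (Fin (m + 1))} (hστ : i ∈ σ ∪ τ) :
    cellTrace hH (c.genForm k ℓ σ τ) = 0 := by
  refine funext fun x => AlternatingMap.ext fun v => AlternatingMap.ext fun u => ?_
  rw [cellTrace_apply]
  exact genSigned_apply_eq_zero hστ (c.bary_eq_zero hH hi x.2)
    (fun j => c.bary_linear_eq_zero hH hi (v j).2) fun j => c.bary_linear_eq_zero hH hi (u j).2

theorem genForm_mem_bubbleAlt {σ τ : Finset (Fin (m + 1))} (h : σ ∪ τ = Finset.univ) :
    c.genForm k ℓ σ τ ∈ bubbleAlt k ℓ F := by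
  refine mem_bubbleAlt.2 ⟨c.genForm_mem_cellAlt σ τ, fun H hH hne => ?_⟩
  obtain ⟨x, hxF, hxH⟩ := Finset.exists_of_ssubset hH
  obtain ⟨i, rfl⟩ := c.exists_pt hxF
  exact c.cellTrace_genForm hH.subset hxH (h ▸ Finset.mem_univ i)

/-- The evaluation point and all edges involved lie in the facet opposite to vertex `i`, where the
double trace of a bubble is zero. -/
theorem coeff_eq_zero_of_bubble {ω : CellForm k ℓ F} (hω : ω ∈ bubbleAlt k ℓ F)
    {s : Fin (k + 1) → Fin (m + 1)} {t : Fin ℓ → Fin (m + 1)} {i : Fin (m + 1)}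
    (hs : ∀ j, s j ≠ i) (ht : ∀ j, t j ≠ i) : c.coeff s t ω = 0 := by
  have hss : F.erase (c.pt i) ⊂ F := Finset.erase_ssubset (c.pt_mem i)
  have hmem : ∀ j, j ≠ i → c.pt j ∈ F.erase (c.pt i) := fun j hj =>
    Finset.mem_erase.2 ⟨fun h => hj (c.pt_injective h), c.pt_mem j⟩
  have h := (mem_bubbleAlt.1 hω).2 _ hss ⟨_, hmem _ (hs 0)⟩
  have hed : ∀ a b, a ≠ i → b ≠ i → c.pt a - c.pt b ∈ tangent (F.erase (c.pt i)) :=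
    fun a b ha hb => vsub_mem_vectorSpan ℝ (hmem a ha) (hmem b hb)
  exact congrArg (fun η : CellForm k ℓ (F.erase (c.pt i)) =>
    η ⟨c.pt (s 0), subset_convexHull ℝ _ (hmem _ (hs 0))⟩
      (fun j => ⟨_, hed (s j.succ) (s 0) (hs _) (hs _)⟩)
      fun j => ⟨_, hed (t j) (s 0) (ht _) (hs _)⟩) h

end Vertices

end CellForms

/-! ### The dimension of the bubble spaces -/

section BubbleDimension

/-- A family on which coordinates that are injective on `B` take diagonal values is a basis of
`B`. -/
theorem eq_span_and_finrank_eq_of_coord {M I : Type*} [AddCommMonoid M] [Module ℝ M]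
    [Fintype I] [DecidableEq I] {B : Submodule ℝ M} (θ : M →ₗ[ℝ] (I → ℝ)) (g : I → M)
    (d : I → ℝ) (hd : ∀ i, d i ≠ 0) (hg : ∀ i, g i ∈ B)
    (hθ : ∀ i j, θ (g i) j = if i = j then d i else 0) (hinj : ∀ ω ∈ B, θ ω = 0 → ω = 0) :
    B = Submodule.span ℝ (Set.range g) ∧ Module.Finite ℝ B ∧
      Module.finrank ℝ B = Fintype.card I := by
  let _ := Module.addCommMonoidToAddCommGroup ℝ (M := M)
  have hspan : B = Submodule.span ℝ (Set.range g) := by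
    refine le_antisymm (fun ω hω => ?_) (Submodule.span_le.2 ?_)
    · set η : M := ∑ i, (θ ω i * (d i)⁻¹) • g i with hη
      have h1 : η ∈ Submodule.span ℝ (Set.range g) :=
        Submodule.sum_mem _ fun i _ => Submodule.smul_mem _ _ (Submodule.subset_span ⟨i, rfl⟩)
      have h2 : η ∈ B := Submodule.sum_mem _ fun i _ => Submodule.smul_mem _ _ (hg i)
      have h3 : θ (ω - η) = 0 := by
        rw [map_sub, sub_eq_zero, hη, map_sum]
        ext j
        rw [Finset.sum_apply, Finset.sum_eq_single j]
        · rw [map_smul, Pi.smul_apply, hθ, if_pos rfl, smul_eq_mul, inv_mul_cancel_right₀ (hd j)]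
        · intro i _ hij
          rw [map_smul, Pi.smul_apply, hθ, if_neg hij, smul_zero]
        · simp
      rwa [sub_eq_zero.1 (hinj _ (Submodule.sub_mem _ hω h2) h3)]
    · rintro _ ⟨i, rfl⟩
      exact hg i
  have hli : LinearIndependent ℝ g := by
    rw [Fintype.linearIndependent_iff]
    intro a ha j
    have := congrFun (congrArg θ ha) j
    simp only [map_sum, map_smul, Finset.sum_apply, Pi.smul_apply, hθ, smul_eq_mul, mul_ite,
      mul_zero, Finset.sum_ite_eq', Finset.mem_univ, if_true, map_zero, Pi.zero_apply] at this
    exact (mul_eq_zero.1 this).resolve_right (hd j)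
  refine ⟨hspan, ?_, ?_⟩
  · rw [hspan]
    exact FiniteDimensional.span_of_finite ℝ (Set.finite_range _)
  · rw [hspan, finrank_span_eq_card hli]

theorem finrank_inf_ker_add_map {M M' : Type*} [AddCommMonoid M] [Module ℝ M] [AddCommMonoid M']
    [Module ℝ M'] (X : Submodule ℝ M) [Module.Finite ℝ X] (f : M →ₗ[ℝ] M') :
    Module.finrank ℝ (X ⊓ LinearMap.ker f : Submodule ℝ M) + Module.finrank ℝ (X.map f) =
      Module.finrank ℝ X := by
  let _ := Module.addCommMonoidToAddCommGroup ℝ (M := M)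
  let _ := Module.addCommMonoidToAddCommGroup ℝ (M := M')
  have h := LinearMap.finrank_range_add_finrank_ker (f.domRestrict X)
  rw [LinearMap.range_domRestrict, LinearMap.ker_domRestrict] at h
  have h2 : Module.finrank ℝ (X ⊓ LinearMap.ker f : Submodule ℝ M) =
      Module.finrank ℝ (Submodule.comap X.subtype (LinearMap.ker f)) := by
    rw [← Submodule.map_comap_subtype]
    exact (Submodule.equivMapOfInjective _ X.subtype_injective _).finrank_eq.symm
  rw [h2, ← h, add_comm]

theorem finrank_inf_ker_add_le {M M' : Type*} [AddCommMonoid M] [Module ℝ M] [AddCommMonoid M']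
    [Module ℝ M'] {X : Submodule ℝ M} [Module.Finite ℝ X] {f : M →ₗ[ℝ] M'} {Y : Submodule ℝ M'}
    (h : Y ≤ X.map f) : Module.finrank ℝ (X ⊓ LinearMap.ker f : Submodule ℝ M) +
      Module.finrank ℝ Y ≤ Module.finrank ℝ X := by
  let _ := Module.addCommMonoidToAddCommGroup ℝ (M := M')
  rw [← finrank_inf_ker_add_map X f]
  exact Nat.add_le_add_left (Submodule.finrank_mono h) _

theorem finrank_le_finrank_inf_ker_add {M M' : Type*} [AddCommMonoid M] [Module ℝ M]
    [AddCommMonoid M'] [Module ℝ M'] {X : Submodule ℝ M} [Module.Finite ℝ X] {f : M →ₗ[ℝ] M'}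
    {Y : Submodule ℝ M'} [Module.Finite ℝ Y] (h : X.map f ≤ Y) : Module.finrank ℝ X ≤
      Module.finrank ℝ (X ⊓ LinearMap.ker f : Submodule ℝ M) + Module.finrank ℝ Y := by
  let _ := Module.addCommMonoidToAddCommGroup ℝ (M := M')
  rw [← finrank_inf_ker_add_map X f]
  exact Nat.add_le_add_left (Submodule.finrank_mono h) _

/-- Dual form of the full rank statement: injectivity of the sums, applied to values in the quotient
by `R`, shows that the sums generate every `y T`. -/
theorem mem_of_sum_powersetCard_mem {α M : Type*} [DecidableEq α] [AddCommMonoid M] [Module ℝ M]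
    {R : Submodule ℝ M} {U : Finset α} {t a : ℕ} (hta : t ≤ a) (hU : a + t ≤ U.card)
    (y : Finset α → M) (h : ∀ A ⊆ U, A.card = a → ∑ B ∈ A.powersetCard t, y B ∈ R)
    {T : Finset α} (hT : T ⊆ U) (hTt : T.card = t) : y T ∈ R := by
  let _ := Module.addCommMonoidToAddCommGroup ℝ (M := M)
  refine (Submodule.Quotient.mk_eq_zero R).1 ?_
  refine eq_zero_of_sum_powersetCard hta hU (fun B => R.mkQ (y B)) (fun A hA hAc => ?_) hT hTt
  rw [← map_sum]
  exact (Submodule.Quotient.mk_eq_zero R).2 (h A hA hAc)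

/-- The smallest element of `σ`. -/
def lowest {m : ℕ} (σ : Finset (Fin (m + 1))) : Fin (m + 1) :=
  if h : σ.Nonempty then σ.min' h else 0

theorem lowest_mem {m k : ℕ} {σ : Finset (Fin (m + 1))} (h : σ.card = k + 1) : lowest σ ∈ σ := by
  have hne : σ.Nonempty := Finset.card_pos.1 (by omega)
  rw [lowest, dif_pos hne]
  exact σ.min'_mem hne

theorem lowest_eq {m k : ℕ} {σ : Finset (Fin (m + 1))} (h : σ.card = k + 1) :
    lowest σ = σ.orderEmbOfFin h 0 := by
  rw [lowest, dif_pos (Finset.card_pos.1 (by omega))]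
  exact (Finset.orderEmbOfFin_zero h (by omega)).symm

/-- The index set of the basis of the bubble space. -/
def bubbleIndex (k ℓ m : ℕ) : Finset (Finset (Fin (m + 1)) × Finset (Fin (m + 1))) :=
  (Finset.univ.powersetCard (k + 1) ×ˢ Finset.univ.powersetCard ℓ).filter fun x =>
    lowest x.1 ∉ x.2 ∧ x.1 ∪ x.2 = Finset.univ

theorem mem_bubbleIndex {k ℓ m : ℕ} {x : Finset (Fin (m + 1)) × Finset (Fin (m + 1))} :
    x ∈ bubbleIndex k ℓ m ↔ (x.1.card = k + 1 ∧ x.2.card = ℓ) ∧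
      lowest x.1 ∉ x.2 ∧ x.1 ∪ x.2 = Finset.univ := by
  simp [bubbleIndex]

/-- Given `σ`, the complement of `τ` is a subset of `σ` that contains the lowest vertex; its other
`m - ℓ` elements are free among the remaining `k`. -/
theorem card_bubbleIndex {k ℓ m : ℕ} (h : ℓ ≤ m) :
    (bubbleIndex k ℓ m).card = (m + 1).choose (k + 1) * k.choose (m - ℓ) := by
  have h1 : (bubbleIndex k ℓ m).card = ∑ σ ∈ (Finset.univ : Finset (Fin (m + 1))).powersetCard
      (k + 1), ((σ.erase (lowest σ)).powersetCard (m - ℓ)).card := by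
    rw [← Finset.card_sigma]
    refine Finset.card_nbij' (fun x => ⟨x.1, x.2ᶜ.erase (lowest x.1)⟩)
      (fun y => (y.1, (insert (lowest y.1) y.2)ᶜ)) ?_ ?_ ?_ ?_
    · rintro ⟨σ, τ⟩ hx
      rw [Finset.mem_coe, mem_bubbleIndex] at hx
      obtain ⟨⟨h1, h2⟩, h3, h4⟩ := hx
      simp only [Finset.coe_sigma, Set.mem_sigma_iff, Finset.mem_coe, Finset.mem_powersetCard,
        Finset.subset_univ, true_and]
      refine ⟨h1, Finset.erase_subset_erase _ fun x hx => ?_, ?_⟩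
      · have : x ∈ σ ∪ τ := h4 ▸ Finset.mem_univ x
        exact (Finset.mem_union.1 this).resolve_right (Finset.mem_compl.1 hx)
      · rw [Finset.card_erase_of_mem (Finset.mem_compl.2 h3), Finset.card_compl, Fintype.card_fin]
        dsimp only at h2 ⊢
        omega
    · rintro ⟨σ, ρ⟩ hy
      simp only [Finset.coe_sigma, Set.mem_sigma_iff, Finset.mem_coe, Finset.mem_powersetCard,
        Finset.subset_univ, true_and] at hy
      obtain ⟨h1, h2, h3⟩ := hy
      rw [Finset.mem_coe, mem_bubbleIndex]
      refine ⟨⟨h1, ?_⟩, by simp, ?_⟩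
      · dsimp only
        rw [Finset.card_compl, Finset.card_insert_of_notMem
          (fun h => (Finset.mem_erase.1 (h2 h)).1 rfl), Fintype.card_fin]
        omega
      · rw [← Finset.univ_subset_iff]
        intro x _
        dsimp only
        rw [Finset.mem_union, Finset.mem_compl, Finset.mem_insert]
        by_cases hx : x = lowest σ ∨ x ∈ ρ
        · left
          rcases hx with rfl | hx
          · exact lowest_mem h1
          · exact (Finset.mem_erase.1 (h2 hx)).2
        · exact Or.inr hx
    · rintro ⟨σ, τ⟩ hx
      rw [Finset.mem_coe, mem_bubbleIndex] at hx
      simp [Finset.insert_erase (Finset.mem_compl.2 hx.2.1)]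
    · rintro ⟨σ, ρ⟩ hy
      simp only [Finset.coe_sigma, Set.mem_sigma_iff, Finset.mem_coe, Finset.mem_powersetCard] at hy
      simp [Finset.erase_insert (fun h => (Finset.mem_erase.1 (hy.2.1 h)).1 rfl :
        lowest σ ∉ ρ)]
  rw [h1, Finset.sum_congr rfl fun σ hσ => by
    rw [Finset.card_powersetCard, Finset.card_erase_of_mem
      (lowest_mem (Finset.mem_powersetCard.1 hσ).2), (Finset.mem_powersetCard.1 hσ).2,
      Nat.add_sub_cancel]]
  simp

variable {F : Finset (Euc n)} {m : ℕ} (c : Vertices F m) {k ℓ : ℕ}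

namespace Vertices

/-- The coordinates of a form on a simplex relevant for bubbles. -/
def bubbleCoord (k ℓ : ℕ) : CellForm k ℓ F →ₗ[ℝ] (bubbleIndex k ℓ m → ℝ) :=
  LinearMap.pi fun x => c.coeff
    (x.1.1.orderEmbOfFin (mem_bubbleIndex.1 x.2).1.1)
    (x.1.2.orderEmbOfFin (mem_bubbleIndex.1 x.2).1.2)

/-- Of the evaluations in `cellAlt_ext`, those that miss a vertex vanish on bubbles. The others are
exactly the pairs in `bubbleIndex`, where `lowest σ ∉ τ` reflects that `t` avoids `s 0`. -/
theorem eq_zero_of_bubbleCoord {ω : CellForm k ℓ F} (hω : ω ∈ bubbleAlt k ℓ F)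
    (h : c.bubbleCoord k ℓ ω = 0) : ω = 0 := by
  classical
  refine c.cellAlt_ext (mem_bubbleAlt.1 hω).1 fun s t => ?_
  by_cases hc : ∃ i, (∀ j, s j ≠ i) ∧ ∀ j, ((s 0).succAbove ∘ t) j ≠ i
  · obtain ⟨i, hs, ht⟩ := hc
    exact c.coeff_eq_zero_of_bubble hω hs ht
  · push Not at hc
    set σ := Finset.univ.image s
    set τ := Finset.univ.image ((s 0).succAbove ∘ t)
    have hσ : σ.card = k + 1 := by
      rw [Finset.card_image_of_injective _ s.injective, Finset.card_univ, Fintype.card_fin]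
    have hmono : StrictMono ((s 0).succAbove ∘ t) :=
      (Fin.strictMono_succAbove _).comp t.strictMono
    have hτ : τ.card = ℓ := by
      rw [Finset.card_image_of_injective _ hmono.injective, Finset.card_univ, Fintype.card_fin]
    have es : (s : Fin (k + 1) → Fin (m + 1)) = σ.orderEmbOfFin hσ :=
      Finset.orderEmbOfFin_unique hσ (fun j => Finset.mem_image_of_mem _ (Finset.mem_univ j))
        s.strictMono
    have et : (s 0).succAbove ∘ t = τ.orderEmbOfFin hτ :=
      Finset.orderEmbOfFin_unique hτ (fun j => Finset.mem_image_of_mem _ (Finset.mem_univ j))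
        hmono
    have hmem : (σ, τ) ∈ bubbleIndex k ℓ m := by
      rw [mem_bubbleIndex]
      refine ⟨⟨hσ, hτ⟩, ?_, ?_⟩
      · rw [lowest_eq hσ, ← es]
        simp only [τ, Finset.mem_image, Finset.mem_univ, true_and, Function.comp_apply]
        rintro ⟨j, hj⟩
        exact Fin.succAbove_ne _ _ hj
      · rw [← Finset.univ_subset_iff]
        intro i _
        rw [Finset.mem_union]
        by_cases hi : ∀ j, s j ≠ i
        · obtain ⟨j, hj⟩ := hc i hi
          exact Or.inr (hj ▸ Finset.mem_image_of_mem _ (Finset.mem_univ j))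
        · push Not at hi
          obtain ⟨j, hj⟩ := hi
          exact Or.inl (hj ▸ Finset.mem_image_of_mem _ (Finset.mem_univ j))
    have h0 : c.coeff (σ.orderEmbOfFin hσ) (τ.orderEmbOfFin hτ) ω = 0 :=
      congrFun h ⟨_, hmem⟩
    rwa [← es, ← et] at h0

theorem exists_notMem_of_card_eq {α : Type*} {σ σ' : Finset α} (h : σ.card = σ'.card)
    (hne : σ ≠ σ') : ∃ i ∈ σ, i ∉ σ' := by
  by_contra! hc
  exact hne (Finset.eq_of_subset_of_card_le hc h.ge)

/-- On its own face the matrix is lower triangular with unit diagonal; on a different face of the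
same size the column of a vertex in `σ \ σ'` is zero. -/
theorem whitneyForm_coeff {σ σ' : Finset (Fin (m + 1))} (hσ : σ.card = k + 1)
    (hσ' : σ'.card = k + 1) :
    whitneyForm (fun i => c.bary i (c.pt (σ'.orderEmbOfFin hσ' 0))) c.dbary (σ.orderEmbOfFin hσ)
      (fun i => c.edge (σ'.orderEmbOfFin hσ' (Fin.succ i)) (σ'.orderEmbOfFin hσ' 0)) =
      if σ = σ' then 1 else 0 := by
  rw [whitneyForm_apply]
  split_ifs with h
  · subst h
    rw [Matrix.det_of_isLowerTriangular]
    · refine Finset.prod_eq_one fun i _ => ?_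
      refine Fin.cases ?_ (fun i => ?_) i
      · simp [c.bary_pt]
      · simp [c.dbary_edge]
    · intro i j hij
      have hij : i < j := hij
      revert hij
      refine Fin.cases ?_ (fun i => ?_) i <;> intro hij
      · simp [c.bary_pt, hij.ne']
      · have : j ≠ 0 := (lt_of_le_of_lt (Fin.zero_le _) hij).ne'
        simp [c.dbary_edge, hij.ne', this]
  · obtain ⟨i, hi, hi'⟩ := exists_notMem_of_card_eq (hσ.trans hσ'.symm) h
    have : i ∈ Set.range (σ.orderEmbOfFin hσ) := by rw [Finset.range_orderEmbOfFin]; exact hi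
    obtain ⟨j, rfl⟩ := this
    have hne : ∀ r, σ.orderEmbOfFin hσ j ≠ σ'.orderEmbOfFin hσ' r := fun r e =>
      hi' (e ▸ Finset.orderEmbOfFin_mem _ _ _)
    refine Matrix.det_eq_zero_of_column_eq_zero j fun r => ?_
    refine Fin.cases ?_ (fun r => ?_) r
    · simp [c.bary_pt, hne]
    · simp [c.dbary_edge, hne]

/-- Because `o ∉ τ`, the differentials in `τ` see only the endpoint of an edge issuing from `o`, so
the matrix for `τ = τ'` is the identity. -/
theorem detForm_coeff {τ τ' : Finset (Fin (m + 1))} (hτ : τ.card = ℓ) (hτ' : τ'.card = ℓ)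
    {o : Fin (m + 1)} (ho : o ∉ τ) :
    detForm c.dbary (τ.orderEmbOfFin hτ) (fun j => c.edge (τ'.orderEmbOfFin hτ' j) o) =
      if τ = τ' then 1 else 0 := by
  have hne : ∀ j, τ.orderEmbOfFin hτ j ≠ o := fun j e =>
    ho (e ▸ Finset.orderEmbOfFin_mem _ _ _)
  rw [detForm_apply]
  split_ifs with h
  · subst h
    convert Matrix.det_one (n := Fin ℓ) (R := ℝ)
    ext i j
    simp [c.dbary_edge, hne, Matrix.one_apply, eq_comm]
  · obtain ⟨i, hi, hi'⟩ := exists_notMem_of_card_eq (hτ.trans hτ'.symm) h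
    have : i ∈ Set.range (τ.orderEmbOfFin hτ) := by rw [Finset.range_orderEmbOfFin]; exact hi
    obtain ⟨j, rfl⟩ := this
    refine Matrix.det_eq_zero_of_column_eq_zero j fun r => ?_
    have : τ.orderEmbOfFin hτ j ≠ τ'.orderEmbOfFin hτ' r := fun e =>
      hi' (e ▸ Finset.orderEmbOfFin_mem _ _ _)
    simp [c.dbary_edge, hne, this]

theorem bubbleCoord_genForm (x y : bubbleIndex k ℓ m) :
    c.bubbleCoord k ℓ (c.genForm k ℓ x.1.1 x.1.2) y =
      if x = y then inversionSign x.1.1 x.1.2 else 0 := by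
  obtain ⟨⟨σ, τ⟩, hx⟩ := x
  obtain ⟨⟨σ', τ'⟩, hy⟩ := y
  obtain ⟨⟨h1, h2⟩, h3, h4⟩ := mem_bubbleIndex.1 hx
  obtain ⟨⟨h1', h2'⟩, h3', h4'⟩ := mem_bubbleIndex.1 hy
  have e : c.bubbleCoord k ℓ (c.genForm k ℓ σ τ) ⟨(σ', τ'), hy⟩ = inversionSign σ τ *
      (whitneyForm (fun i => c.bary i (c.pt (σ'.orderEmbOfFin h1' 0))) c.dbary
        (σ.orderEmbOfFin h1) (fun i => c.edge (σ'.orderEmbOfFin h1' (Fin.succ i))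
          (σ'.orderEmbOfFin h1' 0)) *
      detForm c.dbary (τ.orderEmbOfFin h2) (fun j => c.edge (τ'.orderEmbOfFin h2' j)
        (σ'.orderEmbOfFin h1' 0))) := by
    change genSigned _ _ k ℓ σ τ _ _ = _
    rw [genSigned, genSet_of_card h1 h2]
    rfl
  rw [e, whitneyForm_coeff]
  simp only [Subtype.mk.injEq, Prod.mk.injEq]
  by_cases hσ : σ = σ'
  · subst hσ
    rw [detForm_coeff c h2 h2' (by rw [← lowest_eq]; exact h3)]
    split_ifs <;> simp_all
  · simp [hσ]

theorem bubbleAlt_eq_span_and_finrank_eq (k ℓ : ℕ) :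
    bubbleAlt k ℓ F = Submodule.span ℝ
      (Set.range fun x : bubbleIndex k ℓ m => c.genForm k ℓ x.1.1 x.1.2) ∧
    Module.Finite ℝ (bubbleAlt k ℓ F) ∧
      Module.finrank ℝ (bubbleAlt k ℓ F) = Fintype.card (bubbleIndex k ℓ m) := by
  refine eq_span_and_finrank_eq_of_coord (c.bubbleCoord k ℓ)
    (fun x : bubbleIndex k ℓ m => c.genForm k ℓ x.1.1 x.1.2)
    (fun x : bubbleIndex k ℓ m => inversionSign x.1.1 x.1.2)
    (fun x h => ?_) (fun x => c.genForm_mem_bubbleAlt (mem_bubbleIndex.1 x.2).2.2)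
    c.bubbleCoord_genForm fun ω hω h => c.eq_zero_of_bubbleCoord hω h
  have h1 := inversionSign_mul_self x.1.1 x.1.2
  rw [h] at h1
  simp at h1

theorem finite_bubbleAlt (c : Vertices F m) (k ℓ : ℕ) : Module.Finite ℝ (bubbleAlt k ℓ F) :=
  (c.bubbleAlt_eq_span_and_finrank_eq k ℓ).2.1

theorem finrank_bubbleAlt (c : Vertices F m) (h : ℓ ≤ m) :
    Module.finrank ℝ (bubbleAlt k ℓ F) = (m + 1).choose (k + 1) * k.choose (m - ℓ) := by
  rw [(c.bubbleAlt_eq_span_and_finrank_eq k ℓ).2.2, Fintype.card_coe, card_bubbleIndex h]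

/-- `S_{†,[p]}` maps the bubbles onto the bubbles. -/
theorem bubbleAlt_le_map {p : ℕ} (c : Vertices F m) (hp : p ≤ k) (hk : k + 1 ≤ ℓ + p) :
    bubbleAlt (k - p) (ℓ + p) F ≤
      (bubbleAlt k ℓ F).map ((sdagIter k ℓ p).compLeft (cell F)) := by
  set R := (bubbleAlt k ℓ F).map ((sdagIter k ℓ p).compLeft (cell F)) with hR
  rw [(c.bubbleAlt_eq_span_and_finrank_eq _ _).1, Submodule.span_le]
  rintro _ ⟨⟨⟨σ, τ⟩, hx⟩, rfl⟩
  obtain ⟨⟨h1, h2⟩, -, h4⟩ := mem_bubbleIndex.1 hx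
  dsimp only at h1 h2 h4 ⊢
  -- Moving vertices from `σ \ τ` to `τ` preserves both `J` and the union. The generators with
  -- intersection `J` are thus indexed by subsets `B` of `U`, as `(J ∪ B, univ \ B)`, and the target
  -- is the one with `B = T`.
  set J := σ ∩ τ with hJ
  set T := σ \ τ with hT
  set U := Finset.univ \ J with hU
  have hTJ : T.card + J.card = k - p + 1 := by rw [← h1, Finset.card_sdiff_add_card_inter]
  have hUJ : U.card + J.card = m + 1 := by
    rw [hU, Finset.card_sdiff_add_card_eq_card (Finset.subset_univ J), Finset.card_univ,
      Fintype.card_fin]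
  have hst : J.card + (m + 1) = (k - p + 1) + (ℓ + p) := by
    have := Finset.card_union_add_card_inter σ τ
    rw [h4, Finset.card_univ, Fintype.card_fin, ← hJ] at this
    omega
  obtain ⟨c₀, hc₀, hS⟩ := sdagIter_genSigned c.dbary ℓ hp
  -- After inserting the cardinalities this is `k + 1 ≤ ℓ + p`.
  have hcard : T.card + p + T.card ≤ U.card := by
    have key : ∀ t j u : ℕ, t + j = k - p + 1 → u + j = m + 1 →
        j + (m + 1) = (k - p + 1) + (ℓ + p) → t + p + t ≤ u := by omega
    exact key _ _ _ hTJ hUJ hst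
  have hmain := mem_of_sum_powersetCard_mem (R := R) (U := U) (t := T.card) (a := T.card + p)
    (Nat.le_add_right _ _) hcard
    (fun B => c.genForm (k - p) (ℓ + p) (J ∪ B) (Finset.univ \ B)) (fun A hA hAc => by
      have hJA : Disjoint J A := by
        refine Finset.disjoint_left.2 fun x hx hx' => ?_
        exact (Finset.mem_sdiff.1 (hA hx')).2 hx
      have hmem : c.genForm k ℓ (J ∪ A) (Finset.univ \ A) ∈ bubbleAlt k ℓ F :=
        c.genForm_mem_bubbleAlt (by ext x; simp)
      have e1 : (sdagIter k ℓ p).compLeft (cell F) (c.genForm k ℓ (J ∪ A) (Finset.univ \ A)) =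
          c₀ • ∑ B ∈ A.powersetCard T.card,
            c.genForm (k - p) (ℓ + p) (J ∪ B) (Finset.univ \ B) := by
        funext x
        refine (hS _ _ _).trans ?_
        rw [Pi.smul_apply, Finset.sum_apply]
        congr 1
        have e2 : (J ∪ A) \ (Finset.univ \ A) = A := by ext x; simp; tauto
        rw [e2]
        have hle : ∀ P ⊆ A, (A \ P).card + P.card = A.card := fun P hP =>
          Finset.card_sdiff_add_card_eq_card hP
        -- Index the terms by what remains of `A` instead of by the part `P` that is moved.
        refine Finset.sum_bij' (fun P _ => A \ P) (fun B _ => A \ B) ?_ ?_ ?_ ?_ ?_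
        · intro P hP
          rw [Finset.mem_powersetCard] at hP ⊢
          have := hle P hP.1
          exact ⟨Finset.sdiff_subset, by omega⟩
        · intro P hP
          rw [Finset.mem_powersetCard] at hP ⊢
          have := hle P hP.1
          exact ⟨Finset.sdiff_subset, by omega⟩
        · intro P hP
          exact Finset.sdiff_sdiff_eq_self (Finset.mem_powersetCard.1 hP).1
        · intro P hP
          exact Finset.sdiff_sdiff_eq_self (Finset.mem_powersetCard.1 hP).1
        · intro P hP
          have hPA := (Finset.mem_powersetCard.1 hP).1
          have e3 : (J ∪ A) \ P = J ∪ A \ P := by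
            ext x
            have h1 := @hPA x
            have h2 := fun h : x ∈ J => Finset.disjoint_left.1 hJA h
            simp only [Finset.mem_union, Finset.mem_sdiff]
            tauto
          have e4 : Finset.univ \ A ∪ P = Finset.univ \ (A \ P) := by
            ext x
            simp only [Finset.mem_union, Finset.mem_sdiff, Finset.mem_univ, true_and]
            tauto
          rw [e3, e4]
          rfl
      have e5 : c₀ • ∑ B ∈ A.powersetCard T.card,
          c.genForm (k - p) (ℓ + p) (J ∪ B) (Finset.univ \ B) ∈ R :=
        e1 ▸ Submodule.mem_map_of_mem hmem
      exact (Submodule.smul_mem_iff R hc₀).1 e5)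
    (T := T) (by
      intro x hx
      rw [hT, Finset.mem_sdiff] at hx
      simp [hU, hJ, hx.2]) rfl
  have e7 : J ∪ T = σ := by
    ext x; simp only [hJ, hT, Finset.mem_union, Finset.mem_inter, Finset.mem_sdiff]; tauto
  have e8 : Finset.univ \ T = τ := by
    ext x
    have : x ∈ σ ∪ τ := h4 ▸ Finset.mem_univ x
    rw [Finset.mem_union] at this
    simp only [hT, Finset.mem_sdiff, Finset.mem_univ, true_and]
    tauto
  rwa [e7, e8] at hmain

end Vertices

theorem finrank_bubbleW_add_le {p : ℕ} (c : Vertices F m) (hp : p ≤ k) (hk : k + 1 ≤ ℓ + p) :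
    Module.finrank ℝ (bubbleW k ℓ p F) + Module.finrank ℝ (bubbleAlt (k - p) (ℓ + p) F) ≤
      Module.finrank ℝ (bubbleAlt k ℓ F) := by
  have := c.finite_bubbleAlt k ℓ
  exact finrank_inf_ker_add_le (c.bubbleAlt_le_map hp hk)

/-- The target of `S_{†,[p]}` consists of forms with values in alternating `(ℓ+p)`-forms on an
`m`-dimensional space, which are zero. -/
theorem bubbleW_eq_bubbleAlt {p : ℕ} (c : Vertices F m) (h : m < ℓ + p) :
    bubbleW k ℓ p F = bubbleAlt k ℓ F := by
  rw [bubbleW, symmetric_eq_top, inf_top_eq]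
  ext ω : 1
  ext v : 1
  exact alternatingMap_eq_zero_of_finrank_lt (by rwa [c.finrank_tangent]) _

end BubbleDimension

/-! ### The measure on a simplex -/

section CellMeasure

theorem isCompact_cell (F : Finset (Euc n)) : IsCompact (cell F) :=
  F.finite_toSet.isCompact_convexHull ℝ

instance compactSpace_cell (F : Finset (Euc n)) : CompactSpace (cell F) :=
  isCompact_iff_compactSpace.1 (isCompact_cell F)

theorem cellMeasure_apply (F : Finset (Euc n)) (s : Set (cell F)) :
    cellMeasure F s = (μHE[dim F] : Measure (Euc n)) (Subtype.val '' s) :=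
  (MeasurableEmbedding.subtype_coe (isCompact_cell F).isClosed.measurableSet).comap_apply _ _

variable {F : Finset (Euc n)} {m : ℕ}

/-- The isometric parametrization of the affine hull of `F` by its tangent space. -/
def tangentShift (F : Finset (Euc n)) (x₀ : Euc n) (v : tangent F) : Euc n := v + x₀

theorem isometry_tangentShift (F : Finset (Euc n)) (x₀ : Euc n) :
    Isometry (tangentShift F x₀) :=
  (isometry_add_right x₀).comp isometry_subtype_coe

theorem isCompact_preimage_tangentShift (F : Finset (Euc n)) (x₀ : Euc n) :
    IsCompact (tangentShift F x₀ ⁻¹' cell F) :=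
  (isometry_tangentShift F x₀).isClosedEmbedding.isCompact_preimage (isCompact_cell F)

theorem convex_preimage_tangentShift (F : Finset (Euc n)) (x₀ : Euc n) :
    Convex ℝ (tangentShift F x₀ ⁻¹' cell F) := by
  have := (convex_convexHull ℝ (F : Set (Euc n))).affine_preimage
    ((tangent F).subtype.toAffineMap + AffineMap.const ℝ (tangent F) x₀)
  exact this

theorem Vertices.interior_preimage_tangentShift_nonempty (c : Vertices F m) :
    (interior (tangentShift F (c.pt 0) ⁻¹' cell F)).Nonempty := by
  rw [(convex_preimage_tangentShift F (c.pt 0)).interior_nonempty_iff_affineSpan_eq_top]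
  have h0 : (0 : tangent F) ∈ tangentShift F (c.pt 0) ⁻¹' cell F := by
    rw [Set.mem_preimage, tangentShift, Submodule.coe_zero, zero_add]
    exact (c.cellPt 0).2
  rw [AffineSubspace.affineSpan_eq_top_iff_vectorSpan_eq_top_of_nonempty ℝ _ _ ⟨0, h0⟩,
    ← top_le_iff, ← (c.basis 0).span_eq, Submodule.span_le]
  rintro _ ⟨i, rfl⟩
  rw [← sub_zero (c.basis 0 i)]
  refine vsub_mem_vectorSpan ℝ ?_ h0
  rw [Set.mem_preimage, c.basis_apply]
  change c.pt _ - c.pt 0 + c.pt 0 ∈ _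
  rw [sub_add_cancel]
  exact (c.cellPt _).2

theorem Vertices.isAddHaarMeasure (c : Vertices F m) :
    (μHE[dim F] : Measure (tangent F)).IsAddHaarMeasure := by
  rw [c.dim_eq, ← c.finrank_tangent]
  infer_instance

/-- The cell is an isometric image of a compact subset of its tangent space, where the Hausdorff
measure is a Haar measure. -/
theorem Vertices.isFiniteMeasure_cellMeasure (c : Vertices F m) :
    IsFiniteMeasure (cellMeasure F) := by
  refine ⟨?_⟩
  have := c.isAddHaarMeasure
  rw [cellMeasure_apply, Set.image_univ, Subtype.range_coe]
  have h : cell F = tangentShift F (c.pt 0) '' (tangentShift F (c.pt 0) ⁻¹' cell F) := by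
    rw [Set.image_preimage_eq_of_subset]
    intro x hx
    exact ⟨relPos F (c.cellPt 0) ⟨x, hx⟩, sub_add_cancel _ _⟩
  rw [h, (isometry_tangentShift F _).euclideanHausdorffMeasure_image]
  exact (isCompact_preimage_tangentShift F _).measure_lt_top

/-- In the tangent space the cell is a convex set with nonempty interior, hence contained in the
closure of its interior. A nonempty relatively open set therefore meets the interior in a nonempty
open set, of positive Haar measure. -/
theorem Vertices.isOpenPosMeasure_cellMeasure (c : Vertices F m) :
    (cellMeasure F).IsOpenPosMeasure := by
  refine ⟨fun U hU hne => ?_⟩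
  have := c.isAddHaarMeasure
  obtain ⟨O, hO, rfl⟩ := isOpen_induced_iff.1 hU
  obtain ⟨x, hx⟩ := hne
  set D := tangentShift F (c.pt 0) ⁻¹' cell F
  have hcont := (isometry_tangentShift F (c.pt 0)).continuous
  have hval : tangentShift F (c.pt 0) (relPos F (c.cellPt 0) x) = x := sub_add_cancel _ _
  have h1 : relPos F (c.cellPt 0) x ∈ closure (interior D) := by
    rw [(convex_preimage_tangentShift F _).closure_interior_eq_closure_of_nonempty_interior
      c.interior_preimage_tangentShift_nonempty]
    refine subset_closure ?_
    rw [Set.mem_preimage, hval]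
    exact x.2
  have h2 : (tangentShift F (c.pt 0) ⁻¹' O ∩ interior D).Nonempty :=
    mem_closure_iff.1 h1 _ (hO.preimage hcont) (by rw [Set.mem_preimage, hval]; exact hx)
  have h3 := (((hO.preimage hcont).inter isOpen_interior).measure_pos
    (μHE[dim F] : Measure (tangent F)) h2).ne'
  rw [← (isometry_tangentShift F (c.pt 0)).euclideanHausdorffMeasure_image] at h3
  rw [cellMeasure_apply]
  refine fun h4 => h3 (measure_mono_null ?_ h4)
  rintro _ ⟨v, ⟨hv1, hv2⟩, rfl⟩
  have hv3 : v ∈ D := interior_subset hv2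
  exact ⟨⟨_, hv3⟩, hv1, rfl⟩

end CellMeasure

/-! ### Frobenius products of continuous forms -/

section Pairing

/-- `ip` is an inner product on `N` that is continuous on the functions in `C`. -/
structure IsPairing {S N : Type*} [TopologicalSpace S] [AddCommMonoid N] [Module ℝ N]
    (C : Submodule ℝ (S → N)) (ip : N → N → ℝ) : Prop where
  add_left : ∀ a a' b, ip (a + a') b = ip a b + ip a' b
  smul_left : ∀ (t : ℝ) a b, ip (t • a) b = t * ip a b
  add_right : ∀ a b b', ip a (b + b') = ip a b + ip a b'
  smul_right : ∀ (t : ℝ) a b, ip a (t • b) = t * ip a b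
  nonneg : ∀ a, 0 ≤ ip a a
  definite : ∀ a, ip a a = 0 → a = 0
  continuous : ∀ a ∈ C, ∀ b ∈ C, Continuous fun x => ip (a x) (b x)

variable {S : Type*} [TopologicalSpace S]

/-- Continuous real functions. -/
def contFun (S : Type*) [TopologicalSpace S] : Submodule ℝ (S → ℝ) where
  carrier := {f | Continuous f}
  zero_mem' := continuous_zero
  add_mem' := Continuous.add
  smul_mem' c _ h := h.const_smul c

theorem isPairing_mul : IsPairing (contFun S) (· * ·) where
  add_left := add_mul
  smul_left := mul_assoc
  add_right := mul_add
  smul_right t a b := mul_left_comm a t b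
  nonneg := mul_self_nonneg
  definite _ := mul_self_eq_zero.1
  continuous _ ha _ hb := Continuous.mul ha hb

/-- Functions with values in alternating forms, all of whose evaluations are in `C`. -/
def altFun (k : ℕ) (V : Type*) [AddCommGroup V] [Module ℝ V] {N : Type*} [AddCommMonoid N]
    [Module ℝ N] (C : Submodule ℝ (S → N)) : Submodule ℝ (S → V [⋀^Fin k]→ₗ[ℝ] N) where
  carrier := {f | ∀ v, (fun x => f x v) ∈ C}
  zero_mem' _ := C.zero_mem
  add_mem' ha hb v := C.add_mem (ha v) (hb v)
  smul_mem' c _ h v := C.smul_mem c (h v)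

variable {N : Type*} [AddCommMonoid N] [Module ℝ N] {C : Submodule ℝ (S → N)} {ip : N → N → ℝ}

/-- `frobenius` for values in an additive monoid. -/
def frobeniusSum (k : ℕ) {V : Type*} [NormedAddCommGroup V] [InnerProductSpace ℝ V]
    [FiniteDimensional ℝ V] {N : Type*} [AddCommMonoid N] [Module ℝ N] (ip : N → N → ℝ)
    (α β : V [⋀^Fin k]→ₗ[ℝ] N) : ℝ :=
  ∑ f : Fin k → Fin (Module.finrank ℝ V),
    ip (α fun i => stdOrthonormalBasis ℝ V (f i)) (β fun i => stdOrthonormalBasis ℝ V (f i))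

theorem IsPairing.frobeniusSum {V : Type*} [NormedAddCommGroup V] [InnerProductSpace ℝ V]
    [FiniteDimensional ℝ V] (h : IsPairing C ip) (k : ℕ) :
    IsPairing (altFun k V C) (FormValued.frobeniusSum k ip) where
  add_left a a' b := by
    simp only [FormValued.frobeniusSum, AlternatingMap.add_apply, h.add_left, Finset.sum_add_distrib]
  smul_left t a b := by
    simp only [FormValued.frobeniusSum, AlternatingMap.smul_apply, h.smul_left, Finset.mul_sum]
  add_right a b b' := by
    simp only [FormValued.frobeniusSum, AlternatingMap.add_apply, h.add_right, Finset.sum_add_distrib]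
  smul_right t a b := by
    simp only [FormValued.frobeniusSum, AlternatingMap.smul_apply, h.smul_right, Finset.mul_sum]
  nonneg a := Finset.sum_nonneg fun f _ => h.nonneg _
  definite a ha := by
    have h1 := (Finset.sum_eq_zero_iff_of_nonneg fun f _ => h.nonneg _).1 ha
    refine (stdOrthonormalBasis ℝ V).toBasis.ext_alternating fun v _ => ?_
    have := h.definite _ (h1 v (Finset.mem_univ _))
    simpa using this
  continuous a ha b hb := continuous_finsetSum _ fun f _ => h.continuous _ (ha _) _ (hb _)

namespace IsPairing

theorem integral_smul_left [MeasurableSpace S] {μ : Measure S} (h : IsPairing C ip)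
    (t : ℝ) (a b : S → N) :
    ∫ x, ip ((t • a) x) (b x) ∂μ = t * ∫ x, ip (a x) (b x) ∂μ := by
  simp only [Pi.smul_apply, h.smul_left]
  exact integral_const_mul _ _

theorem integral_smul_right [MeasurableSpace S] {μ : Measure S} (h : IsPairing C ip)
    (t : ℝ) (a b : S → N) :
    ∫ x, ip (a x) ((t • b) x) ∂μ = t * ∫ x, ip (a x) (b x) ∂μ := by
  simp only [Pi.smul_apply, h.smul_right]
  exact integral_const_mul _ _

variable [CompactSpace S] [MeasurableSpace S] [OpensMeasurableSpace S] {μ : Measure S}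
  [IsFiniteMeasure μ]

theorem integrable (h : IsPairing C ip) {a b : S → N} (ha : a ∈ C) (hb : b ∈ C) :
    Integrable (fun x => ip (a x) (b x)) μ :=
  (h.continuous a ha b hb).integrable_of_hasCompactSupport (HasCompactSupport.of_compactSpace _)

theorem integral_add_left (h : IsPairing C ip) {a a' b : S → N} (ha : a ∈ C) (ha' : a' ∈ C)
    (hb : b ∈ C) : ∫ x, ip ((a + a') x) (b x) ∂μ =
      ∫ x, ip (a x) (b x) ∂μ + ∫ x, ip (a' x) (b x) ∂μ := by
  simp only [Pi.add_apply, h.add_left]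
  exact integral_add (h.integrable ha hb) (h.integrable ha' hb)

theorem integral_add_right (h : IsPairing C ip) {a b b' : S → N} (ha : a ∈ C) (hb : b ∈ C)
    (hb' : b' ∈ C) : ∫ x, ip (a x) ((b + b') x) ∂μ =
      ∫ x, ip (a x) (b x) ∂μ + ∫ x, ip (a x) (b' x) ∂μ := by
  simp only [Pi.add_apply, h.add_right]
  exact integral_add (h.integrable ha hb) (h.integrable ha hb')

theorem eq_zero_of_integral [μ.IsOpenPosMeasure] (h : IsPairing C ip) {a : S → N} (ha : a ∈ C)
    (h0 : ∫ x, ip (a x) (a x) ∂μ = 0) : a = 0 := by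
  rw [integral_eq_zero_iff_of_nonneg (fun x => h.nonneg _) (h.integrable ha ha)] at h0
  have := (Continuous.ae_eq_iff_eq μ (h.continuous a ha a ha) continuous_zero).1 h0
  exact funext fun x => h.definite _ (congrFun this x)

end IsPairing

end Pairing

/-! ### Continuity and linearity of the degrees of freedom -/

section Dofs

variable {k ℓ : ℕ}

theorem continuous_of_mem_whitneySpace {S V : Type*} [TopologicalSpace S] [NormedAddCommGroup V]
    [NormedSpace ℝ V] [FiniteDimensional ℝ V] {pos : S → V} (hpos : Continuous pos)
    {ω : S → FF k ℓ V} (hω : ω ∈ whitneySpace k ℓ pos) (v : Fin k → V) (u : Fin ℓ → V) :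
    Continuous fun x => ω x v u := by
  obtain ⟨a, b, h⟩ := hω
  let f : V →ₗ[ℝ] ℝ :=
    { toFun := fun x => b.curryLeft x v u
      map_add' := fun x y => by rw [map_add]; rfl
      map_smul' := fun t x => by rw [map_smul]; rfl }
  have e : (fun x => ω x v u) = fun x => a v u + f (pos x) := by
    funext x
    rw [h]
    rfl
  rw [e]
  exact continuous_const.add (f.continuous_of_finiteDimensional.comp hpos)

theorem mem_altFun_of_mem_cellAlt {F : Finset (Euc n)} {η : CellForm k ℓ F}
    (hη : η ∈ cellAlt k ℓ F) :
    η ∈ altFun k (tangent F) (altFun ℓ (tangent F) (contFun (cell F))) := by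
  rcases isEmpty_or_nonempty (cell F) with hF | ⟨⟨x₀⟩⟩
  · exact fun v u => continuous_of_const fun x => hF.elim x
  · rw [cellAlt_eq k ℓ F x₀] at hη
    refine fun v u => continuous_of_mem_whitneySpace ?_ hη v u
    exact Continuous.subtype_mk (continuous_subtype_val.sub continuous_const) _

variable {η : Form n k ℓ}

theorem doubleTrace_mem_altFun (F : Finset (Euc n)) (hη : η ∈ shapeAlt n k ℓ) :
    doubleTrace F η ∈ altFun k (tangent F) (altFun ℓ (tangent F) (contFun (cell F))) :=
  fun v u => (continuous_of_mem_whitneySpace continuous_id hη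
    (fun i => (v i : Euc n)) fun i => (u i : Euc n)).comp continuous_subtype_val

theorem mixedTrace_mem_altFun {q r : ℕ} (h : q + r = ℓ) (F : Finset (Euc n))
    (hη : η ∈ shapeAlt n k ℓ) : mixedTrace h F η ∈
      altFun k (tangent F) (altFun q (tangent F) (altFun r (normal F) (contFun (cell F)))) := by
  intro v t ν
  exact (continuous_of_mem_whitneySpace continuous_id hη (fun i => (v i : Euc n)) _).comp
    continuous_subtype_val

theorem const_mem_altFun {q r : ℕ} (F : Finset (Euc n)) (b : FormTanNor F k q r) :
    (fun _ => b) ∈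
      altFun k (tangent F) (altFun q (tangent F) (altFun r (normal F) (contFun (cell F)))) :=
  fun _ _ _ => continuous_const

theorem isPairing_bubble (k ℓ : ℕ) (F : Finset (Euc n)) :
    IsPairing (altFun k (tangent F) (altFun ℓ (tangent F) (contFun (cell F))))
      (frobeniusSum k (frobeniusSum ℓ (· * ·))) :=
  (isPairing_mul.frobeniusSum ℓ).frobeniusSum k

theorem isPairing_skeletal (k q r : ℕ) (F : Finset (Euc n)) :
    IsPairing (altFun k (tangent F) (altFun q (tangent F) (altFun r (normal F) (contFun (cell F)))))
      (frobeniusSum k (frobeniusSum q (frobeniusSum r (· * ·)))) :=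
  ((isPairing_mul.frobeniusSum r).frobeniusSum q).frobeniusSum k

theorem bubbleDof_eq (F : Finset (Euc n)) (η : Form n k ℓ) (b : CellForm k ℓ F) :
    bubbleDof F η b = ∫ x, frobeniusSum k (frobeniusSum ℓ (· * ·)) (doubleTrace F η x) (b x)
      ∂cellMeasure F := rfl

theorem skeletalDof_eq {q r : ℕ} (h : q + r = ℓ) (F : Finset (Euc n)) (η : Form n k ℓ)
    (b : FormTanNor F k q r) : skeletalDof h F η b =
      ∫ x, frobeniusSum k (frobeniusSum q (frobeniusSum r (· * ·))) (mixedTrace h F η x) b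
        ∂cellMeasure F := rfl

variable {F : Finset (Euc n)} {m : ℕ} {η' : Form n k ℓ}

theorem doubleTrace_add (F : Finset (Euc n)) (η η' : Form n k ℓ) :
    doubleTrace F (η + η') = doubleTrace F η + doubleTrace F η' := rfl

theorem doubleTrace_smul (F : Finset (Euc n)) (t : ℝ) (η : Form n k ℓ) :
    doubleTrace F (t • η) = t • doubleTrace F η := rfl

theorem mixedTrace_add {q r : ℕ} (h : q + r = ℓ) (F : Finset (Euc n)) (η η' : Form n k ℓ) :
    mixedTrace h F (η + η') = mixedTrace h F η + mixedTrace h F η' := rfl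

theorem mixedTrace_smul {q r : ℕ} (h : q + r = ℓ) (F : Finset (Euc n)) (t : ℝ) (η : Form n k ℓ) :
    mixedTrace h F (t • η) = t • mixedTrace h F η := rfl

namespace Vertices

theorem bubbleDof_add (c : Vertices F m) (hη : η ∈ shapeAlt n k ℓ) (hη' : η' ∈ shapeAlt n k ℓ)
    {b : CellForm k ℓ F} (hb : b ∈ cellAlt k ℓ F) :
    bubbleDof F (η + η') b = bubbleDof F η b + bubbleDof F η' b := by
  have := c.isFiniteMeasure_cellMeasure
  rw [bubbleDof_eq, bubbleDof_eq, bubbleDof_eq, doubleTrace_add]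
  exact (isPairing_bubble k ℓ F).integral_add_left (doubleTrace_mem_altFun F hη)
    (doubleTrace_mem_altFun F hη') (mem_altFun_of_mem_cellAlt hb)

theorem bubbleDof_add_right (c : Vertices F m) (hη : η ∈ shapeAlt n k ℓ)
    {b b' : CellForm k ℓ F} (hb : b ∈ cellAlt k ℓ F) (hb' : b' ∈ cellAlt k ℓ F) :
    bubbleDof F η (b + b') = bubbleDof F η b + bubbleDof F η b' := by
  have := c.isFiniteMeasure_cellMeasure
  rw [bubbleDof_eq, bubbleDof_eq, bubbleDof_eq]
  exact (isPairing_bubble k ℓ F).integral_add_right (doubleTrace_mem_altFun F hη)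
    (mem_altFun_of_mem_cellAlt hb) (mem_altFun_of_mem_cellAlt hb')

theorem skeletalDof_add (c : Vertices F m) {q r : ℕ} (h : q + r = ℓ) (hη : η ∈ shapeAlt n k ℓ)
    (hη' : η' ∈ shapeAlt n k ℓ) (b : FormTanNor F k q r) :
    skeletalDof h F (η + η') b = skeletalDof h F η b + skeletalDof h F η' b := by
  have := c.isFiniteMeasure_cellMeasure
  rw [skeletalDof_eq, skeletalDof_eq, skeletalDof_eq, mixedTrace_add]
  exact (isPairing_skeletal k q r F).integral_add_left (mixedTrace_mem_altFun h F hη)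
    (mixedTrace_mem_altFun h F hη') (const_mem_altFun F b)

theorem skeletalDof_add_right (c : Vertices F m) {q r : ℕ} (h : q + r = ℓ)
    (hη : η ∈ shapeAlt n k ℓ) (b b' : FormTanNor F k q r) :
    skeletalDof h F η (b + b') = skeletalDof h F η b + skeletalDof h F η b' := by
  have := c.isFiniteMeasure_cellMeasure
  rw [skeletalDof_eq, skeletalDof_eq, skeletalDof_eq]
  exact (isPairing_skeletal k q r F).integral_add_right (mixedTrace_mem_altFun h F hη)
    (const_mem_altFun F b) (const_mem_altFun F b')

end Vertices

/-- In contrast to additivity, homogeneity of the integral needs no integrability, so no membership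
in a shape space is assumed. -/
theorem bubbleDof_smul (t : ℝ) (η : Form n k ℓ) (b : CellForm k ℓ F) :
    bubbleDof F (t • η) b = t * bubbleDof F η b := by
  rw [bubbleDof_eq, bubbleDof_eq, doubleTrace_smul]
  exact (isPairing_bubble k ℓ F).integral_smul_left t _ _

theorem bubbleDof_smul_right (t : ℝ) (η : Form n k ℓ) (b : CellForm k ℓ F) :
    bubbleDof F η (t • b) = t * bubbleDof F η b := by
  rw [bubbleDof_eq, bubbleDof_eq]
  exact (isPairing_bubble k ℓ F).integral_smul_right t _ _

theorem skeletalDof_smul {q r : ℕ} (h : q + r = ℓ) (t : ℝ) (η : Form n k ℓ)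
    (b : FormTanNor F k q r) : skeletalDof h F (t • η) b = t * skeletalDof h F η b := by
  rw [skeletalDof_eq, skeletalDof_eq, mixedTrace_smul]
  exact (isPairing_skeletal k q r F).integral_smul_left t _ fun _ => b

theorem skeletalDof_smul_right {q r : ℕ} (h : q + r = ℓ) (t : ℝ) (η : Form n k ℓ)
    (b : FormTanNor F k q r) : skeletalDof h F η (t • b) = t * skeletalDof h F η b := by
  rw [skeletalDof_eq, skeletalDof_eq]
  exact (isPairing_skeletal k q r F).integral_smul_right t _ fun _ => b

end Dofs

/-! ### Vanishing degrees of freedom -/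

section Vanishing

variable {k ℓ : ℕ} {F : Finset (Euc n)} {m : ℕ} {η : Form n k ℓ}

theorem mixedTrace_apply {q r : ℕ} (h : q + r = ℓ) (F : Finset (Euc n)) (η : Form n k ℓ)
    (x : cell F) (v : Fin k → tangent F) :
    mixedTrace h F η x v = component (tangent F) (normal F) h (η x fun i => v i) := rfl

theorem doubleTrace_apply (F : Finset (Euc n)) (η : Form n k ℓ)
    (x : cell F) (v : Fin k → tangent F) (u : Fin ℓ → tangent F) :
    doubleTrace F η x v u = η x (fun i => v i) (fun i => u i) := rfl

theorem doubleTrace_mem_cellAlt (x₀ : cell F) (hη : η ∈ shapeAlt n k ℓ) :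
    doubleTrace F η ∈ cellAlt k ℓ F := by
  rw [cellAlt_eq k ℓ F x₀]
  obtain ⟨a, b, h⟩ := hη
  refine ⟨pullback k ℓ (tangent F).subtype (a + b.curryLeft (x₀ : Euc n)),
    pullback (k + 1) ℓ (tangent F).subtype b, fun x => ?_⟩
  refine AlternatingMap.ext fun v => AlternatingMap.ext fun u => ?_
  have e : (x : Euc n) = x₀ + (relPos F x₀ x : Euc n) := (add_sub_cancel _ _).symm
  rw [doubleTrace_apply, h, id, e, map_add, ← add_assoc]
  change (a + b.curryLeft (x₀ : Euc n)) _ _ + b _ _ =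
    (a + b.curryLeft (x₀ : Euc n)) _ _ + b _ _
  congr 3
  funext i
  refine Fin.cases ?_ (fun i => ?_) i <;> rfl

namespace Vertices

/-- On a simplex of dimension `k`, the pull-back of the first slot of a Whitney form is constant. -/
theorem apply_eq_of_mem_shapeAlt (c : Vertices F k) (hη : η ∈ shapeAlt n k ℓ) (x y : cell F)
    (v : Fin k → tangent F) : η x (fun i => v i) = η y fun i => v i := by
  obtain ⟨a, b, h⟩ := hη
  have e : (x : Euc n) = y + (relPos F y x : Euc n) := (add_sub_cancel _ _).symm
  -- The tangential pullback of `b` is a `(k+1)`-form on a `k`-dimensional space, so moving the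
  -- point changes nothing.
  have h0 : (b.compLinearMap (tangent F).subtype :
      tangent F [⋀^Fin (k + 1)]→ₗ[ℝ] (Euc n [⋀^Fin ℓ]→ₗ[ℝ] ℝ)) = 0 :=
    alternatingMap_eq_zero_of_finrank_lt (by rw [c.finrank_tangent]; omega) _
  have h1 : b.curryLeft (relPos F y x : Euc n) (fun i => (v i : Euc n)) = 0 := by
    have := congrArg (fun f => f (Fin.cons (relPos F y x) v)) h0
    refine Eq.trans ?_ this
    change b _ = b _
    congr 1
    funext i
    refine Fin.cases ?_ (fun i => ?_) i <;> rfl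
  rw [h, h, id, id, e, map_add, ← add_assoc]
  rw [AlternatingMap.add_apply _ (b.curryLeft _), h1, add_zero]

theorem vanishesOn_of_skeletalDof {p : ℕ} (c : Vertices F k) (hη : η ∈ shapeAlt n k ℓ)
    (h : ∀ (j : TraceIndex k ℓ p) (b : FormTanNor F k j.q j.r), skeletalDof j.nor F η b = 0)
    (x : cell F) (v : Fin k → tangent F) :
    VanishesOn (tangent F) (k + 1) p (η x fun i => v i) := by
  have := c.isFiniteMeasure_cellMeasure
  have := c.isOpenPosMeasure_cellMeasure
  refine vanishesOn_of_component (B := normal F)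
    (Submodule.sup_orthogonal_of_hasOrthogonalProjection) fun q r hqr hq => ?_
  by_cases hqk : q ≤ k
  · have hconst : ∀ y, mixedTrace hqr F η y = mixedTrace hqr F η x := fun y =>
      AlternatingMap.ext fun v => by
        rw [mixedTrace_apply, mixedTrace_apply, c.apply_eq_of_mem_shapeAlt hη y x]
    have h1 := h ⟨k - q, q, r, by omega, by omega, hqr⟩ (mixedTrace hqr F η x)
    have h2 := (isPairing_skeletal k q r F).eq_zero_of_integral (μ := cellMeasure F)
      (mixedTrace_mem_altFun hqr F hη) (by
        rw [← h1, skeletalDof_eq]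
        simp only [hconst])
    rw [← mixedTrace_apply, h2]
    rfl
  · exact alternatingMap_eq_zero_of_finrank_lt (by rw [c.finrank_tangent]; omega) _

/-- A Whitney form whose values on the edges are in the kernel of `L` takes values in the kernel of
`L`. -/
theorem compAlternatingMap_eq_zero {N : Type*} [AddCommMonoid N] [Module ℝ N] (c : Vertices F m)
    (L : (Euc n [⋀^Fin ℓ]→ₗ[ℝ] ℝ) →ₗ[ℝ] N) (hη : η ∈ shapeAlt n k ℓ)
    (h : ∀ s : Fin (k + 1) ↪o Fin (m + 1),
      L (η (c.cellPt (s 0)) fun i => c.edge (s i.succ) (s 0)) = 0)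
    (x : cell F) (v : Fin k → tangent F) : L (η x fun i => v i) = 0 := by
  let _ := Module.addCommMonoidToAddCommGroup ℝ (M := N)
  obtain ⟨a, b, hab⟩ := hη
  set a' : tangent F [⋀^Fin k]→ₗ[ℝ] N := L.compAlternatingMap
    ((a + b.curryLeft (c.pt 0)).compLinearMap (tangent F).subtype) with ha'
  set b' : tangent F [⋀^Fin (k + 1)]→ₗ[ℝ] N :=
    L.compAlternatingMap (b.compLinearMap (tangent F).subtype) with hb'
  have key : ∀ (x : cell F) (v : Fin k → tangent F),
      L (η x fun i => v i) = (a' + b'.curryLeft (relPos F (c.cellPt 0) x)) v := by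
    intro x v
    have e : (x : Euc n) = c.pt 0 + (relPos F (c.cellPt 0) x : Euc n) :=
      (add_sub_cancel _ _).symm
    rw [hab, id, e, map_add, ← add_assoc, AlternatingMap.add_apply _ (b.curryLeft _), map_add,
      AlternatingMap.add_apply]
    refine congrArg₂ (· + ·) rfl (congrArg L ?_)
    change b _ = b _
    congr 1
    funext i
    refine Fin.cases ?_ (fun i => ?_) i <;> rfl
  have h1 := whitney_ext (fun i => relPos F (c.cellPt 0) (c.cellPt i)) (c.basis 0)
    (fun i => by
      rw [basis_apply]
      exact Subtype.ext (by simp [relPos, edge, cellPt])) a' b' fun s => by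
    rw [← h s, key]
    congr 1
    funext i
    exact Subtype.ext (by simp [relPos, edge, cellPt])
  have h3 : relPos F (c.cellPt 0) (c.cellPt 0) = 0 := Subtype.ext (by simp [relPos])
  have h2 := h1.1
  rw [key, h1.2]
  rw [h3, map_zero, add_zero] at h2
  rw [h2]
  simp

end Vertices

/-- The degrees of freedom of `η` on the subsimplices of `σ` vanish. -/
structure DofsVanish (p : ℕ) (B : ∀ σ : Finset (Euc n), Submodule ℝ (CellForm k ℓ σ))
    (σ : Finset (Euc n)) (η : Form n k ℓ) : Prop where
  skeletal : ∀ τ ⊆ σ, τ.Nonempty → dim τ = k →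
    ∀ (j : TraceIndex k ℓ p) (b : FormTanNor τ k j.q j.r), skeletalDof j.nor τ η b = 0
  bubble : ∀ F ⊆ σ, F.Nonempty → ℓ + p ≤ dim F → ∀ b ∈ B F, bubbleDof F η b = 0

theorem DofsVanish.subset {p : ℕ} {B : ∀ σ : Finset (Euc n), Submodule ℝ (CellForm k ℓ σ)}
    {σ τ : Finset (Euc n)} (h : DofsVanish p B σ η) (hτ : τ ⊆ σ) : DofsVanish p B τ η :=
  ⟨fun F hF => h.skeletal F (hF.trans hτ), fun F hF => h.bubble F (hF.trans hτ)⟩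

variable {p : ℕ} {B : ∀ σ : Finset (Euc n), Submodule ℝ (CellForm k ℓ σ)} {σ : Finset (Euc n)}

/-- Each `k`-face of `σ` supplies the vanishing relative to its own tangent space; passing to that
of `σ` raises the threshold by `m - k`. -/
theorem DofsVanish.vanishesOn (h : DofsVanish p B σ η) (c : Vertices σ m) (hσ : IsSimplex σ m)
    (hη : η ∈ shapeAlt n k ℓ) (s : Fin (k + 1) ↪o Fin (m + 1)) :
    VanishesOn (tangent σ) (m + 1) p
      (η (c.cellPt (s 0)) fun i => c.edge (s i.succ) (s 0)) := by
  classical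
  set τ : Finset (Euc n) := Finset.univ.image fun i => c.pt (s i) with hτ
  have hmem : ∀ i, c.pt (s i) ∈ τ := fun i => Finset.mem_image_of_mem _ (Finset.mem_univ i)
  have hτσ : τ ⊆ σ := by
    intro x hx
    obtain ⟨i, -, rfl⟩ := Finset.mem_image.1 hx
    exact c.pt_mem _
  have hcard : τ.card = k + 1 := by
    rw [hτ, Finset.card_image_of_injective (f := fun i => c.pt (s i)) _
      (c.pt_injective.comp s.injective), Finset.card_univ,
      Fintype.card_fin]
  have hdim : dim τ = k := by rw [dim, hcard, Nat.add_sub_cancel]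
  have hkm : k ≤ m := by
    have := Fintype.card_le_of_embedding s.toEmbedding
    simpa using this
  obtain ⟨c'⟩ := (hdim ▸ hσ.subset hτσ ⟨_, hmem 0⟩ : IsSimplex τ k).nonempty_vertices
  have h1 := c'.vanishesOn_of_skeletalDof hη (h.skeletal τ hτσ ⟨_, hmem 0⟩ hdim)
    ⟨c.pt (s 0), subset_convexHull ℝ _ (hmem 0)⟩
    (fun i => ⟨c.pt (s i.succ) - c.pt (s 0), vsub_mem_vectorSpan ℝ (hmem i.succ) (hmem 0)⟩)
  have h2 := h1.mono_left (U := tangent σ) (d := m - k)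
    (vectorSpan_mono ℝ (Finset.coe_subset.2 hτσ)) (by
      rw [c.finrank_tangent, c'.finrank_tangent]; omega)
  rw [show k + 1 + (m - k) = m + 1 by omega] at h2
  exact h2

theorem DofsVanish.mixedTrace_eq_zero (h : DofsVanish p B σ η) (hσ : IsSimplex σ m)
    (hη : η ∈ shapeAlt n k ℓ) (j : TraceIndex m ℓ p) : mixedTrace j.nor σ η = 0 := by
  obtain ⟨c⟩ := hσ.nonempty_vertices
  funext x
  refine AlternatingMap.ext fun v => ?_
  rw [mixedTrace_apply]
  refine c.compAlternatingMap_eq_zero _ hη (fun s => ?_) x v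
  -- From `s < p` and `q + s = m` one gets `m + 1 ≤ q + p`.
  refine component_eq_zero_of_vanishesOn _ (h.vanishesOn c hσ hη s) ?_
  have := j.lt
  have := j.tan
  omega

theorem DofsVanish.doubleTrace_eq_zero_of_lt (h : DofsVanish p B σ η) (hσ : IsSimplex σ m)
    (hη : η ∈ shapeAlt n k ℓ) (hm : m < ℓ + p) : doubleTrace σ η = 0 := by
  obtain ⟨c⟩ := hσ.nonempty_vertices
  refine funext fun x => AlternatingMap.ext fun v => AlternatingMap.ext fun u => ?_
  rw [doubleTrace_apply]
  let L : (Euc n [⋀^Fin ℓ]→ₗ[ℝ] ℝ) →ₗ[ℝ] ℝ :=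
    { toFun := fun α => α fun i => u i
      map_add' := fun _ _ => rfl
      map_smul' := fun _ _ => rfl }
  refine c.compAlternatingMap_eq_zero L hη (fun s => ?_) x v
  -- All `ℓ` arguments are tangential, and `m + 1 ≤ ℓ + p` reaches the threshold.
  refine h.vanishesOn c hσ hη s _ Finset.univ ?_ fun i _ => (u i).2
  simp only [Finset.card_univ, Fintype.card_fin]
  omega

/-- Induction over subsimplices: from dimension `ℓ + p` on, the double trace vanishes on all proper
faces, so it is a bubble and an admissible test function for itself. -/
theorem DofsVanish.doubleTrace_eq_zero (h : DofsVanish p B σ η) (hσ : IsSimplex σ (dim σ))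
    (hne : σ.Nonempty) (hη : η ∈ shapeAlt n k ℓ)
    (hB : ∀ F, doubleTrace F η ∈ bubbleAlt k ℓ F → doubleTrace F η ∈ B F) :
    doubleTrace σ η = 0 := by
  induction σ using Finset.strongInduction with
  | H σ ih =>
    rcases lt_or_ge (dim σ) (ℓ + p) with hm | hm
    · exact h.doubleTrace_eq_zero_of_lt hσ hη hm
    · obtain ⟨c⟩ := hσ.nonempty_vertices
      have := c.isFiniteMeasure_cellMeasure
      have := c.isOpenPosMeasure_cellMeasure
      have hmem : doubleTrace σ η ∈ bubbleAlt k ℓ σ :=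
        mem_bubbleAlt.2 ⟨doubleTrace_mem_cellAlt (c.cellPt 0) hη, fun H hH hHne =>
          ih H hH (h.subset hH.subset) (hσ.subset hH.subset hHne) hHne⟩
      exact (isPairing_bubble k ℓ σ).eq_zero_of_integral (doubleTrace_mem_altFun σ hη)
        (h.bubble σ subset_rfl hne hm _ (hB σ hmem))

/-- `S_{†,[p]}` commutes with pullbacks, so the kernel condition passes to traces. -/
theorem doubleTrace_mem_bubbleW (hη : η ∈ shapeW n k ℓ p) (F : Finset (Euc n))
    (h : doubleTrace F η ∈ bubbleAlt k ℓ F) : doubleTrace F η ∈ bubbleW k ℓ p F := by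
  refine ⟨h, funext fun x => ?_⟩
  have h1 : sdagIter k ℓ p (η x) = 0 := congrFun hη.2 x
  refine (sdagIter_pullback k ℓ (tangent F).subtype p (η x)).trans ?_
  rw [h1]
  rfl

end Vanishing

/-! ### Dimension counts -/

section Counting

theorem finite_and_finrank_alternatingMap {V N : Type*} [AddCommGroup V] [Module ℝ V]
    [AddCommMonoid N] [Module ℝ N] [Module.Finite ℝ V] [Module.Finite ℝ N] (k : ℕ) :
    Module.Finite ℝ (V [⋀^Fin k]→ₗ[ℝ] N) ∧ Module.finrank ℝ (V [⋀^Fin k]→ₗ[ℝ] N) =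
      (Module.finrank ℝ V).choose k * Module.finrank ℝ N := by
  let _ := Module.addCommMonoidToAddCommGroup ℝ (M := N)
  exact ⟨finite_alternatingMap k, finrank_alternatingMap k⟩

/-- The pair `(a, b)` is determined by the form: the value at 0 is `a`, and evaluating at `v 0` on
the other vectors recovers `b v`. The two binomials add up by Pascal's rule. -/
theorem finite_and_finrank_whitney {V N : Type*} [AddCommGroup V] [Module ℝ V]
    [AddCommMonoid N] [Module ℝ N] [Module.Finite ℝ V] [Module.Finite ℝ N] {k : ℕ}
    (X : Submodule ℝ (V → V [⋀^Fin k]→ₗ[ℝ] N))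
    (hX : ∀ ω, ω ∈ X ↔ ∃ (a : V [⋀^Fin k]→ₗ[ℝ] N) (b : V [⋀^Fin (k + 1)]→ₗ[ℝ] N),
      ∀ x, ω x = a + b.curryLeft x) :
    Module.Finite ℝ X ∧ Module.finrank ℝ X =
      (Module.finrank ℝ V + 1).choose (k + 1) * Module.finrank ℝ N := by
  let _ := Module.addCommMonoidToAddCommGroup ℝ (M := N)
  let T : (V [⋀^Fin k]→ₗ[ℝ] N) × (V [⋀^Fin (k + 1)]→ₗ[ℝ] N) →ₗ[ℝ] (V → V [⋀^Fin k]→ₗ[ℝ] N) :=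
    { toFun := fun y x => y.1 + y.2.curryLeft x
      map_add' := fun y z => by
        funext x
        simp only [Prod.fst_add, Prod.snd_add, AlternatingMap.curryLeft_add, LinearMap.add_apply,
          Pi.add_apply]
        abel
      map_smul' := fun t y => by
        funext x
        simp only [Prod.smul_fst, Prod.smul_snd, AlternatingMap.curryLeft_smul,
          LinearMap.smul_apply, Pi.smul_apply, smul_add, RingHom.id_apply] }
  have hT : X = LinearMap.range T := by
    ext ω
    rw [hX, LinearMap.mem_range]
    constructor
    · rintro ⟨a, b, h⟩
      exact ⟨(a, b), funext fun x => (h x).symm⟩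
    · rintro ⟨⟨a, b⟩, rfl⟩
      exact ⟨a, b, fun x => rfl⟩
  have hinj : Function.Injective T := by
    rw [← LinearMap.ker_eq_bot, LinearMap.ker_eq_bot']
    rintro ⟨a, b⟩ h
    have h0 : a + b.curryLeft 0 = 0 := congrFun h 0
    rw [map_zero, add_zero] at h0
    have hb : b = 0 := by
      ext v
      have h1 : a + b.curryLeft (v 0) = 0 := congrFun h (v 0)
      rw [h0, zero_add] at h1
      have h2 := congrArg (fun f => f (Matrix.vecTail v)) h1
      rw [AlternatingMap.curryLeft_apply_apply] at h2
      rw [← Matrix.cons_head_tail v]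
      exact h2
    rw [h0, hb]
    rfl
  rw [hT]
  refine ⟨inferInstance, ?_⟩
  rw [LinearMap.finrank_range_of_inj hinj, Module.finrank_prod, finrank_alternatingMap,
    finrank_alternatingMap, ← add_mul, Nat.choose_succ_succ]

theorem finite_and_finrank_shapeAlt (n k ℓ : ℕ) : Module.Finite ℝ (shapeAlt n k ℓ) ∧
    Module.finrank ℝ (shapeAlt n k ℓ) = (n + 1).choose (k + 1) * n.choose ℓ := by
  have h1 := finite_and_finrank_alternatingMap (V := Euc n) (N := ℝ) ℓ
  have := h1.1
  have h2 := finite_and_finrank_whitney (V := Euc n) (N := Euc n [⋀^Fin ℓ]→ₗ[ℝ] ℝ) (k := k)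
    (shapeAlt n k ℓ) fun ω => Iff.rfl
  refine ⟨h2.1, ?_⟩
  rw [h2.2, h1.2, finrank_euclideanSpace_fin, Module.finrank_self, mul_one]

theorem finite_of_le {M : Type*} [AddCommMonoid M] [Module ℝ M] {X Y : Submodule ℝ M}
    [Module.Finite ℝ Y] (h : X ≤ Y) : Module.Finite ℝ X := by
  let _ := Module.addCommMonoidToAddCommGroup ℝ (M := M)
  exact Submodule.finiteDimensional_of_le h

theorem finrank_shapeAlt_le {n k ℓ p : ℕ} (hp : p ≤ k) : Module.finrank ℝ (shapeAlt n k ℓ) ≤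
    Module.finrank ℝ (shapeW n k ℓ p) + Module.finrank ℝ (shapeAlt n (k - p) (ℓ + p)) := by
  have := (finite_and_finrank_shapeAlt n k ℓ).1
  have := (finite_and_finrank_shapeAlt n (k - p) (ℓ + p)).1
  refine finrank_le_finrank_inf_ker_add (X := shapeAlt n k ℓ)
    (f := (sdagIter (V := Euc n) k ℓ p).compLeft (Euc n)) ?_
  rintro _ ⟨ω, hω, rfl⟩
  exact sdagIter_mem_whitneySpace hp hω

variable {σ : Finset (Euc n)} {k : ℕ}

theorem Vertices.finrank_normal (c : Vertices σ k) : Module.finrank ℝ (normal σ) = n - k := by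
  have h1 := Submodule.finrank_add_finrank_orthogonal (tangent σ)
  rw [c.finrank_tangent, finrank_euclideanSpace_fin] at h1
  exact Nat.eq_sub_of_add_eq' h1

theorem Vertices.finite_and_finrank_tanNor (c : Vertices σ k) (q r : ℕ) :
    Module.Finite ℝ (TanNor σ q r) ∧
      Module.finrank ℝ (TanNor σ q r) = k.choose q * (n - k).choose r := by
  have h1 := finite_and_finrank_alternatingMap (V := normal σ) (N := ℝ) r
  have := h1.1
  have h2 := finite_and_finrank_alternatingMap (V := tangent σ) (N := normal σ [⋀^Fin r]→ₗ[ℝ] ℝ) q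
  refine ⟨h2.1, ?_⟩
  rw [h2.2, h1.2, c.finrank_tangent, c.finrank_normal, Module.finrank_self, mul_one]

theorem Vertices.finite_and_finrank_formTanNor (c : Vertices σ k) (q r : ℕ) :
    Module.Finite ℝ (FormTanNor σ k q r) ∧
      Module.finrank ℝ (FormTanNor σ k q r) = k.choose q * (n - k).choose r := by
  have h1 := c.finite_and_finrank_tanNor q r
  have := h1.1
  have h2 := finite_and_finrank_alternatingMap (V := tangent σ) (N := TanNor σ q r) k
  refine ⟨h2.1, ?_⟩
  rw [h2.2, h1.2, c.finrank_tangent, Nat.choose_self, one_mul]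

/-- The number of components of `ℓ`-forms with `k - s` tangential arguments on a `k`-simplex in
`ℝⁿ`. -/
def componentCount (n k ℓ s : ℕ) : ℕ :=
  if s ≤ k ∧ k ≤ ℓ + s then k.choose (k - s) * (n - k).choose (ℓ + s - k) else 0

theorem Vertices.skeletalCount_eq (c : Vertices σ k) (ℓ s : ℕ) :
    skeletalCount k ℓ s σ = componentCount n k ℓ s := by
  rw [skeletalCount, componentCount, (c.finite_and_finrank_tanNor _ _).2]

/-- Both sides count the flags formed by a `k`-face inside an `(ℓ+s)`-face of an `n`-simplex, with
weight `C(k,s)`. -/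
theorem choose_mul_choose_mul_choose (n k ℓ s : ℕ) :
    (n + 1).choose (ℓ + s + 1) * ((ℓ + s + 1).choose (k + 1) * k.choose s) =
      (n + 1).choose (k + 1) * componentCount n k ℓ s := by
  rw [componentCount]
  rcases lt_or_ge k s with h1 | h1
  · rw [if_neg (by omega), Nat.choose_eq_zero_of_lt h1]
    simp
  rcases lt_or_ge (ℓ + s) k with h2 | h2
  · rw [if_neg (by omega), Nat.choose_eq_zero_of_lt (show ℓ + s + 1 < k + 1 by omega)]
    simp
  rw [if_pos ⟨h1, h2⟩, Nat.choose_symm h1, ← mul_assoc]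
  rcases lt_or_ge n (ℓ + s) with h3 | h3
  · rw [Nat.choose_eq_zero_of_lt (show n + 1 < ℓ + s + 1 by omega)]
    rcases lt_or_ge n k with h4 | h4
    · rw [Nat.choose_eq_zero_of_lt (show n + 1 < k + 1 by omega)]
      simp
    · rw [Nat.choose_eq_zero_of_lt (show n - k < ℓ + s - k by omega)]
      simp
  · rw [Nat.choose_mul (show k + 1 ≤ ℓ + s + 1 by omega),
      show n + 1 - (k + 1) = n - k by omega, show ℓ + s + 1 - (k + 1) = ℓ + s - k by omega]
    ring

/-- Vandermonde's identity: `ℓ`-forms on `ℝⁿ` decompose by the number `k - s` of arguments tangent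
to a fixed `k`-simplex. -/
theorem sum_componentCount {n k : ℕ} (ℓ : ℕ) (hk : k ≤ n) :
    ∑ s ∈ Finset.range (n + 1), componentCount n k ℓ s = n.choose ℓ := by
  have h := Nat.add_choose_eq k (n - k) ℓ
  rw [Nat.add_sub_cancel' hk,
    Finset.Nat.sum_antidiagonal_eq_sum_range_succ (fun i j => k.choose i * (n - k).choose j)] at h
  rw [h]
  refine Finset.sum_bij_ne_zero (fun s _ _ => k - s) ?_ ?_ ?_ ?_
  · intro s hs h0
    have : s ≤ k ∧ k ≤ ℓ + s := by
      by_contra h1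
      exact h0 (if_neg h1)
    rw [Finset.mem_range]
    omega
  · intro s hs h0 s' hs' h0' hss
    have : s ≤ k ∧ k ≤ ℓ + s := by
      by_contra h1
      exact h0 (if_neg h1)
    have : s' ≤ k ∧ k ≤ ℓ + s' := by
      by_contra h1
      exact h0' (if_neg h1)
    omega
  · intro i hi h0
    have hik : i ≤ k := by
      by_contra h1
      exact h0 (by rw [Nat.choose_eq_zero_of_lt (by omega), zero_mul])
    rw [Finset.mem_range] at hi
    refine ⟨k - i, Finset.mem_range.2 (by omega), ?_, by omega⟩
    rwa [componentCount, if_pos (by omega), show k - (k - i) = i by omega,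
      show ℓ + (k - i) - k = ℓ - i by omega]
  · intro s hs h0
    have : s ≤ k ∧ k ≤ ℓ + s := by
      by_contra h1
      exact h0 (if_neg h1)
    rw [componentCount, if_pos this, show ℓ + s - k = ℓ - (k - s) by omega]

theorem sum_powerset_filter_card {α : Type*} (K : Finset α) (f : Finset α → ℕ) (ℓ p : ℕ) :
    ∑ F ∈ K.powerset with ℓ + 1 ≤ F.card, f F =
      ∑ s ∈ Finset.range p, ∑ F ∈ K.powersetCard (ℓ + s + 1), f F +
        ∑ F ∈ K.powerset with ℓ + p + 1 ≤ F.card, f F := by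
  classical
  induction p with
  | zero => simp
  | succ p ih =>
    rw [ih, Finset.sum_range_succ, add_assoc (Finset.sum (Finset.range p) _)]
    congr 1
    rw [← Finset.sum_union]
    · refine Finset.sum_congr ?_ fun _ _ => rfl
      ext F
      simp only [Finset.mem_filter, Finset.mem_union, Finset.mem_powerset,
        Finset.mem_powersetCard, ← and_or_left]
      refine and_congr_right fun _ => ?_
      omega
    · refine Finset.disjoint_left.2 fun F h1 h2 => ?_
      rw [Finset.mem_powersetCard] at h1
      rw [Finset.mem_filter] at h2
      omega

variable {K : Finset (Euc n)} {ℓ : ℕ}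

theorem IsSimplex.nonempty_vertices_of_subset (hK : IsSimplex K n) {F : Finset (Euc n)}
    (hF : F ⊆ K) {m : ℕ} (hm : F.card = m + 1) : Nonempty (Vertices F m) :=
  IsSimplex.nonempty_vertices ⟨hK.1.mono hF, hm⟩

theorem sum_finrank_bubbleAlt_powersetCard (hK : IsSimplex K n) (k ℓ s : ℕ) :
    ∑ F ∈ K.powersetCard (ℓ + s + 1), Module.finrank ℝ (bubbleAlt k ℓ F) =
      (n + 1).choose (k + 1) * componentCount n k ℓ s := by
  rw [Finset.sum_congr rfl (g := fun _ => (ℓ + s + 1).choose (k + 1) * k.choose s)]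
  · rw [Finset.sum_const, Finset.card_powersetCard, hK.2, smul_eq_mul,
      choose_mul_choose_mul_choose]
  · intro F hF
    rw [Finset.mem_powersetCard] at hF
    obtain ⟨c⟩ := hK.nonempty_vertices_of_subset hF.1 hF.2
    rw [c.finrank_bubbleAlt (Nat.le_add_right _ _), Nat.add_sub_cancel_left]

theorem countsMatch_bubbleAlt (hK : IsSimplex K n) (k ℓ p : ℕ) :
    CountsMatch p (bubbleAlt (n := n) k ℓ) K := by
  intro s _
  rw [sum_finrank_bubbleAlt_powersetCard hK,
    Finset.sum_congr rfl (g := fun _ => componentCount n k ℓ s)]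
  · rw [Finset.sum_const, Finset.card_powersetCard, hK.2, smul_eq_mul]
  · intro σ hσ
    rw [Finset.mem_powersetCard] at hσ
    obtain ⟨c⟩ := hK.nonempty_vertices_of_subset hσ.1 hσ.2
    exact c.skeletalCount_eq ℓ s

theorem countsMatch_bubbleW (hK : IsSimplex K n) (k ℓ p : ℕ) :
    CountsMatch p (bubbleW (n := n) k ℓ p) K := by
  intro s hs
  rw [← countsMatch_bubbleAlt hK k ℓ p s hs]
  refine Finset.sum_congr rfl fun F hF => ?_
  rw [Finset.mem_powersetCard] at hF
  obtain ⟨c⟩ := hK.nonempty_vertices_of_subset hF.1 hF.2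
  rw [bubbleW_eq_bubbleAlt c (by omega)]

theorem sum_finrank_bubbleAlt (hK : IsSimplex K n) (k ℓ : ℕ) :
    ∑ F ∈ K.powerset with ℓ + 1 ≤ F.card, Module.finrank ℝ (bubbleAlt k ℓ F) =
      Module.finrank ℝ (shapeAlt n k ℓ) := by
  -- With `n + 1` layers removed, no face is left over, as `K` has only `n + 1` vertices.
  rw [sum_powerset_filter_card K _ ℓ (n + 1), Finset.filter_eq_empty_iff.2, Finset.sum_empty,
    add_zero, (finite_and_finrank_shapeAlt n k ℓ).2,
    Finset.sum_congr rfl fun s _ => sum_finrank_bubbleAlt_powersetCard hK k ℓ s, ← Finset.mul_sum]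
  · rcases lt_or_ge n k with h | h
    · rw [Nat.choose_eq_zero_of_lt (show n + 1 < k + 1 by omega), zero_mul, zero_mul]
    · rw [sum_componentCount ℓ h]
  · intro F hF
    have := Finset.card_le_card (Finset.mem_powerset.1 hF)
    rw [hK.2] at this
    omega

theorem sum_finrank_bubbleW_le (hK : IsSimplex K n) {k ℓ p : ℕ} (hk : k + 1 ≤ ℓ + p) :
    ∑ F ∈ K.powerset with ℓ + 1 ≤ F.card, Module.finrank ℝ (bubbleW k ℓ p F) ≤
      Module.finrank ℝ (shapeW n k ℓ p) := by
  rcases lt_or_ge k p with hp | hp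
  · have h1 : ∀ F : Finset (Euc n), bubbleW k ℓ p F = bubbleAlt k ℓ F := fun F => by
      rw [bubbleW, symmetric_eq_top (sdagIter_eq_zero ℓ hp), inf_top_eq]
    have h2 : shapeW n k ℓ p = shapeAlt n k ℓ := by
      rw [shapeW, symmetric_eq_top (sdagIter_eq_zero ℓ hp), inf_top_eq]
    rw [h2, ← sum_finrank_bubbleAlt hK]
    exact (Finset.sum_congr rfl fun F _ => by rw [h1]).le
  · have h1 := finrank_shapeAlt_le (n := n) (ℓ := ℓ) hp
    rw [← sum_finrank_bubbleAlt hK k ℓ, ← sum_finrank_bubbleAlt hK (k - p) (ℓ + p)] at h1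
    -- Below dimension `ℓ + p` every bubble is in the kernel. From there on, the faces are those
    -- counted for `(k - p, ℓ + p)`, and surjectivity on bubbles compares the sums face by face.
    refine Nat.le_of_add_le_add_right (le_trans ?_ h1)
    rw [sum_powerset_filter_card K _ ℓ p, sum_powerset_filter_card K _ ℓ p, add_assoc,
      ← Finset.sum_add_distrib]
    refine add_le_add (Finset.sum_le_sum fun s hs => Finset.sum_le_sum fun F hF => ?_)
      (Finset.sum_le_sum fun F hF => ?_)
    · rw [Finset.mem_powersetCard] at hF
      rw [Finset.mem_range] at hs
      obtain ⟨c⟩ := hK.nonempty_vertices_of_subset hF.1 hF.2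
      rw [bubbleW_eq_bubbleAlt c (by omega)]
    · rw [Finset.mem_filter, Finset.mem_powerset] at hF
      obtain ⟨c⟩ := hK.nonempty_vertices_of_subset hF.1 (m := F.card - 1) (by omega)
      exact finrank_bubbleW_add_le c hp hk

end Counting

/-! ### Unisolvency -/

section Unisolvency

/-- `φ` is bilinear on `X × D`. -/
structure IsBilinOn {M D : Type*} [AddCommMonoid M] [Module ℝ M] [AddCommMonoid D] [Module ℝ D]
    (X : Submodule ℝ M) (φ : M → D → ℝ) : Prop where
  add_left : ∀ ω ∈ X, ∀ ω' ∈ X, ∀ b, φ (ω + ω') b = φ ω b + φ ω' b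
  smul_left : ∀ (t : ℝ) ω b, φ (t • ω) b = t * φ ω b
  add_right : ∀ ω ∈ X, ∀ b b', φ ω (b + b') = φ ω b + φ ω b'
  smul_right : ∀ (t : ℝ) ω b, φ ω (t • b) = t * φ ω b

theorem isBilinOn_of_mem {M D : Type*} [AddCommMonoid M] [Module ℝ M] [AddCommMonoid D]
    [Module ℝ D] {X : Submodule ℝ M} {Y : Submodule ℝ D} {φ : M → D → ℝ}
    (add_left : ∀ ω ∈ X, ∀ ω' ∈ X, ∀ b ∈ Y, φ (ω + ω') b = φ ω b + φ ω' b)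
    (smul_left : ∀ (t : ℝ) ω b, φ (t • ω) b = t * φ ω b)
    (add_right : ∀ ω ∈ X, ∀ b ∈ Y, ∀ b' ∈ Y, φ ω (b + b') = φ ω b + φ ω b')
    (smul_right : ∀ (t : ℝ) ω b, φ ω (t • b) = t * φ ω b) :
    IsBilinOn X fun ω (b : Y) => φ ω b where
  add_left ω hω ω' hω' b := add_left ω hω ω' hω' b b.2
  smul_left t ω b := smul_left t ω b
  add_right ω hω b b' := add_right ω hω b b.2 b' b'.2
  smul_right t ω b := smul_right t ω b

/-- The map to the dual space induced by a bilinear map. -/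
def IsBilinOn.toDual {M D : Type*} [AddCommMonoid M] [Module ℝ M] [AddCommMonoid D] [Module ℝ D]
    {X : Submodule ℝ M} {φ : M → D → ℝ} (h : IsBilinOn X φ) : X →ₗ[ℝ] Module.Dual ℝ D :=
  LinearMap.mk₂ ℝ (fun ω b => φ ω b) (fun ω ω' b => h.add_left ω ω.2 ω' ω'.2 b)
    (fun t ω b => h.smul_left t ω b) (fun ω b b' => h.add_right ω ω.2 b b')
    fun t ω b => h.smul_right t ω b

theorem finite_and_finrank_pi_dual {I : Type*} [Fintype I] {D : I → Type*}
    [∀ i, AddCommMonoid (D i)] [∀ i, Module ℝ (D i)] (hD : ∀ i, Module.Finite ℝ (D i)) :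
    Module.Finite ℝ (∀ i, Module.Dual ℝ (D i)) ∧
      Module.finrank ℝ (∀ i, Module.Dual ℝ (D i)) = ∑ i, Module.finrank ℝ (D i) := by
  let _ : ∀ i, AddCommGroup (D i) := fun i => Module.addCommMonoidToAddCommGroup ℝ
  refine ⟨inferInstance, ?_⟩
  rw [Module.finrank_pi_fintype]
  exact Finset.sum_congr rfl fun i _ => Subspace.dual_finrank_eq

theorem bijective_of_injective_of_finrank_le {M P : Type*} [AddCommMonoid M] [Module ℝ M]
    [AddCommMonoid P] [Module ℝ P] [Module.Finite ℝ M] [Module.Finite ℝ P] {Φ : M →ₗ[ℝ] P}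
    (h : Function.Injective Φ) (hle : Module.finrank ℝ P ≤ Module.finrank ℝ M) :
    Function.Bijective Φ := by
  let _ := Module.addCommMonoidToAddCommGroup ℝ (M := M)
  let _ := Module.addCommMonoidToAddCommGroup ℝ (M := P)
  exact ⟨h, (LinearMap.injective_iff_surjective_of_finrank_eq_finrank
    (le_antisymm (LinearMap.finrank_le_finrank_of_injective h) hle)).1 h⟩

theorem injective_of_eq_zero {M P : Type*} [AddCommMonoid M] [Module ℝ M]
    [AddCommMonoid P] [Module ℝ P] {Φ : M →ₗ[ℝ] P} (h : ∀ x, Φ x = 0 → x = 0) :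
    Function.Injective Φ := by
  let _ := Module.addCommMonoidToAddCommGroup ℝ (M := M)
  let _ := Module.addCommMonoidToAddCommGroup ℝ (M := P)
  exact (injective_iff_map_eq_zero Φ).2 h

theorem eq_of_add_neg_one_smul {M : Type*} [AddCommMonoid M] [Module ℝ M] {x y : M}
    (h : x + (-1 : ℝ) • y = 0) : x = y := by
  let _ := Module.addCommMonoidToAddCommGroup ℝ (M := M)
  rwa [neg_one_smul, ← sub_eq_add_neg, sub_eq_zero] at h

theorem curryLeft_sub_eq_zero {V N : Type*} [AddCommGroup V] [Module ℝ V] [AddCommMonoid N]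
    [Module ℝ N] {k : ℕ} {a : V [⋀^Fin k]→ₗ[ℝ] N} {b : V [⋀^Fin (k + 1)]→ₗ[ℝ] N} {x y : V}
    (hx : a + b.curryLeft x = 0) (hy : a + b.curryLeft y = 0) : b.curryLeft (x - y) = 0 := by
  let _ := Module.addCommMonoidToAddCommGroup ℝ (M := N)
  rw [map_sub, add_left_cancel (hx.trans hy.symm), sub_self]

theorem sum_prod_le_sum {A J : Type*} [Fintype J] {S : Finset A} (g : A → J → ℕ) {h : A → ℕ}
    (H : ∀ a ∈ S, ∑ j, g a j ≤ h a) : ∑ i : S × J, g i.1.1 i.2 ≤ ∑ a ∈ S, h a := by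
  rw [Fintype.sum_prod_type, ← Finset.sum_coe_sort S]
  exact Finset.sum_le_sum fun a _ => H a a.2

theorem sum_subtype_le_sum {A : Type*} {S : Finset A} (g : A → ℕ) :
    ∑ i : S, g i.1 ≤ ∑ a ∈ S, g a :=
  (Finset.sum_coe_sort S g).le

/-- Functionals that separate the points of `X` and are not more than `dim X` are unisolvent. -/
theorem existsUnique_of_separating {M I J : Type*} [AddCommMonoid M] [Module ℝ M] [Fintype I]
    [Fintype J] {D : I → Type*} [∀ i, AddCommMonoid (D i)] [∀ i, Module ℝ (D i)]
    {x : I → ℕ} (hD : ∀ i, Module.Finite ℝ (D i) ∧ Module.finrank ℝ (D i) = x i) {E : J → Type*}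
    [∀ j, AddCommMonoid (E j)] [∀ j, Module ℝ (E j)] {y : J → ℕ}
    (hE : ∀ j, Module.Finite ℝ (E j) ∧ Module.finrank ℝ (E j) = y j) {X : Submodule ℝ M}
    [Module.Finite ℝ X] {φ : ∀ i, M → D i → ℝ} (hφ : ∀ i, IsBilinOn X (φ i))
    {ψ : ∀ j, M → E j → ℝ} (hψ : ∀ j, IsBilinOn X (ψ j))
    (hsep : ∀ ω ∈ X, (∀ i b, φ i ω b = 0) → (∀ j b, ψ j ω b = 0) → ω = 0)
    (hle : ∑ i, x i + ∑ j, y j ≤ Module.finrank ℝ X)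
    (c : ∀ i, Module.Dual ℝ (D i)) (d : ∀ j, Module.Dual ℝ (E j)) :
    ∃! ω : M, ω ∈ X ∧ (∀ i b, φ i ω b = c i b) ∧ ∀ j b, ψ j ω b = d j b := by
  have h1 := finite_and_finrank_pi_dual fun i => (hD i).1
  have h2 := finite_and_finrank_pi_dual fun j => (hE j).1
  have := h1.1
  have := h2.1
  let Φ : X →ₗ[ℝ] (∀ i, Module.Dual ℝ (D i)) × ∀ j, Module.Dual ℝ (E j) :=
    (LinearMap.pi fun i => (hφ i).toDual).prod (LinearMap.pi fun j => (hψ j).toDual)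
  have hΦ : ∀ (ω : X) (c : ∀ i, Module.Dual ℝ (D i)) (d : ∀ j, Module.Dual ℝ (E j)),
      Φ ω = (c, d) ↔ (∀ i b, φ i ω b = c i b) ∧ ∀ j b, ψ j ω b = d j b := by
    intro ω c d
    rw [Prod.ext_iff, funext_iff, funext_iff]
    exact and_congr (forall_congr' fun i => LinearMap.ext_iff)
      (forall_congr' fun j => LinearMap.ext_iff)
  have hbij : Function.Bijective Φ := by
    refine bijective_of_injective_of_finrank_le (injective_of_eq_zero fun ω hω => ?_) ?_
    · obtain ⟨h3, h4⟩ := (hΦ ω 0 0).1 hω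
      exact Subtype.ext (hsep ω ω.2 h3 h4)
    · rwa [Module.finrank_prod, h1.2, h2.2, Finset.sum_congr rfl fun i _ => (hD i).2,
        Finset.sum_congr rfl fun j _ => (hE j).2]
  obtain ⟨ω, hω, huniq⟩ := hbij.existsUnique (c, d)
  refine ⟨ω, ⟨ω.2, (hΦ ω c d).1 hω⟩, fun ω' hω' => ?_⟩
  exact congrArg Subtype.val (huniq ⟨ω', hω'.1⟩ ((hΦ ⟨ω', hω'.1⟩ c d).2 hω'.2))

instance fintype_traceIndex (m ℓ p : ℕ) : Fintype (TraceIndex m ℓ p) :=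
  @Fintype.ofInjective _ (Fin p) _ (fun j => ⟨j.s, j.lt⟩) fun i j hij => by
    obtain ⟨s, q, r, h1, h2, h3⟩ := i
    obtain ⟨s', q', r', h1', h2', h3'⟩ := j
    obtain rfl : s = s' := congrArg Fin.val hij
    obtain rfl : q = q' := by omega
    obtain rfl : r = r' := by omega
    rfl

theorem TraceIndex.s_injective {m ℓ p : ℕ} : Function.Injective (TraceIndex.s (m := m) (ℓ := ℓ)
    (p := p)) := by
  rintro ⟨s, q, r, h1, h2, h3⟩ ⟨s', q', r', h1', h2', h3'⟩ (rfl : s = s')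
  obtain rfl : q = q' := by omega
  obtain rfl : r = r' := by omega
  rfl

/-- A value `s < p` without a trace index has a negative degree, and its count is zero. -/
theorem Vertices.sum_choose_le {σ : Finset (Euc n)} {k : ℕ} (c : Vertices σ k)
    (ℓ p : ℕ) : ∑ j : TraceIndex k ℓ p, k.choose j.q * (n - k).choose j.r ≤
      ∑ s ∈ Finset.range p, skeletalCount k ℓ s σ := by
  have h : ∀ j : TraceIndex k ℓ p, k.choose j.q * (n - k).choose j.r =
      skeletalCount k ℓ j.s σ := fun j => by
    have h1 := j.tan
    have h2 := j.nor
    rw [c.skeletalCount_eq, componentCount,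
      if_pos (by omega), show k - j.s = j.q by omega, show ℓ + j.s - k = j.r by omega]
  classical
  rw [Finset.sum_congr rfl fun j _ => h j,
    ← Finset.sum_image (f := fun s => skeletalCount k ℓ s σ) TraceIndex.s_injective.injOn]
  refine Finset.sum_le_sum_of_subset fun s hs => ?_
  obtain ⟨j, -, rfl⟩ := Finset.mem_image.1 hs
  exact Finset.mem_range.2 j.lt

variable {k ℓ : ℕ} {K : Finset (Euc n)}

/-- The tangent space of `K` is everything, so the trace forgets only the points outside `K`.
Vanishing at all vertices makes `b` vanish on all edge vectors, and these span. -/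
theorem eq_zero_of_doubleTrace (hK : IsSimplex K n) {η : Form n k ℓ} (hη : η ∈ shapeAlt n k ℓ)
    (h : doubleTrace K η = 0) : η = 0 := by
  obtain ⟨c⟩ := hK.nonempty_vertices
  have htop : tangent K = ⊤ :=
    Submodule.eq_top_of_finrank_eq (by rw [c.finrank_tangent, finrank_euclideanSpace_fin])
  obtain ⟨a, b, hab⟩ := hη
  have h0 : ∀ x ∈ cell K, a + b.curryLeft x = 0 := by
    intro x hx
    refine AlternatingMap.ext fun v => AlternatingMap.ext fun u => ?_
    have h1 := congrArg (fun f => f (fun i => ⟨v i, htop ▸ Submodule.mem_top⟩)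
      fun i => ⟨u i, htop ▸ Submodule.mem_top⟩) (congrFun h ⟨x, hx⟩)
    change η x v u = 0 at h1
    rwa [hab] at h1
  have hker : tangent K ≤ LinearMap.ker b.curryLeft := by
    rw [tangent, vectorSpan_def, Submodule.span_le]
    rintro _ ⟨x, hx, y, hy, rfl⟩
    have h1 := h0 x (subset_convexHull ℝ _ hx)
    exact curryLeft_sub_eq_zero h1 (h0 y (subset_convexHull ℝ _ hy))
  have hb : ∀ x, b.curryLeft x = 0 := fun x => hker (htop ▸ Submodule.mem_top)
  have ha := h0 (c.pt 0) (subset_convexHull ℝ _ (c.pt_mem 0))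
  rw [hb, add_zero] at ha
  funext x
  rw [hab, ha, hb, add_zero]
  rfl

theorem Vertices.isBilinOn_skeletalDof {F : Finset (Euc n)} {m q r : ℕ} (c : Vertices F m)
    {X : Submodule ℝ (Form n k ℓ)} (hX : X ≤ shapeAlt n k ℓ) (h : q + r = ℓ) :
    IsBilinOn X (skeletalDof (k := k) h F) where
  add_left _ hω _ hω' b := c.skeletalDof_add h (hX hω) (hX hω') b
  smul_left := skeletalDof_smul h
  add_right _ hω b b' := c.skeletalDof_add_right h (hX hω) b b'
  smul_right := skeletalDof_smul_right h

theorem Vertices.isBilinOn_bubbleDof {F : Finset (Euc n)} {m : ℕ} (c : Vertices F m)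
    {X : Submodule ℝ (Form n k ℓ)} (hX : X ≤ shapeAlt n k ℓ) {B : Submodule ℝ (CellForm k ℓ F)}
    (hB : B ≤ cellAlt k ℓ F) : IsBilinOn X fun ω (b : B) => bubbleDof F ω b :=
  isBilinOn_of_mem (fun _ hω _ hω' _ hb => c.bubbleDof_add (hX hω) (hX hω') (hB hb))
    bubbleDof_smul (fun _ hω _ hb _ hb' => c.bubbleDof_add_right (hX hω) (hB hb) (hB hb'))
    bubbleDof_smul_right

theorem DofsVanish.eq_zero {p : ℕ} (hK : IsSimplex K n) {η : Form n k ℓ}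
    (hη : η ∈ shapeAlt n k ℓ) {B : ∀ σ : Finset (Euc n), Submodule ℝ (CellForm k ℓ σ)}
    (hB : ∀ F, doubleTrace F η ∈ bubbleAlt k ℓ F → doubleTrace F η ∈ B F)
    (h : DofsVanish p B K η) : η = 0 := by
  have hne : K.Nonempty := Finset.card_pos.1 (by rw [hK.2]; omega)
  exact eq_zero_of_doubleTrace hK hη
    (h.doubleTrace_eq_zero (hK.subset subset_rfl hne) hne hη hB)

theorem DofsVanish.of_powersetCard {p : ℕ} {η : Form n k ℓ}
    {B : ∀ σ : Finset (Euc n), Submodule ℝ (CellForm k ℓ σ)}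
    (h1 : ∀ (i : K.powersetCard (k + 1) × TraceIndex k ℓ p)
      (b : FormTanNor i.1.1 k i.2.q i.2.r), skeletalDof i.2.nor i.1.1 η b = 0)
    (h2 : ∀ (F : {F ∈ K.powerset | ℓ + p + 1 ≤ F.card}) (b : B F.1), bubbleDof F.1 η b = 0) :
    DofsVanish p B K η where
  skeletal τ hτ hne hdim j := by
    have hτK : τ ∈ K.powersetCard (k + 1) := Finset.mem_powersetCard.2 ⟨hτ, by
      rw [← hdim, dim, Nat.sub_add_cancel hne.card_pos]⟩
    exact h1 (⟨τ, hτK⟩, j)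
  bubble F hF hne hdim b hb := by
    have hFK : F ∈ {F ∈ K.powerset | ℓ + p + 1 ≤ F.card} :=
      Finset.mem_filter.2 ⟨Finset.mem_powerset.2 hF, by
        rw [dim] at hdim; have := hne.card_pos; omega⟩
    exact h2 ⟨F, hFK⟩ ⟨b, hb⟩

theorem sum_choose_add_sum_finrank_le {p : ℕ} (hK : IsSimplex K n) {X : Submodule ℝ (Form n k ℓ)}
    {B : ∀ σ : Finset (Euc n), Submodule ℝ (CellForm k ℓ σ)} (hcount : CountsMatch p B K)
    (hle : ∑ F ∈ K.powerset with ℓ + 1 ≤ F.card, Module.finrank ℝ (B F) ≤ Module.finrank ℝ X) :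
    ∑ i : K.powersetCard (k + 1) × TraceIndex k ℓ p,
      k.choose i.2.q * (n - k).choose i.2.r +
      ∑ F : {F ∈ K.powerset | ℓ + p + 1 ≤ F.card}, Module.finrank ℝ (B F.1) ≤
      Module.finrank ℝ X := by
  refine le_trans ?_ hle
  rw [sum_powerset_filter_card K _ ℓ p, Finset.sum_congr rfl fun s hs =>
    hcount s (Finset.mem_range.1 hs), Finset.sum_comm]
  refine add_le_add (sum_prod_le_sum
    (fun _ (j : TraceIndex k ℓ p) => k.choose j.q * (n - k).choose j.r)
    fun σ hσ => ?_) (sum_subtype_le_sum fun F => Module.finrank ℝ (B F))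
  obtain ⟨c⟩ := hK.nonempty_vertices_of_subset (Finset.mem_powersetCard.1 hσ).1
    (Finset.mem_powersetCard.1 hσ).2
  exact c.sum_choose_le ℓ p

/-- Common to both families. Separation needs that bubble traces of `X` belong to the test space
`B`; replacing the bubbles below dimension `ℓ + p` by skeletal moments keeps the count within `dim
X`. -/
theorem isUnisolvent_of_countsMatch {p : ℕ} (hK : IsSimplex K n) {X : Submodule ℝ (Form n k ℓ)}
    (hX : X ≤ shapeAlt n k ℓ) {B : ∀ σ : Finset (Euc n), Submodule ℝ (CellForm k ℓ σ)}
    (hB : ∀ F, B F ≤ bubbleAlt k ℓ F)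
    (hXB : ∀ η ∈ X, ∀ F, doubleTrace F η ∈ bubbleAlt k ℓ F → doubleTrace F η ∈ B F)
    (hcount : CountsMatch p B K)
    (hle : ∑ F ∈ K.powerset with ℓ + 1 ≤ F.card, Module.finrank ℝ (B F) ≤ Module.finrank ℝ X) :
    IsUnisolvent p X B K := by
  intro c d
  have hXfin : Module.Finite ℝ X := by
    have := (finite_and_finrank_shapeAlt n k ℓ).1
    exact finite_of_le hX
  have hσ : ∀ σ : K.powersetCard (k + 1), Nonempty (Vertices σ.1 k) := fun σ =>
    hK.nonempty_vertices_of_subset (Finset.mem_powersetCard.1 σ.2).1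
      (Finset.mem_powersetCard.1 σ.2).2
  have hF : ∀ F : {F ∈ K.powerset | ℓ + p + 1 ≤ F.card},
      Nonempty (Vertices F.1 (F.1.card - 1)) := fun F =>
    hK.nonempty_vertices_of_subset (Finset.mem_powerset.1 (Finset.mem_filter.1 F.2).1)
      (by have := (Finset.mem_filter.1 F.2).2; omega)
  have hfin : ∀ F : {F ∈ K.powerset | ℓ + p + 1 ≤ F.card}, Module.Finite ℝ (B F.1) ∧
      Module.finrank ℝ (B F.1) = Module.finrank ℝ (B F.1) := fun F => by
    have := (hF F).some.finite_bubbleAlt k ℓ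
    exact ⟨finite_of_le (hB F.1), rfl⟩
  have hBcell : ∀ F, B F ≤ cellAlt k ℓ F := fun F b hb => (mem_bubbleAlt.1 (hB F hb)).1
  have hsep : ∀ ω ∈ X,
      (∀ (i : K.powersetCard (k + 1) × TraceIndex k ℓ p)
        (b : FormTanNor i.1.1 k i.2.q i.2.r), skeletalDof i.2.nor i.1.1 ω b = 0) →
      (∀ (F : {F ∈ K.powerset | ℓ + p + 1 ≤ F.card}) (b : B F.1), bubbleDof F.1 ω b = 0) →
      ω = 0 := fun ω hω h1 h2 =>
    DofsVanish.eq_zero hK (hX hω) (hXB ω hω) (DofsVanish.of_powersetCard h1 h2)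
  have hdim := sum_choose_add_sum_finrank_le hK hcount hle
  have key := existsUnique_of_separating (M := Form n k ℓ)
    (I := K.powersetCard (k + 1) × TraceIndex k ℓ p)
    (J := ({F ∈ K.powerset | ℓ + p + 1 ≤ F.card} : Finset (Finset (Euc n))))
    (D := fun i => FormTanNor i.1.1 k i.2.q i.2.r)
    (x := fun i => k.choose i.2.q * (n - k).choose i.2.r)
    (fun i => (hσ i.1).some.finite_and_finrank_formTanNor i.2.q i.2.r)
    (E := fun F => B F.1) (y := fun F => Module.finrank ℝ (B F.1)) hfin
    (X := X) (φ := fun i => skeletalDof i.2.nor i.1.1)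
    (fun i => (hσ i.1).some.isBilinOn_skeletalDof hX i.2.nor)
    (ψ := fun F ω b => bubbleDof F.1 ω b)
    (fun F => (hF F).some.isBilinOn_bubbleDof hX (hBcell F.1)) hsep hdim
    (fun i => c i.1.1 i.2) (fun F => d F.1)
  refine (existsUnique_congr fun ω => and_congr_right fun _ => and_congr ⟨?_, ?_⟩ ⟨?_, ?_⟩).1 key
  · intro h τ hτ hne hdimτ j
    have hτK : τ ∈ K.powersetCard (k + 1) := Finset.mem_powersetCard.2 ⟨hτ, by
      rw [← hdimτ, dim, Nat.sub_add_cancel hne.card_pos]⟩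
    exact h (⟨τ, hτK⟩, j)
  · intro h i
    have h1 := Finset.mem_powersetCard.1 i.1.2
    exact h i.1.1 h1.1 (Finset.card_pos.1 (by omega)) (by rw [dim, h1.2, Nat.add_sub_cancel]) i.2
  · intro h F hFK hne hdimF
    have hFS : F ∈ {F ∈ K.powerset | ℓ + p + 1 ≤ F.card} :=
      Finset.mem_filter.2 ⟨Finset.mem_powerset.2 hFK, by
        rw [dim] at hdimF; have := hne.card_pos; omega⟩
    exact h ⟨F, hFS⟩
  · intro h F
    have h1 := Finset.mem_filter.1 F.2
    exact h F.1 (Finset.mem_powerset.1 h1.1) (Finset.card_pos.1 (by omega)) (by rw [dim]; omega)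

end Unisolvency

/-! ### Conformity -/

section Conformity

variable {k ℓ : ℕ}

/-- The difference of the two polynomial pieces lies in `X`, and its degrees of freedom vanish on
every subsimplex of the shared simplex, so the vanishing principle applies there. -/
theorem isConforming_of_mem_feSpace {p : ℕ} {X : Submodule ℝ (Form n k ℓ)}
    (hX : X ≤ shapeAlt n k ℓ) {B : ∀ σ : Finset (Euc n), Submodule ℝ (CellForm k ℓ σ)}
    (hB : ∀ F, B F ≤ bubbleAlt k ℓ F)
    (hXB : ∀ η ∈ X, ∀ F, doubleTrace F η ∈ bubbleAlt k ℓ F → doubleTrace F η ∈ B F)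
    (T : Geometry.SimplicialComplex ℝ (Euc n)) {ω : Cells T → Form n k ℓ}
    (hω : ω ∈ feSpace p X B T) : IsConforming p T ω := by
  intro K K' σ hne hσ hσ'
  have hsimp : IsSimplex σ (dim σ) := K.2.2.subset hσ hne
  have hXK := hω.1 K
  have hXK' := hω.1 K'
  set η : Form n k ℓ := ω K + (-1 : ℝ) • ω K' with hη
  have hηX : η ∈ X := X.add_mem hXK (X.smul_mem _ hXK')
  have hvan : DofsVanish p B σ η := by
    refine ⟨fun τ hτ hτne hdim j b => ?_, fun F hF hFne hdim b hb => ?_⟩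
    · obtain ⟨c⟩ := (hsimp.subset hτ hτne).nonempty_vertices
      rw [hη, c.skeletalDof_add _ (hX hXK) (hX (X.smul_mem _ hXK')), skeletalDof_smul,
        (hω.2 K K' τ hτne (hτ.trans hσ) (hτ.trans hσ')).1 hdim j b]
      ring
    · obtain ⟨c⟩ := (hsimp.subset hF hFne).nonempty_vertices
      rw [hη, c.bubbleDof_add (hX hXK) (hX (X.smul_mem _ hXK')) (mem_bubbleAlt.1 (hB F hb)).1,
        bubbleDof_smul, (hω.2 K K' F hFne (hF.trans hσ) (hF.trans hσ')).2 hdim b hb]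
      ring
  refine ⟨fun _ j => ?_, fun _ => ?_⟩
  · have h := hvan.mixedTrace_eq_zero hsimp (hX hηX) j
    rw [hη, mixedTrace_add, mixedTrace_smul] at h
    exact eq_of_add_neg_one_smul h
  · have h := hvan.doubleTrace_eq_zero hsimp hne (hX hηX) (hXB η hηX)
    rw [hη, doubleTrace_add, doubleTrace_smul] at h
    exact eq_of_add_neg_one_smul h

end Conformity

end FormValued

end

/-! ### Unisolvency, counts and conformity for both families -/

theorem mainTheorem6 (n k ℓ p : ℕ) (hp : 1 ≤ p) (hk : k ≤ ℓ + p - 1) :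
    (∀ K : Finset (FormValued.Euc n), FormValued.IsSimplex K n →
      (FormValued.IsUnisolvent p (FormValued.shapeAlt n k ℓ) (FormValued.bubbleAlt k ℓ) K ∧
        FormValued.CountsMatch p (FormValued.bubbleAlt (n := n) k ℓ) K) ∧
      (FormValued.IsUnisolvent p (FormValued.shapeW n k ℓ p) (FormValued.bubbleW k ℓ p) K ∧
        FormValued.CountsMatch p (FormValued.bubbleW (n := n) k ℓ p) K)) ∧
    (∀ (T : Geometry.SimplicialComplex ℝ (FormValued.Euc n))
      (ω : FormValued.Cells T → FormValued.Form n k ℓ),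
      (ω ∈ FormValued.feSpace p (FormValued.shapeAlt n k ℓ) (FormValued.bubbleAlt k ℓ) T →
        FormValued.IsConforming p T ω) ∧
      (ω ∈ FormValued.feSpace p (FormValued.shapeW n k ℓ p) (FormValued.bubbleW k ℓ p) T →
        FormValued.IsConforming p T ω)) := by
  refine ⟨fun K hK => ⟨⟨?_, FormValued.countsMatch_bubbleAlt hK k ℓ p⟩,
    ⟨?_, FormValued.countsMatch_bubbleW hK k ℓ p⟩⟩, fun T ω => ⟨fun hω => ?_, fun hω => ?_⟩⟩
  · exact FormValued.isUnisolvent_of_countsMatch hK le_rfl (fun F => le_rfl) (fun η _ F h => h)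
      (FormValued.countsMatch_bubbleAlt hK k ℓ p) (FormValued.sum_finrank_bubbleAlt hK k ℓ).le
  · exact FormValued.isUnisolvent_of_countsMatch hK inf_le_left (fun F => inf_le_left)
      (fun η hη F h => FormValued.doubleTrace_mem_bubbleW hη F h)
      (FormValued.countsMatch_bubbleW hK k ℓ p)
      -- The bound `k ≤ ℓ + p - 1` involves truncated subtraction; it yields `k + 1 ≤ ℓ + p` thanks
      -- to `1 ≤ p`.
      (FormValued.sum_finrank_bubbleW_le hK (by omega))
  · exact FormValued.isConforming_of_mem_feSpace le_rfl (fun F => le_rfl) (fun η _ F h => h) T hω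
  · exact FormValued.isConforming_of_mem_feSpace inf_le_left (fun F => inf_le_left)
      (fun η hη F h => FormValued.doubleTrace_mem_bubbleW hη F h) T hω
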